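/- **Setting.** Let $N\ge 2$, $m,n\in\mathbb Z$ with $n\neq 0$, and let $\zeta,\tau,c\in\mathbb C$ satisfy $\mathrm{Im}\,\zeta>0$, $\mathrm{Im}\,\tau>0$, $\mathrm{Im}\,\tau^*>0$, where $\tau^*=\tau-c\zeta$. Put $q=e^{i\pi\zeta}$, $p=e^{2i\pi\tau}$, $p^{1/2}=e^{i\pi\tau}$, $p^*=pq^{-2c}=e^{2i\pi\tau^*}$, $p^{*1/2}=e^{i\pi\tau^*}$, $\omega=e^{2i\pi/N}$. Spectral parameters are written $z=e^{i\pi\xi}$; powers $z^{2/N}$ and $q^{2/N}$ mean $e^{2i\pi\xi/N}$ and $e^{2i\pi\zeta/N}$, and multiplying $z$ by $-p^{1/2}$ (resp. $-p^{*1/2}$, $q$) means adding $\tau+1$ (resp. $\tau^*+1$, $\zeta$) to $\xi$. For $N=2$ everything depends on $z$ only. Let $(z;p)_\infty=\prod_{k\ge0}(1-zp^k)$, $(z;p,a)_\infty=\prod_{k,l\ge 0}(1-zp^ka^l)$, $\Theta_a(z)=(z;a)_\infty(az^{-1};a)_\infty(a;a)_\infty$ and $\vartheta[\gamma_1,\gamma_2](\xi,\tau)=\sum_{k\in\mathbb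 Z}\exp\big(i\pi(k+\gamma_1)^2\tau+2i\pi(k+\gamma_1)(\xi+\gamma_2)\big)$. Let $g=\mathrm{diag}(\omega,\dots,\omega^N)$, $g^{1/2}=\mathrm{diag}(\omega^{1/2},\dots,\omega^{N/2})$, $h_{ij}=\delta_{i+1,j}$ (indices mod $N$), $I_\alpha=g^{\alpha_2}h^{\alpha_1}$, $\Gamma=g^{1/2}hg^{1/2}$. The elliptic $R$-matrix is $R(z,q,p)=(g^{1/2}\otimes g^{1/2})\,\mathcal Z\,(g^{-1/2}\otimes g^{-1/2})$ with $$\mathcal Z=\frac{z^{2/N-2}}{\kappa(z^2)}\,\frac{\vartheta[\frac12,\frac12](\zeta,\tau)}{\vartheta[\frac12,\frac12](\xi+\zeta,\tau)}\sum_{\alpha\in\{0,\dots,N-1\}^2}\frac{\vartheta[\frac12+\frac{\alpha_1}N,\frac12+\frac{\alpha_2}N](\xi+\frac\zeta N,\tau)}{N\,\vartheta[\frac12+\frac{\alpha_1}N,\frac12+\frac{\alpha_2}N](\frac\zeta N,\tau)}\,I_\alpha\otimes I_\alpha^{-1}$$ (removable singularities in $\zeta$ being filled in), $$\frac1{\kappa(z^2)}=\frac{(q^{2N}z^{-2};p,q^{2N})_\infty(q^2z^2;p,q^{2N})_\infty(pz^{-2};p,q^{2N})_\infty(pq^{2N-2}z^2;p,q^{2N})_\infty}{(q^{2N}z^2;p,q^{2N})_\infty(q^2z^{-2};p,q^{2N})_\infty(pz^2;p,q^{2N})_\infty(pq^{2N-2}z^{-2};p,q^{2N})_\infty}.$$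 Put $\widehat R(z)=\tau_N(q^{1/2}z^{-1})R(z,q,p)$ with $\tau_N(x)=x^{2/N-2}\,\Theta_{q^{2N}}(qx^2)/\Theta_{q^{2N}}(qx^{-2})$, and let $\widehat R^*$ be $\widehat R$ with $\tau$ replaced by $\tau^*$. The algebra $\mathcal A_{q,p}(\widehat{gl}(N)_c)$ is the unital associative $\mathbb C$-algebra generated by the entries of the matrices $L(z)$ and $L(z)^{-1}$, where $z$ runs over the curve of pairs $(z,z^{2/N})$ ($z\in\mathbb C^*$ if $N=2$), subject to $L(z)L(z)^{-1}=L(z)^{-1}L(z)=\mathbb I$ and $$\widehat R_{12}(z/w)\,L_1(z)\,L_2(w)=L_2(w)\,L_1(z)\,\widehat R^*_{12}(z/w)$$ at all $z/w$ where $\widehat R$ and $\widehat R^*$ are holomorphic and invertible and, for each of them, the partial transposes of the matrix and of its inverse are invertible (that is, outside a closed discrete set of $\log(z/w)$). Below, exchange relations and the formula for $\mathcal Y_{mn}$ in (d) are identities of meromorphic functions of $z/w$ (resp. $x$): they hold outside a closed discrete set of $\log(z/w)$ (resp. $\log x$) which is independent of $w$. **Theorem.** Suppose that the parameters lie on the surface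 $$\mathscr S_{mn}:\quad(-p^{1/2})^m(-p^{*1/2})^n=q^{-N}$$ (for $N>2$ also with compatible branches: $e^{2i\pi(m(\tau+1)+n(\tau^*+1))/N}=e^{-2i\pi\zeta}$, which for $N=2$ is the same equation). Define $$t_{mn}(z)=\mathrm{tr}\big(\Gamma^{-m}L((-p^{*1/2})^nz)\,\Gamma^{-n}L(z)^{-1}\big),\qquad t^*_{-n,-m}(z)=\mathrm{tr}\big(\Gamma^{n}L((-p^{1/2})^{-m}z)^{-1}\,\Gamma^{m}L(z)\big),$$ $$\mathcal U(x)=q^{\frac2N-2}\frac{\Theta_{q^{2N}}(q^2x^2)\Theta_{q^{2N}}(q^2x^{-2})}{\Theta_{q^{2N}}(x^2)\Theta_{q^{2N}}(x^{-2})},\qquad \mathcal F_a(x)=\begin{cases}\prod_{k=0}^{a-1}\mathcal U((-p^{1/2})^kx)&a\ge0,\\ \prod_{k=1}^{|a|}\mathcal U((-p^{1/2})^{-k}x)^{-1}&a<0,\end{cases}$$ $\mathcal F^*_a=\mathcal F_a|_{p\to p^*}$, and $\mathcal Y_{mn}(x)=\dfrac{\mathcal F^*_n(x)\mathcal F^*_{-n}(x)}{\mathcal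 F_m(x)\mathcal F_{-m}(x)}$. Then: (a) $t_{mn}(z)L(w)=\dfrac{\mathcal F_{-m}(z/w)}{\mathcal F^*_n(z/w)}L(w)t_{mn}(z)$ and $t^*_{-n,-m}(z)L(w)=\dfrac{\mathcal F^*_n(z/w)}{\mathcal F_{-m}(z/w)}L(w)t^*_{-n,-m}(z)$; (b) $t_{mn}(z)t_{mn}(w)=\mathcal Y_{mn}(z/w)\,t_{mn}(w)t_{mn}(z)$, $\;t^*_{-n,-m}(z)t^*_{-n,-m}(w)=\mathcal Y_{mn}(z/w)\,t^*_{-n,-m}(w)t^*_{-n,-m}(z)$, $\;t_{mn}(z)t^*_{-n,-m}(w)=\mathcal Y_{mn}(z/w)^{-1}\,t^*_{-n,-m}(w)t_{mn}(z)$; (c) for $a>0$, $$\mathcal F_a(x)=q^{a(\frac2N-2)}\prod_{k=0}^{a-1}\frac{\Theta_{q^{2N}}(q^2p^kx^2)\Theta_{q^{2N}}(q^2p^{-k}x^{-2})}{\Theta_{q^{2N}}(p^kx^2)\Theta_{q^{2N}}(p^{-k}x^{-2})},\quad \mathcal F_{-a}(x)=q^{-a(\frac2N-2)}\prod_{k=1}^{a}\frac{\Theta_{q^{2N}}(p^{-k}x^2)\Theta_{q^{2N}}(p^kx^{-2})}{\Theta_{q^{2N}}(q^2p^{-k}x^2)\Theta_{q^{2N}}(q^2p^kx^{-2})},$$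 the same holds for $\mathcal F^*$ with $p^*$ in place of $p$, and $\mathcal Y_{mn}=\mathcal Y_{-m,-n}$; (d) if $N=2$, then $\mathcal Y_{mn}(x)=\dfrac{g_{mn}(x^2)}{g_{mn}(x^{-2})}$ with $$g_{mn}(z)=\frac{g^{(|m|)}(z)}{g^{*(|n|)}(z)}\Big(\prod_{k=1}^{|m|-1}g^{(k)}(z)\Big)^2\Big(\prod_{k=1}^{|n|-1}g^{*(k)}(z)\Big)^{-2},$$ where, for $k\ge0$, $g^{(k)}$ is the meromorphic function on $\mathbb C$ which for $|z|<|p|^k$ equals $$g^{(k)}(z)=\exp\Big(-\sum_{\ell\ge1}\frac{(1-p^{-k\ell})(1-(p^kq^2)^\ell)}{1+q^{2\ell}}\frac{z^\ell}{\ell}\Big),$$ and $g^{*(k)}=g^{(k)}|_{p\to p^*}$ (in particular these meromorphic continuations exist). -/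

import Mathlib

open scoped Kronecker Topology

noncomputable section

namespace EllipticGL

/-!
All spectral and structural parameters are described by their logarithms
`z = e^{iπξ}`, `q = e^{iπζ}`, `p = e^{2iπτ}`, `p^{1/2} = e^{iπτ}`, which fixes the branches of the
fractional powers `z^{2/N}`, `q^{2/N}`, `p^{1/2}` occurring in the elliptic R-matrix.
-/

/-- `ePi x = e^{iπx}`. -/
def ePi (x : ℂ) : ℂ := Complex.exp (Complex.I * Real.pi * x)

/-! ### Theta functions and infinite products -/

/-- The Jacobi theta function with characteristics `(γ₁, γ₂)`. -/
def thetaChar (γ₁ γ₂ ξ τ : ℂ) : ℂ :=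
  ∑' m : ℤ, Complex.exp (Complex.I * Real.pi * (m + γ₁) ^ 2 * τ
    + 2 * Complex.I * Real.pi * (m + γ₁) * (ξ + γ₂))

/-- `(z; p)_∞`. -/
def qPoch (z p : ℂ) : ℂ := ∏' n : ℕ, (1 - z * p ^ n)

/-- `(z; p₁, p₂)_∞`. -/
def qPoch₂ (z p₁ p₂ : ℂ) : ℂ := ∏' n : ℕ × ℕ, (1 - z * p₁ ^ n.1 * p₂ ^ n.2)

/-- `Θ_p(z) = (z; p)_∞ (p z⁻¹; p)_∞ (p; p)_∞`. -/
def Theta (p z : ℂ) : ℂ := qPoch z p * qPoch (p * z⁻¹) p * qPoch p p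

/-! ### The matrices `g`, `g^{1/2}`, `h` (the index `i : Fin N` stands for `i + 1 ∈ {1, …, N}`) -/

/-- `g = diag(ω, ω², …, ω^N)` with `ω = e^{2iπ/N}`. -/
def gMat (N : ℕ) : Matrix (Fin N) (Fin N) ℂ :=
  Matrix.diagonal fun i => ePi (2 * ((i : ℕ) + 1) / N)

/-- `g^{1/2} = diag(ω^{1/2}, ω, …, ω^{N/2})` with `ω^{1/2} = e^{iπ/N}`. -/
def gHalf (N : ℕ) : Matrix (Fin N) (Fin N) ℂ :=
  Matrix.diagonal fun i => ePi (((i : ℕ) + 1) / N)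

/-- `h_{ij} = δ_{i+1,j}`, indices modulo `N`. -/
def hMat (N : ℕ) : Matrix (Fin N) (Fin N) ℂ :=
  Matrix.of fun i j => if ((i : ℕ) + 1) % N = (j : ℕ) then 1 else 0

/-- `g^{1/2} h g^{1/2}`. -/
def gammaMat (N : ℕ) : Matrix (Fin N) (Fin N) ℂ := gHalf N * hMat N * gHalf N

/-- `I_{(α₁,α₂)} = g^{α₂} h^{α₁}`. -/
def IMat (N : ℕ) (α : Fin N × Fin N) : Matrix (Fin N) (Fin N) ℂ :=
  gMat N ^ (α.2 : ℕ) * hMat N ^ (α.1 : ℕ)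

/-! ### The elliptic R-matrix -/

/-- The normalisation `1/κ(z²)`, `z = e^{iπξ}`. -/
def kappaInv (N : ℕ) (ζ τ ξ : ℂ) : ℂ :=
  let q := ePi ζ
  let p := ePi (2 * τ)
  let y := ePi (2 * ξ)
  let a := q ^ (2 * N)
  (qPoch₂ (a * y⁻¹) p a * qPoch₂ (q ^ 2 * y) p a * qPoch₂ (p * y⁻¹) p a
      * qPoch₂ (p * q ^ (2 * N - 2) * y) p a)
    / (qPoch₂ (a * y) p a * qPoch₂ (q ^ 2 * y⁻¹) p a * qPoch₂ (p * y) p a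
      * qPoch₂ (p * q ^ (2 * N - 2) * y⁻¹) p a)

/-- The theta function with characteristics `(1/2 + α₁/N, 1/2 + α₂/N)`. -/
def thetaAlpha (N : ℕ) (α : Fin N × Fin N) (ξ τ : ℂ) : ℂ :=
  thetaChar (1 / 2 + (α.1 : ℕ) / N) (1 / 2 + (α.2 : ℕ) / N) ξ τ

/-- `ϑ[1/2,1/2](ζ,τ) / (N ϑ[1/2+α₁/N,1/2+α₂/N](ζ/N,τ))`. When `q²` is an integral power of `p` the
ratio is `0/0` for one `α`; the singularity is removable and the limit is taken, so that the
R-matrix is defined for every `ζ`. At all other `ζ` the limit is the value. -/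
def thetaRatio (N : ℕ) (α : Fin N × Fin N) (ζ τ : ℂ) : ℂ :=
  Filter.limUnder (𝓝[≠] ζ) fun ζ' : ℂ => thetaChar (1 / 2) (1 / 2) ζ' τ / (N * thetaAlpha N α (ζ' / N) τ)

/-- The `ℤ_N`-vertex model matrix `𝒵(z,q,p)`. -/
def ZMat (N : ℕ) (ζ τ ξ : ℂ) : Matrix (Fin N × Fin N) (Fin N × Fin N) ℂ :=
  (ePi (ξ * (2 / N - 2)) * kappaInv N ζ τ ξ / thetaChar (1 / 2) (1 / 2) (ξ + ζ) τ) •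
    ∑ α : Fin N × Fin N,
      (thetaRatio N α ζ τ * thetaAlpha N α (ξ + ζ / N) τ) • (IMat N α ⊗ₖ (IMat N α)⁻¹)

/-- `R(z,q,p) = (g^{1/2} ⊗ g^{1/2}) 𝒵(z,q,p) (g^{-1/2} ⊗ g^{-1/2})`. -/
def RMat (N : ℕ) (ζ τ ξ : ℂ) : Matrix (Fin N × Fin N) (Fin N × Fin N) ℂ :=
  (gHalf N ⊗ₖ gHalf N) * ZMat N ζ τ ξ * ((gHalf N)⁻¹ ⊗ₖ (gHalf N)⁻¹)

/-- `τ_N(x) = x^{2/N-2} Θ_{q^{2N}}(q x²) / Θ_{q^{2N}}(q x⁻²)` at `x = e^{iπu}`. -/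
def tauN (N : ℕ) (ζ u : ℂ) : ℂ :=
  ePi (u * (2 / N - 2)) *
    (Theta (ePi ζ ^ (2 * N)) (ePi (ζ + 2 * u)) / Theta (ePi ζ ^ (2 * N)) (ePi (ζ - 2 * u)))

/-- `R̂(z,q,p) = τ_N(q^{1/2} z⁻¹) R(z,q,p)`. -/
def RHat (N : ℕ) (ζ τ ξ : ℂ) : Matrix (Fin N × Fin N) (Fin N × Fin N) ℂ :=
  tauN N ζ (ζ / 2 - ξ) • RMat N ζ τ ξ

/-- Transposition in the first tensor factor. -/
def transpose₁ {N : ℕ} (X : Matrix (Fin N × Fin N) (Fin N × Fin N) ℂ) :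
    Matrix (Fin N × Fin N) (Fin N × Fin N) ℂ :=
  Matrix.of fun a b => X (b.1, a.2) (a.1, b.2)

/-- `x` is a regular point of `R̂`: there `R̂` is holomorphic and invertible, as are the partial
transposes of `R̂` and of its inverse. This fails only on a closed discrete set of `x`. -/
def IsRegular (N : ℕ) (ζ τ x : ℂ) : Prop :=
  (∀ a b, AnalyticAt ℂ (fun ξ => RHat N ζ τ ξ a b) x) ∧
    IsUnit (RHat N ζ τ x) ∧ IsUnit (transpose₁ (RHat N ζ τ x)) ∧
    IsUnit (transpose₁ (RHat N ζ τ x)⁻¹)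

/-! ### The elliptic quantum algebra -/

/-- `p^* = p q^{-2c}`, that is `τ^* = τ - c ζ`; also `p^{*1/2} = p^{1/2} q^{-c}`. -/
def tauStar (ζ τ c : ℂ) : ℂ := τ - c * ζ

/-- `u` and `v` are logarithms of the same point of the curve on which the R-matrix is
single-valued: `e^{iπu} = e^{iπv}` and the values of `z^{2/N}` agree. For `N = 2` this is just
`e^{iπu} = e^{iπv}`. -/
def SamePoint (N : ℕ) (u v : ℂ) : Prop :=
  ePi u = ePi v ∧ ePi (2 * u / N) = ePi (2 * v / N)

/-- The generators: the entries of `L(z)` and of `L(z)⁻¹`, `z = e^{iπu}`. -/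
inductive Gen (N : ℕ) : Type
  | L (u : ℂ) (i j : Fin N) : Gen N
  | Linv (u : ℂ) (i j : Fin N) : Gen N

/-- `X₁ = X ⊗ 𝕀`. -/
def first {N : ℕ} {A : Type*} [Ring A] (X : Matrix (Fin N) (Fin N) A) :
    Matrix (Fin N × Fin N) (Fin N × Fin N) A := X ⊗ₖ (1 : Matrix (Fin N) (Fin N) A)

/-- `X₂ = 𝕀 ⊗ X`. -/
def second {N : ℕ} {A : Type*} [Ring A] (X : Matrix (Fin N) (Fin N) A) :
    Matrix (Fin N × Fin N) (Fin N × Fin N) A := (1 : Matrix (Fin N) (Fin N) A) ⊗ₖ X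

/-- A complex matrix as a matrix over a `ℂ`-algebra. -/
def scal {ι : Type*} (A : Type*) [Ring A] [Algebra ℂ A] (X : Matrix ι ι ℂ) : Matrix ι ι A :=
  X.map (algebraMap ℂ A)

/-- `L(z)` in the free algebra. -/
def freeL (N : ℕ) (u : ℂ) : Matrix (Fin N) (Fin N) (FreeAlgebra ℂ (Gen N)) :=
  Matrix.of fun i j => FreeAlgebra.ι ℂ (Gen.L u i j)

/-- `L(z)⁻¹` in the free algebra. -/
def freeLinv (N : ℕ) (u : ℂ) : Matrix (Fin N) (Fin N) (FreeAlgebra ℂ (Gen N)) :=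
  Matrix.of fun i j => FreeAlgebra.ι ℂ (Gen.Linv u i j)

/-- The defining relations: `L(z)` is a function of the point `z`, `L(z)⁻¹` is its inverse, and
`R̂₁₂(z/w) L₁(z) L₂(w) = L₂(w) L₁(z) R̂*₁₂(z/w)` (entry by entry, at the points `z/w = e^{iπ(u-v)}`
regular for `R̂` and `R̂*`). -/
inductive Rel (N : ℕ) (ζ τ c : ℂ) : FreeAlgebra ℂ (Gen N) → FreeAlgebra ℂ (Gen N) → Prop
  | point (u v : ℂ) (h : SamePoint N u v) (i j : Fin N) :
      Rel N ζ τ c (freeL N u i j) (freeL N v i j)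
  | mul_inv (u : ℂ) (i j : Fin N) :
      Rel N ζ τ c ((freeL N u * freeLinv N u) i j)
        ((1 : Matrix (Fin N) (Fin N) (FreeAlgebra ℂ (Gen N))) i j)
  | inv_mul (u : ℂ) (i j : Fin N) :
      Rel N ζ τ c ((freeLinv N u * freeL N u) i j)
        ((1 : Matrix (Fin N) (Fin N) (FreeAlgebra ℂ (Gen N))) i j)
  | rll (u v : ℂ) (h : IsRegular N ζ τ (u - v)) (h' : IsRegular N ζ (tauStar ζ τ c) (u - v))
      (a b : Fin N × Fin N) :
      Rel N ζ τ c
        ((scal (FreeAlgebra ℂ (Gen N)) (RHat N ζ τ (u - v))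
          * first (freeL N u) * second (freeL N v)) a b)
        ((second (freeL N v) * first (freeL N u)
          * scal (FreeAlgebra ℂ (Gen N)) (RHat N ζ (tauStar ζ τ c) (u - v))) a b)

/-- The elliptic quantum algebra `𝒜_{q,p}(ĝl(N)_c)`. -/
abbrev EllAlg (N : ℕ) (ζ τ c : ℂ) : Type := RingQuot (Rel N ζ τ c)

/-- The class of a generator. -/
def gen (N : ℕ) (ζ τ c : ℂ) (x : Gen N) : EllAlg N ζ τ c :=
  RingQuot.mkAlgHom ℂ (Rel N ζ τ c) (FreeAlgebra.ι ℂ x)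

/-- The Lax matrix `L(z)`, `z = e^{iπu}`. -/
def LMat (N : ℕ) (ζ τ c u : ℂ) : Matrix (Fin N) (Fin N) (EllAlg N ζ τ c) :=
  Matrix.of fun i j => gen N ζ τ c (Gen.L u i j)

/-- The inverse `L(z)⁻¹`. -/
def LInv (N : ℕ) (ζ τ c u : ℂ) : Matrix (Fin N) (Fin N) (EllAlg N ζ τ c) :=
  Matrix.of fun i j => gen N ζ τ c (Gen.Linv u i j)

/-- `(g^{1/2} h g^{1/2})^k` over the elliptic quantum algebra. -/
def gammaPow (N : ℕ) (ζ τ c : ℂ) (k : ℤ) : Matrix (Fin N) (Fin N) (EllAlg N ζ τ c) :=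
  scal (EllAlg N ζ τ c) (gammaMat N ^ k)

/-- `t_{mn}(z) = tr((g^{1/2}hg^{1/2})^{-m} L((-p^{*1/2})^n z) (g^{1/2}hg^{1/2})^{-n} L(z)⁻¹)`;
the logarithm of `-p^{*1/2}` is `τ^* + 1`. -/
def t (N : ℕ) (ζ τ c : ℂ) (m n : ℤ) (u : ℂ) : EllAlg N ζ τ c :=
  (gammaPow N ζ τ c (-m) * LMat N ζ τ c (u + n * (tauStar ζ τ c + 1))
    * gammaPow N ζ τ c (-n) * LInv N ζ τ c u).trace

/-- `t^*_{ab}(z) = tr((g^{1/2}hg^{1/2})^{-a} L((-p^{1/2})^b z)⁻¹ (g^{1/2}hg^{1/2})^{-b} L(z))`,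
used at `(a, b) = (-n, -m)`. -/
def tStar (N : ℕ) (ζ τ c : ℂ) (a b : ℤ) (u : ℂ) : EllAlg N ζ τ c :=
  (gammaPow N ζ τ c (-a) * LInv N ζ τ c (u + b * (τ + 1))
    * gammaPow N ζ τ c (-b) * LMat N ζ τ c u).trace

/-- The surface `(-p^{1/2})^m (-p^{*1/2})^n = q^{-N}`, together with the same relation for the
chosen values of the powers `2/N` (for `N = 2` the second relation repeats the first). -/
def OnSurface (N : ℕ) (ζ τ c : ℂ) (m n : ℤ) : Prop :=
  (-ePi τ) ^ m * (-ePi (tauStar ζ τ c)) ^ n = ePi ζ ^ (-(N : ℤ)) ∧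
    ePi (2 * (m * (τ + 1) + n * (tauStar ζ τ c + 1)) / N) = ePi (-(2 * ζ))

/-! ### Structure functions -/

/-- `𝒰(x)`, `x = e^{iπξ}`. -/
def UFun (N : ℕ) (ζ ξ : ℂ) : ℂ :=
  ePi (ζ * (2 / N - 2)) *
    ((Theta (ePi ζ ^ (2 * N)) (ePi ζ ^ 2 * ePi (2 * ξ))
        * Theta (ePi ζ ^ (2 * N)) (ePi ζ ^ 2 * ePi (-(2 * ξ))))
      / (Theta (ePi ζ ^ (2 * N)) (ePi (2 * ξ)) * Theta (ePi ζ ^ (2 * N)) (ePi (-(2 * ξ)))))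

/-- `𝓕_a(x)`, `x = e^{iπξ}`; `𝓕^*_a` is the same function with `τ` replaced by `τ^*`. -/
def FFun (N : ℕ) (ζ τ : ℂ) (a : ℤ) (ξ : ℂ) : ℂ :=
  if 0 ≤ a then ∏ k ∈ Finset.range a.natAbs, UFun N ζ (ξ + k * (τ + 1))
  else ∏ k ∈ Finset.Icc 1 a.natAbs, (UFun N ζ (ξ - k * (τ + 1)))⁻¹

/-- `𝒴_{mn} = 𝓕^*_n 𝓕^*_{-n} / (𝓕_m 𝓕_{-m})`. -/
def YFun (N : ℕ) (ζ τ c : ℂ) (m n : ℤ) (ξ : ℂ) : ℂ :=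
  (FFun N ζ (tauStar ζ τ c) n ξ * FFun N ζ (tauStar ζ τ c) (-n) ξ)
    / (FFun N ζ τ m ξ * FFun N ζ τ (-m) ξ)

/-- `G` is the meromorphic function on `ℂ` given near the origin, namely for `|z| < |p|^k`, by
`exp(-∑_{ℓ ≥ 1} (1 - p^{-kℓ}) (1 - (p^k q²)^ℓ) / (1 + q^{2ℓ}) z^ℓ / ℓ)`. -/
def IsGFun (p q : ℂ) (k : ℕ) (G : ℂ → ℂ) : Prop :=
  MeromorphicOn G Set.univ ∧
    ∀ z : ℂ, ‖z‖ < ‖p‖ ^ k → ∃ s : ℂ,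
      HasSum (fun l : ℕ => (1 - p⁻¹ ^ (k * (l + 1))) * (1 - (p ^ k * q ^ 2) ^ (l + 1))
        / (1 + q ^ (2 * (l + 1))) * (z ^ (l + 1) / ((l : ℂ) + 1))) s ∧
      G z = Complex.exp (-s)

/-- `g_{mn}`, built from the families `g^{(k)}` and `g^{*(k)}`. -/
def gFun (g gs : ℕ → ℂ → ℂ) (m n : ℤ) (z : ℂ) : ℂ :=
  g m.natAbs z * (gs n.natAbs z)⁻¹
    * (∏ k ∈ Finset.Ico 1 m.natAbs, g k z) ^ 2 * ((∏ k ∈ Finset.Ico 1 n.natAbs, gs k z) ^ 2)⁻¹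

end EllipticGL

end

namespace EllipticGL

/-! ### Exponentials -/

/-! The exchange relations rest on three properties of `RHat`, each holding off a discrete set of
arguments or everywhere. Quasi-periodicity (`RHat_add_zsmul`): the shift by `a(τ+1)` conjugates the
first factor by `Γ^a` and divides by `𝓕_a`. Crossing (`RHat_crossing`): the partial transposes of
`R̂(q^{-N}z)` and of `R̂(z)⁻¹` are inverse to each other. Single-valuedness
(`RHat_add_of_samePoint`): `R̂` lives on the curve of pairs `(z, z^{2/N})`. The Yang-Baxter equation
is not needed.

The surface condition says that `d = m(τ+1) + n(τ*+1) + Nζ` is a logarithm of the trivial point of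
that curve. Hence shifting by `n(τ*+1)` is the same as shifting by `-Nζ - m(τ+1)`. In the RLL
relation at the shifted point, `R̂*` becomes a `Γ`-conjugate of itself, while `R̂` becomes a
`Γ`-conjugate of `R̂(q^{-N}z)`. The powers of `Γ` inserted in `t_{mn}` absorb the conjugations, the
RLL relation for `L⁻¹` supplies `R̂⁻¹`, and the partial trace over the first factor removes both
matrices by crossing. What is left is the scalar `𝓕_{-m}/𝓕*_n` (`t_mul_LMat`); the starred trace is
the mirror image (`tStar_mul_LMat`). An element that exchanges with `L` by a scalar also exchanges
with `L⁻¹`, hence with traces of products, and the resulting ratio of shifted scalars is `𝒴` or its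
inverse (`exchange_t`, `exchange_tStar`).

The properties of `R̂` reduce to theta identities. Products of matrices `I_α ⊗ I_α⁻¹` are regrouped
by the Heisenberg group law into quadratic sums over `N`-torsion points. Such a sum is entire in the
spectral variable with the multipliers of a product of two theta functions, so two zeros fix it up
to a constant, and a wrong multiplier forces the constant to vanish (`IsTheta.eq_const_mul_mul`, by
Liouville). The zeros and constants come from one finite Fourier transform (`torsSum_chi_mul_wFun`).
These arguments need generic `ζ`; continuity in `ζ` gives the rest. The scalar prefactor is a
quotient of double products, and its two functional equations come from telescoping in each of the
two nomes.

For `N = 2`, `𝒰` is a monomial times the square of a theta quotient, so `𝓕_m 𝓕_{-m}` collapses to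
quotients `g^{(k)}(y)/g^{(k)}(1/y)` and one boundary term. On the surface the boundary terms at
`p^{|m|}` and `p*^{|n|}` match (`OnSurface.thetaQuot_eq`), and `gMero` is the explicit continuation
of the exponential series. -/

lemma ePi_add (x y : ℂ) : ePi (x + y) = ePi x * ePi y := by
  simp only [ePi, mul_add, Complex.exp_add]

lemma ePi_zero : ePi 0 = 1 := by simp [ePi]

lemma ePi_ne_zero (x : ℂ) : ePi x ≠ 0 := Complex.exp_ne_zero _

lemma ePi_neg (x : ℂ) : ePi (-x) = (ePi x)⁻¹ := by
  rw [ePi, mul_neg, Complex.exp_neg, ePi]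

lemma ePi_sub (x y : ℂ) : ePi (x - y) = ePi x / ePi y := by
  rw [sub_eq_add_neg, ePi_add, ePi_neg, div_eq_mul_inv]

lemma ePi_nat_mul (n : ℕ) (x : ℂ) : ePi (n * x) = ePi x ^ n := by
  rw [ePi, ePi, ← Complex.exp_nat_mul]; ring_nf

lemma ePi_int_mul (n : ℤ) (x : ℂ) : ePi (n * x) = ePi x ^ n := by
  rw [ePi, ePi, ← Complex.exp_int_mul]; ring_nf

lemma ePi_two_mul (x : ℂ) : ePi (2 * x) = ePi x ^ 2 := by
  simpa using ePi_nat_mul 2 x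

lemma ePi_one : ePi 1 = -1 := by
  rw [ePi, mul_one, mul_comm]; exact Complex.exp_pi_mul_I

lemma ePi_two : ePi 2 = 1 := by
  have := ePi_two_mul 1; rw [mul_one, ePi_one] at this; simpa using this

lemma ePi_two_mul_int (n : ℤ) : ePi (2 * n) = 1 := by
  rw [mul_comm, ePi_int_mul, ePi_two, one_zpow]

lemma ePi_two_mul_nat (n : ℕ) : ePi (2 * n) = 1 := by
  simpa using ePi_two_mul_int n

lemma norm_ePi (x : ℂ) : ‖ePi x‖ = Real.exp (-(Real.pi * x.im)) := by
  rw [ePi, Complex.norm_exp]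
  simp [mul_assoc]

lemma norm_ePi_lt_one {x : ℂ} (hx : 0 < x.im) : ‖ePi x‖ < 1 := by
  rw [norm_ePi, Real.exp_lt_one_iff]
  have := mul_pos Real.pi_pos hx
  linarith

lemma ePi_eq_one_iff {x : ℂ} : ePi x = 1 ↔ ∃ n : ℤ, x = 2 * n := by
  rw [ePi, Complex.exp_eq_one_iff]
  have hπ : (Real.pi : ℂ) ≠ 0 := by exact_mod_cast Real.pi_ne_zero
  refine exists_congr fun n => ?_
  constructor
  · intro h
    have : (Complex.I * Real.pi) * (x - 2 * n) = 0 := by linear_combination h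
    rcases mul_eq_zero.mp this with h | h
    · exact absurd h (mul_ne_zero Complex.I_ne_zero hπ)
    · linear_combination h
  · rintro rfl; ring

lemma differentiable_ePi : Differentiable ℂ ePi := by
  unfold ePi; fun_prop

lemma _root_.Differentiable.ePi {f : ℂ → ℂ} (hf : Differentiable ℂ f) :
    Differentiable ℂ fun x => ePi (f x) := differentiable_ePi.comp hf

lemma exists_ePi_eq {z : ℂ} (hz : z ≠ 0) : ∃ x, ePi x = z := by
  have hπ : (Real.pi : ℂ) ≠ 0 := by exact_mod_cast Real.pi_ne_zero
  refine ⟨Complex.log z / (Complex.I * Real.pi), ?_⟩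
  rw [ePi, mul_div_cancel₀ _ (mul_ne_zero Complex.I_ne_zero hπ), Complex.exp_log hz]

/-! ### Infinite products `∏ (1 - z uᵢ)` -/

section Products

variable {ι : Type*} {u : ι → ℂ}

lemma summable_norm_mul_left (hu : Summable fun i => ‖u i‖) (z : ℂ) :
    Summable fun i => ‖-(z * u i)‖ := by
  simpa using hu.mul_left ‖z‖

lemma multipliable_one_sub_mul (hu : Summable fun i => ‖u i‖) (z : ℂ) :
    Multipliable fun i => 1 - z * u i := by
  simpa [sub_eq_add_neg] using multipliable_one_add_of_summable (summable_norm_mul_left hu z)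

lemma tprod_one_sub_mul_ne_zero (hu : Summable fun i => ‖u i‖) {z : ℂ} (hz : ∀ i, z * u i ≠ 1) :
    ∏' i, (1 - z * u i) ≠ 0 := by
  have := tprod_one_add_ne_zero_of_summable (f := fun i => -(z * u i))
    (fun i h => hz i (by linear_combination -h)) (summable_norm_mul_left hu z)
  simpa [sub_eq_add_neg] using this

/-- On the ball of radius `‖z‖ + 1` the terms are dominated by a fixed summable sequence, so the
product converges locally uniformly and the limit is holomorphic there. -/
lemma differentiable_tprod_one_sub_mul (hu : Summable fun i => ‖u i‖) :
    Differentiable ℂ fun z => ∏' i, (1 - z * u i) := by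
  intro z
  have h := Summable.hasProdLocallyUniformlyOn_one_add (K := Metric.ball (0 : ℂ) (‖z‖ + 1))
    (f := fun i z => -(z * u i)) Metric.isOpen_ball (hu.mul_left (‖z‖ + 1))
    (.of_forall fun i x hx => by
      rw [norm_neg, norm_mul]
      exact mul_le_mul_of_nonneg_right (by simpa using (mem_ball_zero_iff.mp hx).le)
        (norm_nonneg _)) (fun i => by fun_prop)
  have h2 := h.differentiableOn (.of_forall fun s => by
    simpa [Finset.prod_fn] using DifferentiableOn.finsetProd (fun _ _ => by fun_prop))
    Metric.isOpen_ball
  simpa [sub_eq_add_neg] using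
    h2.differentiableAt (Metric.isOpen_ball.mem_nhds (mem_ball_zero_iff.mpr (lt_add_one ‖z‖)))

end Products

lemma summable_norm_pow {p : ℂ} (hp : ‖p‖ < 1) : Summable fun n : ℕ => ‖p ^ n‖ := by
  simpa using summable_geometric_of_lt_one (norm_nonneg p) hp

lemma summable_norm_pow_mul_pow {p a : ℂ} (hp : ‖p‖ < 1) (ha : ‖a‖ < 1) :
    Summable fun n : ℕ × ℕ => ‖p ^ n.1 * a ^ n.2‖ := by
  simpa using (summable_geometric_of_lt_one (norm_nonneg p) hp).mul_of_nonneg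
    (summable_geometric_of_lt_one (norm_nonneg a) ha) (fun _ => by positivity)
    (fun _ => by positivity)

section qPoch

variable {p a : ℂ}

lemma differentiable_qPoch (hp : ‖p‖ < 1) : Differentiable ℂ fun z => qPoch z p :=
  differentiable_tprod_one_sub_mul (summable_norm_pow hp)

lemma qPoch_zero (p : ℂ) : qPoch 0 p = 1 := by simp [qPoch]

lemma qPoch_ne_zero (hp : ‖p‖ < 1) {z : ℂ} (hz : ∀ n : ℕ, z * p ^ n ≠ 1) : qPoch z p ≠ 0 :=
  tprod_one_sub_mul_ne_zero (summable_norm_pow hp) hz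

lemma qPoch_eq_mul (hp : ‖p‖ < 1) (z : ℂ) : qPoch z p = (1 - z) * qPoch (p * z) p := by
  have h := multipliable_one_sub_mul (summable_norm_pow hp) (p * z)
  rw [qPoch, tprod_eq_zero_mul' (h.congr fun n => by ring)]
  simp only [pow_zero, mul_one, qPoch]
  congr 2; ext n; ring

lemma qPoch_ne_zero_of_norm_lt (hp : ‖p‖ < 1) {z : ℂ} (hz : ‖z‖ < 1) : qPoch z p ≠ 0 := by
  refine qPoch_ne_zero hp fun n h => ?_
  have h1 : ‖z * p ^ n‖ = 1 := by rw [h, norm_one]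
  rw [norm_mul, norm_pow] at h1
  have h2 : ‖z‖ * ‖p‖ ^ n ≤ ‖z‖ * 1 :=
    mul_le_mul_of_nonneg_left (pow_le_one₀ (norm_nonneg p) hp.le) (norm_nonneg z)
  linarith

lemma differentiable_qPoch₂ (hp : ‖p‖ < 1) (ha : ‖a‖ < 1) :
    Differentiable ℂ fun z => qPoch₂ z p a := by
  simpa [qPoch₂, mul_assoc] using
    differentiable_tprod_one_sub_mul (summable_norm_pow_mul_pow hp ha)

lemma qPoch₂_zero (p a : ℂ) : qPoch₂ 0 p a = 1 := by simp [qPoch₂]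

lemma qPoch₂_swap (z p a : ℂ) : qPoch₂ z p a = qPoch₂ z a p := by
  rw [qPoch₂, qPoch₂, ← (Equiv.prodComm ℕ ℕ).tprod_eq]
  congr 1; ext n
  simp only [Equiv.prodComm_apply, Prod.fst_swap, Prod.snd_swap]; ring

/-- Fubini for absolutely convergent products. Splitting off the first factor gives the functional
equation in `p`, and by symmetry the one in `a`. -/
lemma hasProd_qPoch₂ (hp : ‖p‖ < 1) (ha : ‖a‖ < 1) (z : ℂ) :
    HasProd (fun n : ℕ => qPoch (z * p ^ n) a) (qPoch₂ z p a) := by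
  have h1 := (multipliable_one_sub_mul (summable_norm_pow_mul_pow hp ha) z).hasProd
  have h2 : ∏' i : ℕ × ℕ, (1 - z * (p ^ i.1 * a ^ i.2)) = qPoch₂ z p a :=
    tprod_congr fun i => by rw [mul_assoc]
  rw [h2] at h1
  refine h1.prod_fiberwise fun n => ?_
  have h3 := (multipliable_one_sub_mul (summable_norm_pow ha) (z * p ^ n)).hasProd
  have h4 : (fun c : ℕ => 1 - z * (p ^ n * a ^ c)) = fun c => 1 - z * p ^ n * a ^ c := by
    funext c; rw [mul_assoc]
  exact h4 ▸ h3

lemma qPoch₂_eq_mul_left (hp : ‖p‖ < 1) (ha : ‖a‖ < 1) (z : ℂ) :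
    qPoch₂ z p a = qPoch z a * qPoch₂ (p * z) p a := by
  have h2 : HasProd (fun n : ℕ => qPoch (z * p ^ (n + 1)) a) (qPoch₂ (p * z) p a) := by
    have h3 : (fun n : ℕ => qPoch (z * p ^ (n + 1)) a) = fun n => qPoch (p * z * p ^ n) a := by
      funext n; rw [pow_succ']; congr 1; ring
    rw [h3]; exact hasProd_qPoch₂ hp ha (p * z)
  have h4 := tprod_eq_zero_mul' (f := fun n : ℕ => qPoch (z * p ^ n) a) h2.multipliable
  rw [(hasProd_qPoch₂ hp ha z).tprod_eq, h2.tprod_eq] at h4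
  simpa using h4

lemma qPoch₂_eq_mul_right (hp : ‖p‖ < 1) (ha : ‖a‖ < 1) (z : ℂ) :
    qPoch₂ z p a = qPoch z p * qPoch₂ (a * z) p a := by
  rw [qPoch₂_swap, qPoch₂_eq_mul_left ha hp, qPoch₂_swap]

/-! ### The product form of the theta function -/

/-- Multiplying `z` by `p` removes the factor `1 - z` from one product and adds `1 - z⁻¹` to the
other; their ratio is the multiplier. -/
lemma Theta_mul (hp : ‖p‖ < 1) (hp0 : p ≠ 0) {z : ℂ} (hz : z ≠ 0) :
    Theta p (p * z) = -z⁻¹ * Theta p z := by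
  have h1 := qPoch_eq_mul hp z
  have h2 := qPoch_eq_mul hp z⁻¹
  have h3 : p * (p * z)⁻¹ = z⁻¹ := by field_simp
  rw [Theta, Theta, h3, h1, h2]
  field_simp
  ring

lemma Theta_inv (hp : ‖p‖ < 1) {z : ℂ} (hz : z ≠ 0) :
    Theta p z⁻¹ = -z⁻¹ * Theta p z := by
  have h1 := qPoch_eq_mul hp z
  have h2 := qPoch_eq_mul hp z⁻¹
  rw [Theta, Theta, inv_inv, h1, h2]
  field_simp
  ring

lemma Theta_eq_zero (hp : ‖p‖ < 1) {z : ℂ} (hz : z ≠ 0) (h : Theta p z = 0) :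
    ∃ n : ℤ, z = p ^ n := by
  by_contra! hcon
  have hpp : qPoch p p ≠ 0 := qPoch_ne_zero_of_norm_lt hp hp
  have h1 : qPoch z p ≠ 0 := qPoch_ne_zero hp fun n hn => hcon (-n) <| by
    rw [zpow_neg, zpow_natCast]; exact eq_inv_of_mul_eq_one_left hn
  have h2 : qPoch (p * z⁻¹) p ≠ 0 := qPoch_ne_zero hp fun n hn => hcon (n + 1) <| by
    have : p ^ (n + 1) = z := by
      field_simp at hn; linear_combination hn
    rw [← this]; norm_cast
  exact mul_ne_zero (mul_ne_zero h1 h2) hpp h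

end qPoch

/-! ### Codiscrete sets of complex numbers -/

/-- The form used throughout: every point, exceptional or not, has a punctured neighbourhood on
which `P` holds. This makes translations and limits immediate. -/
lemma eventually_codiscrete_iff {P : ℂ → Prop} :
    (∀ᶠ x in Filter.codiscrete ℂ, P x) ↔ ∀ x, ∀ᶠ y in 𝓝[≠] x, P y := by
  rw [Filter.Eventually, mem_codiscrete]
  simp only [Filter.disjoint_principal_right, compl_compl]
  rfl

lemma eventually_codiscrete_add {P : ℂ → Prop} (h : ∀ᶠ x in Filter.codiscrete ℂ, P x) (d : ℂ) :
    ∀ᶠ x in Filter.codiscrete ℂ, P (x + d) := by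
  rw [eventually_codiscrete_iff] at h ⊢
  intro x
  have ht : Filter.Tendsto (fun y => y + d) (𝓝[≠] x) (𝓝[≠] (x + d)) := by
    refine tendsto_nhdsWithin_of_tendsto_nhds_of_eventually_within _ ?_ ?_
    · exact (continuous_add_const d).continuousAt.tendsto.mono_left nhdsWithin_le_nhds
    · filter_upwards [self_mem_nhdsWithin] with y hy hxy
      exact hy (add_right_cancel hxy)
  exact ht.eventually (h (x + d))

lemma eventually_codiscrete_sub {P : ℂ → Prop} (h : ∀ᶠ x in Filter.codiscrete ℂ, P x) (d : ℂ) :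
    ∀ᶠ x in Filter.codiscrete ℂ, P (x - d) := by
  simpa [sub_eq_add_neg] using eventually_codiscrete_add h (-d)

lemma eventually_ne_zero_of_differentiable {f : ℂ → ℂ} (hf : Differentiable ℂ f) {x : ℂ}
    (hx : f x ≠ 0) : ∀ᶠ y in Filter.codiscrete ℂ, f y ≠ 0 :=
  AnalyticOnNhd.preimage_zero_mem_codiscrete (fun y _ => hf.analyticAt y) hx

/-- If `E` is entire with `E 0 ≠ 0` then `E(b e^{2iπx})` vanishes only on a discrete set. -/
lemma eventually_comp_ePi_ne_zero {E : ℂ → ℂ} (hE : Differentiable ℂ E) (h0 : E 0 ≠ 0) (b k : ℂ)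
    (hk : k ≠ 0) : ∀ᶠ x in Filter.codiscrete ℂ, E (b * ePi (k * x)) ≠ 0 := by
  have hd : Differentiable ℂ fun x : ℂ => E (b * ePi (k * x)) :=
    hE.comp (((differentiable_id.const_mul k).ePi).const_mul b)
  -- The exponential omits only `0`, so a nonzero point near `0` where `E(b z)` does not vanish has
  -- a logarithm; one such point suffices by the identity theorem.
  have hc : ∀ᶠ z in 𝓝 (0 : ℂ), E (b * z) ≠ 0 := by
    have hcont : ContinuousAt (fun z => E (b * z)) 0 :=
      (hE.continuous.comp (continuous_const_mul b)).continuousAt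
    exact hcont.eventually_ne (by simpa using h0)
  obtain ⟨z, hz, hz0⟩ := ((hc.filter_mono nhdsWithin_le_nhds).and
    (self_mem_nhdsWithin (s := {(0 : ℂ)}ᶜ))).exists
  obtain ⟨x, hx⟩ := exists_ePi_eq hz0
  refine eventually_ne_zero_of_differentiable hd (x := k⁻¹ * x) ?_
  rwa [mul_inv_cancel_left₀ hk, hx]

/-! ### Quasi-periodic entire functions -/

/-- A codiscrete set is dense. This extends identities proved off the zeros of a denominator, in the
spectral variable as well as in `ζ`. -/
lemma eq_of_eventually_codiscrete {f g : ℂ → ℂ} (hf : Continuous f) (hg : Continuous g)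
    (h : ∀ᶠ x in Filter.codiscrete ℂ, f x = g x) (x : ℂ) : f x = g x := by
  have h1 := eventually_codiscrete_iff.mp h x
  have h2 : Filter.Tendsto f (𝓝[≠] x) (𝓝 (f x)) := hf.continuousAt.tendsto.mono_left nhdsWithin_le_nhds
  have h3 : Filter.Tendsto g (𝓝[≠] x) (𝓝 (g x)) := hg.continuousAt.tendsto.mono_left nhdsWithin_le_nhds
  exact tendsto_nhds_unique (h2.congr' h1) h3

lemma exists_lattice_decomposition {τ : ℂ} (hτ : 0 < τ.im) (x : ℂ) :
    ∃ (j k : ℤ) (r s : ℝ), r ∈ Set.Icc (0 : ℝ) 1 ∧ s ∈ Set.Icc (0 : ℝ) 1 ∧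
      x = (r * τ + s) + j * τ + k := by
  set σ : ℝ := x.im / τ.im with hσ
  set ρ : ℝ := x.re - σ * τ.re with hρ
  refine ⟨⌊σ⌋, ⌊ρ⌋, Int.fract σ, Int.fract ρ, ⟨Int.fract_nonneg _, (Int.fract_lt_one _).le⟩,
    ⟨Int.fract_nonneg _, (Int.fract_lt_one _).le⟩, ?_⟩
  have h1 : (Int.fract σ : ℝ) + (⌊σ⌋ : ℝ) = σ := by rw [add_comm]; exact Int.floor_add_fract σ
  have h2 : (Int.fract ρ : ℝ) + (⌊ρ⌋ : ℝ) = ρ := by rw [add_comm]; exact Int.floor_add_fract ρ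
  have h3 : ((Int.fract σ : ℝ) : ℂ) + (⌊σ⌋ : ℂ) = σ := by exact_mod_cast congrArg Complex.ofReal h1
  have h4 : ((Int.fract ρ : ℝ) : ℂ) + (⌊ρ⌋ : ℂ) = ρ := by exact_mod_cast congrArg Complex.ofReal h2
  have h5 : x = σ * τ + ρ := by
    apply Complex.ext
    · simp [hρ]
    · simp [hσ]; field_simp
  rw [h5, ← h3, ← h4]; ring

/-- Liouville: the norm is bounded by its maximum on a fundamental parallelogram. Only the norm has
to be periodic, so multipliers of modulus one are allowed. -/
lemma exists_const_of_norm_periodic {τ : ℂ} (hτ : 0 < τ.im) {f : ℂ → ℂ} (hf : Differentiable ℂ f)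
    (h1 : ∀ x, ‖f (x + 1)‖ = ‖f x‖) (h2 : ∀ x, ‖f (x + τ)‖ = ‖f x‖) : ∃ c, ∀ x, f x = c := by
  have hp1 : Function.Periodic (fun x => ‖f x‖) 1 := h1
  have hp2 : Function.Periodic (fun x => ‖f x‖) τ := h2
  refine hf.exists_const_forall_eq_of_bounded ?_
  have hK : IsCompact ((fun z : ℝ × ℝ => (z.1 * τ + z.2 : ℂ)) ''
      (Set.Icc (0 : ℝ) 1 ×ˢ Set.Icc (0 : ℝ) 1)) :=
    (isCompact_Icc.prod isCompact_Icc).image (by fun_prop)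
  obtain ⟨C, hC⟩ := hK.exists_bound_of_continuousOn hf.continuous.continuousOn
  refine isBounded_iff_forall_norm_le.mpr ⟨C, ?_⟩
  rintro _ ⟨x, rfl⟩
  obtain ⟨j, k, r, s, hr, hs, rfl⟩ := exists_lattice_decomposition hτ x
  have e1 := hp1.int_mul k (r * τ + s + j * τ)
  have e2 := hp2.int_mul j (r * τ + s)
  simp only [mul_one] at e1 e2
  rw [e1, e2]
  exact hC _ ⟨(r, s), ⟨hr, hs⟩, rfl⟩

/-- An entire function that is multiplied by constants under the translations by `1` and `τ` is
an exponential. -/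
lemma eq_zero_or_exponential {τ : ℂ} (hτ : 0 < τ.im) {f : ℂ → ℂ} (hf : Differentiable ℂ f)
    {α β : ℂ} (hα : α ≠ 0) (hβ : β ≠ 0) (h1 : ∀ x, f (x + 1) = α * f x)
    (h2 : ∀ x, f (x + τ) = β * f x) :
    (∀ x, f x = 0) ∨ ∃ l, α = ePi l ∧ β = ePi (l * τ) := by
  -- The imaginary and real parts of `l` are solved from `|e^{iπl}| = |α|` and `|e^{iπlτ}| = |β|`;
  -- dividing `f` by `e^{iπlx}` leaves multipliers of modulus one.
  set b : ℝ := -(Real.log ‖α‖) / Real.pi with hb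
  set a : ℝ := (-(Real.log ‖β‖) / Real.pi - b * τ.re) / τ.im with ha
  set l : ℂ := ⟨a, b⟩ with hl
  have n1 : ‖ePi l‖ = ‖α‖ := by
    rw [norm_ePi]
    have : -(Real.pi * l.im) = Real.log ‖α‖ := by
      simp only [hl, hb]; field_simp
    rw [this, Real.exp_log (norm_pos_iff.mpr hα)]
  have n2 : ‖ePi (l * τ)‖ = ‖β‖ := by
    rw [norm_ePi]
    have : -(Real.pi * (l * τ).im) = Real.log ‖β‖ := by
      simp only [Complex.mul_im, hl, ha]; field_simp; ring
    rw [this, Real.exp_log (norm_pos_iff.mpr hβ)]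
  obtain ⟨c, hc⟩ := exists_const_of_norm_periodic hτ (f := fun x => ePi (-(l * x)) * f x)
    (((differentiable_id.const_mul l).neg.ePi).mul hf)
    (fun x => by
      rw [h1, show -(l * (x + 1)) = -(l * x) + -l by ring, ePi_add, ePi_neg l]
      simp only [norm_mul, norm_inv, n1]
      have := norm_ne_zero_iff.mpr hα
      field_simp)
    (fun x => by
      rw [h2, show -(l * (x + τ)) = -(l * x) + -(l * τ) by ring, ePi_add, ePi_neg (l * τ)]
      simp only [norm_mul, norm_inv, n2]
      have := norm_ne_zero_iff.mpr hβ
      field_simp)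
  have hc' : ∀ x, f x = c * ePi (l * x) := fun x => by
    rw [← hc x, ePi_neg]; field_simp [ePi_ne_zero]
  by_cases hc0 : c = 0
  · exact Or.inl fun x => by rw [hc', hc0, zero_mul]
  · refine Or.inr ⟨l, ?_, ?_⟩
    · have := h1 0
      rw [hc', hc'] at this
      simp only [zero_add, mul_one, mul_zero, ePi_zero] at this
      exact (mul_left_cancel₀ hc0 (by linear_combination this)).symm
    · have := h2 0
      rw [hc', hc'] at this
      simp only [zero_add, mul_one, mul_zero, ePi_zero] at this
      exact (mul_left_cancel₀ hc0 (by linear_combination this)).symm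

/-- All zeros of `φ` are simple and shared by `F`, so the singularities of `F/φ` are removable, with
the value given by l'Hôpital's rule. -/
lemma exists_entire_quotient {F φ : ℂ → ℂ} (hF : Differentiable ℂ F) (hφ : Differentiable ℂ φ)
    (h0 : ∀ x, φ x = 0 → F x = 0) (h1 : ∀ x, φ x = 0 → deriv φ x ≠ 0) :
    ∃ h : ℂ → ℂ, Differentiable ℂ h ∧ (∀ x, F x = φ x * h x) ∧
      ∀ x, φ x = 0 → h x = deriv F x / deriv φ x := by
  classical
  refine ⟨fun x => if φ x = 0 then deriv F x / deriv φ x else F x / φ x, ?_, ?_, ?_⟩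
  · intro x
    by_cases hx : φ x = 0
    · have hds : ∀ {G : ℂ → ℂ}, Differentiable ℂ G → Differentiable ℂ (dslope G x) := fun hG =>
        differentiableOn_univ.mp
          ((Complex.differentiableOn_dslope Filter.univ_mem).mpr hG.differentiableOn)
      have hd0 : dslope φ x x ≠ 0 := by rw [dslope_same]; exact h1 x hx
      -- Near a zero the common factor `y - x` cancels, and `F/φ` becomes a quotient of difference
      -- quotients whose denominator does not vanish.
      have hdiff : DifferentiableAt ℂ (fun y => dslope F x y / dslope φ x y) x :=
        (hds hF x).div (hds hφ x) hd0
      refine hdiff.congr_of_eventuallyEq ?_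
      filter_upwards [(hds hφ).continuous.continuousAt.eventually_ne hd0] with y hy
      by_cases hyx : y = x
      · subst hyx; simp [hx, dslope_same]
      · have e1 := sub_smul_dslope F x y
        have e2 := sub_smul_dslope φ x y
        rw [h0 x hx, sub_zero, smul_eq_mul] at e1
        rw [hx, sub_zero, smul_eq_mul] at e2
        have hyx' : y - x ≠ 0 := sub_ne_zero.mpr hyx
        rw [if_neg (by rw [← e2]; exact mul_ne_zero hyx' hy), ← e1, ← e2,
          mul_div_mul_left _ _ hyx']
    · refine ((hF x).div (hφ x) hx).congr_of_eventuallyEq ?_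
      filter_upwards [hφ.continuous.continuousAt.eventually_ne hx] with y hy
      simp [hy]
  · intro x
    by_cases hx : φ x = 0
    · simp [hx, h0 x hx]
    · simp only [hx, if_false]; field_simp
  · intro x hx; simp [hx]

/-- The properties that characterise the odd Jacobi theta function up to a constant. -/
structure IsTheta (τ : ℂ) (θ : ℂ → ℂ) : Prop where
  diff : Differentiable ℂ θ
  add_one : ∀ x, θ (x + 1) = -θ x
  add_tau : ∀ x, θ (x + τ) = -ePi (-(τ + 2 * x)) * θ x
  odd : ∀ x, θ (-x) = -θ x
  lattice : ∀ x, θ x = 0 → ∃ j k : ℤ, x = j * τ + k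
  deriv_zero : deriv θ 0 ≠ 0

/-! ### Zeros of a theta function and division by it. -/

namespace IsTheta

variable {τ : ℂ} {θ : ℂ → ℂ}

lemma zero (h : IsTheta τ θ) : θ 0 = 0 := by
  have := h.odd 0
  rw [neg_zero] at this
  exact self_eq_neg.mp this

lemma sub_one (h : IsTheta τ θ) (x : ℂ) : θ (x - 1) = -θ x := by
  have := h.add_one (x - 1); rw [sub_add_cancel] at this; rw [this, neg_neg]

lemma sub_tau (h : IsTheta τ θ) (x : ℂ) : θ (x - τ) = -ePi (-(τ - 2 * x)) * θ x := by
  have := h.add_tau (x - τ)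
  rw [sub_add_cancel] at this
  rw [this]
  rw [show -(τ + 2 * (x - τ)) = -(-(τ - 2 * x)) by ring, ePi_neg (-(τ - 2 * x))]
  field_simp [ePi_ne_zero]

lemma add_int (h : IsTheta τ θ) (x : ℂ) (k : ℤ) : θ (x + k) = (-1) ^ k * θ x := by
  induction k using Int.induction_on with
  | zero => simp
  | succ k ih =>
    push_cast at ih ⊢
    rw [← add_assoc, h.add_one, ih, zpow_add_one₀ (by norm_num)]; ring
  | pred k ih =>
    push_cast at ih ⊢
    rw [← add_sub_assoc, h.sub_one, ih, zpow_sub_one₀ (by norm_num)]; norm_num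

lemma add_int_mul_tau (h : IsTheta τ θ) (x : ℂ) (j : ℤ) :
    θ (x + j * τ) = (-1) ^ j * ePi (-(j ^ 2 * τ + 2 * j * x)) * θ x := by
  induction j using Int.induction_on with
  | zero => simp [ePi_zero]
  | succ k ih =>
    push_cast at ih ⊢
    rw [show x + (k + 1) * τ = x + k * τ + τ by ring, h.add_tau, ih,
      zpow_add_one₀ (by norm_num), show -(((k : ℂ) + 1) ^ 2 * τ + 2 * (k + 1) * x)
        = -(τ + 2 * (x + k * τ)) + -((k : ℂ) ^ 2 * τ + 2 * k * x) by ring, ePi_add]; ring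
  | pred k ih =>
    push_cast at ih ⊢
    rw [show x + (-(k : ℂ) - 1) * τ = x + -k * τ - τ by ring, h.sub_tau, ih,
      zpow_sub_one₀ (by norm_num), show -((-(k : ℂ) - 1) ^ 2 * τ + 2 * (-k - 1) * x)
        = -(τ - 2 * (x + -k * τ)) + -((-(k : ℂ)) ^ 2 * τ + 2 * -k * x) by ring, ePi_add]; norm_num
    ring

lemma add_lattice (h : IsTheta τ θ) (x : ℂ) (j k : ℤ) :
    θ (x + (j * τ + k)) = (-1) ^ k * ((-1) ^ j * ePi (-(j ^ 2 * τ + 2 * j * x))) * θ x := by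
  rw [← add_assoc, h.add_int, h.add_int_mul_tau]; ring

lemma eq_zero_iff (h : IsTheta τ θ) {x : ℂ} : θ x = 0 ↔ ∃ j k : ℤ, x = j * τ + k := by
  refine ⟨h.lattice x, ?_⟩
  rintro ⟨j, k, rfl⟩
  have := h.add_lattice 0 j k
  rwa [h.zero, mul_zero, zero_add] at this

/-- Every zero is a lattice translate of `0`, and differentiating the translation law at `0` carries
over the simplicity of the zero there. -/
lemma deriv_ne_zero (h : IsTheta τ θ) {x : ℂ} (hx : θ x = 0) : deriv θ x ≠ 0 := by
  obtain ⟨j, k, rfl⟩ := h.lattice x hx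
  set d : ℂ := j * τ + k with hd
  set c : ℂ → ℂ := fun y => (-1) ^ k * ((-1) ^ j * ePi (-(j ^ 2 * τ + 2 * j * y))) with hc
  have hcd : Differentiable ℂ c := by
    have : Differentiable ℂ fun y : ℂ => ePi (-((j : ℂ) ^ 2 * τ + 2 * j * y)) :=
      Differentiable.ePi (by fun_prop)
    exact (this.const_mul _).const_mul _
  have e : (fun y => θ (y + d)) = fun y => c y * θ y := funext fun y => h.add_lattice y j k
  have h1 : deriv (fun y => θ (y + d)) 0 = deriv θ d := by
    rw [deriv_comp_add_const, zero_add]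
  have h2 : deriv (fun y => c y * θ y) 0 = c 0 * deriv θ 0 := by
    rw [deriv_fun_mul (hcd 0) (h.diff 0), h.zero]; ring
  rw [← h1, e, h2]
  refine mul_ne_zero ?_ h.deriv_zero
  exact mul_ne_zero (zpow_ne_zero _ (by norm_num))
    (mul_ne_zero (zpow_ne_zero _ (by norm_num)) (ePi_ne_zero _))

lemma exists_ne_zero (h : IsTheta τ θ) : ∃ x, θ x ≠ 0 := by
  by_contra! hcon
  exact h.deriv_zero (by rw [show θ = fun _ => 0 from funext hcon]; simp)

lemma eventually_ne_zero (h : IsTheta τ θ) : ∀ᶠ x in Filter.codiscrete ℂ, θ x ≠ 0 := by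
  obtain ⟨x, hx⟩ := h.exists_ne_zero
  exact eventually_ne_zero_of_differentiable h.diff hx

/-- `θ(kx + d)` vanishes only on a discrete set. -/
lemma eventually_affine_ne_zero (h : IsTheta τ θ) {k : ℂ} (hk : k ≠ 0) (d : ℂ) :
    ∀ᶠ x in Filter.codiscrete ℂ, θ (k * x + d) ≠ 0 := by
  obtain ⟨x, hx⟩ := h.exists_ne_zero
  refine eventually_ne_zero_of_differentiable (x := (x - d) / k) (f := fun x => θ (k * x + d))
    (h.diff.comp (by fun_prop)) ?_
  simpa [mul_div_cancel₀ _ hk] using hx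

/-- Division of a quasi-periodic entire function by `θ`, given one zero. -/
lemma exists_quotient (h : IsTheta τ θ) {F c₁ c₂ : ℂ → ℂ} (hF : Differentiable ℂ F)
    (hc₁ : Continuous c₁) (hc₂ : Continuous c₂) (n₁ : ∀ x, c₁ x ≠ 0) (n₂ : ∀ x, c₂ x ≠ 0)
    (h₁ : ∀ x, F (x + 1) = c₁ x * F x) (h₂ : ∀ x, F (x + τ) = c₂ x * F x) {d : ℂ} (hd : F d = 0) :
    ∃ k : ℂ → ℂ, Differentiable ℂ k ∧ (∀ x, F x = θ (x - d) * k x) ∧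
      (∀ x, k (x + 1) = -c₁ x * k x) ∧
      (∀ x, k (x + τ) = -(c₂ x * ePi (τ + 2 * (x - d))) * k x) ∧
      k d = deriv F d / deriv θ 0 := by
  -- The multipliers never vanish, so the zero `d` of `F` propagates, here and in `z2`, to all of `d
  -- + ℤτ + ℤ`, which contains the zero set of `θ(x - d)`.
  have z1 : ∀ j : ℤ, ∀ x, F x = 0 → F (x + j) = 0 := by
    intro j
    induction j using Int.induction_on with
    | zero => intro x hx; simpa using hx
    | succ k ih =>
      intro x hx
      push_cast at ih ⊢
      rw [← add_assoc, h₁, ih x hx, mul_zero]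
    | pred k ih =>
      intro x hx
      push_cast at ih ⊢
      have := h₁ (x + (-k - 1))
      rw [show x + (-(k : ℂ) - 1) + 1 = x + -k by ring, ih x hx] at this
      exact (mul_eq_zero.mp this.symm).resolve_left (n₁ _)
  have z2 : ∀ j : ℤ, ∀ x, F x = 0 → F (x + j * τ) = 0 := by
    intro j
    induction j using Int.induction_on with
    | zero => intro x hx; simpa using hx
    | succ k ih =>
      intro x hx
      push_cast at ih ⊢
      rw [show x + (k + 1) * τ = x + k * τ + τ by ring, h₂, ih x hx, mul_zero]
    | pred k ih =>
      intro x hx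
      push_cast at ih ⊢
      have := h₂ (x + (-k - 1) * τ)
      rw [show x + (-(k : ℂ) - 1) * τ + τ = x + -k * τ by ring, ih x hx] at this
      exact (mul_eq_zero.mp this.symm).resolve_left (n₂ _)
  obtain ⟨k, hk, hFk, hkd⟩ := exists_entire_quotient (φ := fun x => θ (x - d)) hF
    (h.diff.comp (by fun_prop))
    (fun x hx => by
      obtain ⟨j, k, hjk⟩ := h.lattice _ hx
      rw [show x = d + j * τ + k by linear_combination hjk]
      exact z1 k _ (z2 j _ hd))
    (fun x hx => by
      rw [deriv_comp_sub_const]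
      exact h.deriv_ne_zero hx)
  have hgen : ∀ᶠ x in Filter.codiscrete ℂ, θ (x - d) ≠ 0 := by
    simpa [sub_eq_add_neg] using h.eventually_affine_ne_zero one_ne_zero (-d)
  refine ⟨k, hk, hFk, ?_, ?_, ?_⟩
  · refine eq_of_eventually_codiscrete (hk.continuous.comp (continuous_add_const 1))
      (hc₁.neg.mul hk.continuous) ?_
    filter_upwards [hgen] with x hx
    have := h₁ x
    rw [hFk, hFk x, show x + 1 - d = x - d + 1 by ring, h.add_one] at this
    exact mul_left_cancel₀ hx (by linear_combination -this)
  · refine eq_of_eventually_codiscrete (hk.continuous.comp (continuous_add_const τ))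
      (((hc₂.mul (differentiable_ePi.continuous.comp (by fun_prop))).neg).mul hk.continuous) ?_
    filter_upwards [hgen] with x hx
    have := h₂ x
    rw [hFk, hFk x, show x + τ - d = x - d + τ by ring, h.add_tau, ePi_neg] at this
    have e := ePi_ne_zero (τ + 2 * (x - d))
    field_simp at this
    linear_combination -this
  · rw [hkd d (by rw [sub_self, h.zero]), deriv_comp_sub_const, sub_self]

/-- An entire function with the multipliers of a product of two translated theta functions (up to
unitary constants) and two prescribed zeros is proportional to this product. -/
lemma eq_const_mul_mul (h : IsTheta τ θ) (hτ : 0 < τ.im) {F : ℂ → ℂ} (hF : Differentiable ℂ F)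
    {α β d₁ d₂ : ℂ} (hα : ‖α‖ = 1) (hβ : ‖β‖ = 1) (h₁ : ∀ x, F (x + 1) = α * F x)
    (h₂ : ∀ x, F (x + τ) = β * ePi (-(2 * τ + 4 * x - 2 * d₁ - 2 * d₂)) * F x)
    (hd₁ : F d₁ = 0) (hd₂ : (F d₂ = 0 ∧ θ (d₂ - d₁) ≠ 0) ∨ (d₂ = d₁ ∧ deriv F d₁ = 0)) :
    ∃ c, (∀ x, F x = c * (θ (x - d₁) * θ (x - d₂))) ∧ (c = 0 ∨ (α = 1 ∧ β = 1)) := by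
  have hα0 : α ≠ 0 := norm_ne_zero_iff.mp (by rw [hα]; exact one_ne_zero)
  have hβ0 : β ≠ 0 := norm_ne_zero_iff.mp (by rw [hβ]; exact one_ne_zero)
  have hce : ∀ f : ℂ → ℂ, Continuous f → Continuous fun x => ePi (f x) := fun f hf =>
    differentiable_ePi.continuous.comp hf
  obtain ⟨k, hk, hFk, hk1, hk2, hkd⟩ := h.exists_quotient hF continuous_const
    (continuous_const.mul (hce _ (by fun_prop))) (fun _ => hα0)
    (fun x => mul_ne_zero hβ0 (ePi_ne_zero _)) h₁ h₂ hd₁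
  -- Either `d₂` is another zero, at which the first divisor does not vanish, or `d₁` is a double
  -- zero and the value of the quotient there is a multiple of `F'(d₁)`.
  have hk0 : k d₂ = 0 := by
    rcases hd₂ with ⟨h2, h3⟩ | ⟨rfl, h3⟩
    · rw [hFk] at h2
      exact (mul_eq_zero.mp h2).resolve_left h3
    · rw [hkd, h3, zero_div]
  obtain ⟨l, hl, hkl, hl1, hl2, -⟩ := h.exists_quotient hk continuous_const
    ((((continuous_const.mul (hce _ (by fun_prop))).mul (hce _ (by fun_prop)))).neg)
    (fun _ => neg_ne_zero.mpr hα0)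
    (fun x => neg_ne_zero.mpr (mul_ne_zero (mul_ne_zero hβ0 (ePi_ne_zero _)) (ePi_ne_zero _)))
    hk1 hk2 hk0
  have hl1' : ∀ x, l (x + 1) = α * l x := fun x => by rw [hl1, neg_neg]
  have hl2' : ∀ x, l (x + τ) = β * l x := fun x => by
    rw [hl2]
    simp only [Pi.mul_apply, Pi.neg_apply]
    have e : ePi (-(2 * τ + 4 * x - 2 * d₁ - 2 * d₂)) * ePi (τ + 2 * (x - d₁))
        * ePi (τ + 2 * (x - d₂)) = 1 := by
      rw [← ePi_add, ← ePi_add, ← ePi_zero]; congr 1; ring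
    linear_combination β * l x * e
  obtain ⟨c, hc⟩ := exists_const_of_norm_periodic hτ hl
    (fun x => by rw [hl1', norm_mul, hα, one_mul]) (fun x => by rw [hl2', norm_mul, hβ, one_mul])
  refine ⟨c, fun x => by rw [hFk, hkl, hc]; ring, ?_⟩
  -- The last quotient is the constant `c` and also has multipliers `α`, `β`; if `c ≠ 0` both must
  -- be `1`.
  by_cases hc0 : c = 0
  · exact Or.inl hc0
  · refine Or.inr ⟨?_, ?_⟩
    · have := hl1' 0
      rw [hc, hc] at this
      exact (mul_right_cancel₀ hc0 (by linear_combination this)).symm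
    · have := hl2' 0
      rw [hc, hc] at this
      exact (mul_right_cancel₀ hc0 (by linear_combination this)).symm

end IsTheta

/-! ### The theta function as an infinite product -/

/-- The product form makes the zero set and the simplicity of the zeros visible; the series form
obtains both from it by comparison. -/
lemma isTheta_Theta {τ : ℂ} (hτ : 0 < τ.im) :
    IsTheta τ fun x => ePi (-x) * Theta (ePi (2 * τ)) (ePi (2 * x)) := by
  have hp : ‖ePi (2 * τ)‖ < 1 := norm_ePi_lt_one (by simpa using hτ)
  have hp0 := ePi_ne_zero (2 * τ)
  set p := ePi (2 * τ) with hpdef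
  have hE := differentiable_qPoch hp
  have hd1 : Differentiable ℂ fun x : ℂ => qPoch (ePi (2 * x)) p :=
    hE.comp (differentiable_id.const_mul 2).ePi
  have hd1' : Differentiable ℂ fun x : ℂ => qPoch (p * ePi (2 * x)) p :=
    hE.comp ((differentiable_id.const_mul 2).ePi.const_mul p)
  have hd2 : Differentiable ℂ fun x : ℂ => qPoch (p * ePi (-(2 * x))) p :=
    hE.comp ((differentiable_id.const_mul 2).neg.ePi.const_mul p)
  have hneg : Differentiable ℂ fun x : ℂ => ePi (-x) := differentiable_id.neg.ePi
  constructor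
  · have : Differentiable ℂ fun x : ℂ => ePi (-x) * (qPoch (ePi (2 * x)) p *
        qPoch (p * ePi (-(2 * x))) p * qPoch p p) :=
      hneg.mul ((hd1.mul hd2).mul_const _)
    simpa only [Theta, ePi_neg] using this
  · intro x
    rw [show 2 * (x + 1) = 2 * x + 2 by ring, ePi_add, ePi_two, mul_one, neg_add, ePi_add,
      ePi_neg 1, ePi_one]
    norm_num
  · intro x
    have e : ePi (2 * (x + τ)) = p * ePi (2 * x) := by rw [mul_add, ePi_add, mul_comm]
    rw [e, Theta_mul hp hp0 (ePi_ne_zero _), ← ePi_neg,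
      show ePi (-(x + τ)) * (-ePi (-(2 * x)) * Theta p (ePi (2 * x)))
        = -(ePi (-(x + τ)) * ePi (-(2 * x))) * Theta p (ePi (2 * x)) by ring, ← ePi_add,
      show -(x + τ) + -(2 * x) = -(τ + 2 * x) + -x by ring, ePi_add]
    ring
  · intro x
    rw [mul_neg, ePi_neg (2 * x), Theta_inv hp (ePi_ne_zero _), neg_neg, ePi_neg x,
      ePi_two_mul]
    have := ePi_ne_zero x
    field_simp
  · intro x hx
    obtain ⟨n, hn⟩ := Theta_eq_zero hp (ePi_ne_zero _)
      ((mul_eq_zero.mp hx).resolve_left (ePi_ne_zero _))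
    have h1 : ePi (2 * x - n * (2 * τ)) = 1 := by
      rw [ePi_sub, ePi_int_mul, hn, div_self (zpow_ne_zero _ hp0)]
    obtain ⟨k, hk⟩ := ePi_eq_one_iff.mp h1
    exact ⟨n, k, by linear_combination hk / 2⟩
  -- Only the factor `1 - e^{2iπx}` vanishes at `0`; `H` collects the remaining factors, and `H 0`
  -- is a product of nonzero Pochhammer symbols.
  · set H : ℂ → ℂ := fun x => ePi (-x) * (qPoch (p * ePi (2 * x)) p *
        qPoch (p * ePi (-(2 * x))) p * qPoch p p) with hH
    have hHd : Differentiable ℂ H := hneg.mul ((hd1'.mul hd2).mul_const _)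
    have e : (fun x => ePi (-x) * Theta p (ePi (2 * x))) = fun x => (1 - ePi (2 * x)) * H x := by
      funext x
      rw [Theta, qPoch_eq_mul hp (ePi (2 * x)), ← ePi_neg, hH]; ring
    have hl : HasDerivAt (fun x : ℂ => 1 - ePi (2 * x)) (-(Complex.I * Real.pi * 2)) 0 := by
      have h1 : HasDerivAt (fun x : ℂ => Complex.I * Real.pi * (2 * x)) (Complex.I * Real.pi * 2) 0 := by
        simpa using ((hasDerivAt_id (0 : ℂ)).const_mul 2).const_mul (Complex.I * Real.pi)
      have h2 := h1.cexp.const_sub 1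
      simpa [ePi] using h2
    have hm := hl.mul (hHd 0).hasDerivAt
    have hm' : HasDerivAt (fun x => (1 - ePi (2 * x)) * H x) (-(Complex.I * Real.pi * 2) * H 0) 0 := by
      convert! hm using 1
      simp [ePi_zero]
    rw [e, hm'.deriv]
    have hπ : (Real.pi : ℂ) ≠ 0 := by exact_mod_cast Real.pi_ne_zero
    have hq : qPoch p p ≠ 0 := qPoch_ne_zero_of_norm_lt hp hp
    refine mul_ne_zero (neg_ne_zero.mpr (mul_ne_zero (mul_ne_zero Complex.I_ne_zero hπ) two_ne_zero)) ?_
    simp only [hH, mul_zero, neg_zero, ePi_zero, mul_one, one_mul]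
    exact mul_ne_zero (mul_ne_zero hq hq) hq

/-! ### Theta functions with characteristics -/

lemma thetaChar_eq_jacobiTheta₂ (γ₁ γ₂ ξ τ : ℂ) :
    thetaChar γ₁ γ₂ ξ τ
      = ePi (γ₁ ^ 2 * τ + 2 * γ₁ * (ξ + γ₂)) * jacobiTheta₂ (ξ + γ₂ + γ₁ * τ) τ := by
  rw [thetaChar, jacobiTheta₂, ← tsum_mul_left]
  refine tsum_congr fun n => ?_
  rw [ePi, jacobiTheta₂_term, ← Complex.exp_add]
  ring_nf

lemma differentiable_thetaChar {τ : ℂ} (hτ : 0 < τ.im) (γ₁ γ₂ : ℂ) :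
    Differentiable ℂ fun ξ => thetaChar γ₁ γ₂ ξ τ := by
  have h : Differentiable ℂ fun z => jacobiTheta₂ z τ := fun z =>
    differentiableAt_jacobiTheta₂_fst z hτ
  simp only [thetaChar_eq_jacobiTheta₂]
  have h1 : Differentiable ℂ fun ξ : ℂ => ePi (γ₁ ^ 2 * τ + 2 * γ₁ * (ξ + γ₂)) :=
    Differentiable.ePi (by fun_prop)
  exact h1.mul (h.comp (by fun_prop))

lemma thetaChar_add_left (γ₁ γ₂ δ₁ δ₂ ξ τ : ℂ) :
    thetaChar (γ₁ + δ₁) (γ₂ + δ₂) ξ τ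
      = ePi (δ₁ ^ 2 * τ + 2 * δ₁ * (ξ + γ₂ + δ₂)) * thetaChar γ₁ γ₂ (ξ + (δ₁ * τ + δ₂)) τ := by
  rw [thetaChar_eq_jacobiTheta₂, thetaChar_eq_jacobiTheta₂, ← mul_assoc, ← ePi_add]
  congr 2
  · ring
  · ring

lemma thetaChar_half_add_one (ξ τ : ℂ) :
    thetaChar (1 / 2) (1 / 2) (ξ + 1) τ = -thetaChar (1 / 2) (1 / 2) ξ τ := by
  rw [thetaChar_eq_jacobiTheta₂, thetaChar_eq_jacobiTheta₂,
    show ξ + 1 + 1 / 2 + 1 / 2 * τ = ξ + 1 / 2 + 1 / 2 * τ + 1 by ring, jacobiTheta₂_add_left,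
    show (1 / 2 : ℂ) ^ 2 * τ + 2 * (1 / 2) * (ξ + 1 + 1 / 2)
      = ((1 / 2 : ℂ) ^ 2 * τ + 2 * (1 / 2) * (ξ + 1 / 2)) + 1 by ring, ePi_add, ePi_one]
  ring

lemma thetaChar_half_add_tau (ξ τ : ℂ) :
    thetaChar (1 / 2) (1 / 2) (ξ + τ) τ
      = -ePi (-(τ + 2 * ξ)) * thetaChar (1 / 2) (1 / 2) ξ τ := by
  have e : Complex.exp (-Real.pi * Complex.I * (τ + 2 * (ξ + 1 / 2 + 1 / 2 * τ)))
      = -ePi (-(2 * τ + 2 * ξ)) := by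
    have h : -ePi (-(2 * τ + 2 * ξ)) = ePi (-1) * ePi (-(2 * τ + 2 * ξ)) := by
      rw [ePi_neg 1, ePi_one]; norm_num
    rw [h, ← ePi_add, ePi]; congr 1; ring
  rw [thetaChar_eq_jacobiTheta₂, thetaChar_eq_jacobiTheta₂,
    show ξ + τ + 1 / 2 + 1 / 2 * τ = ξ + 1 / 2 + 1 / 2 * τ + τ by ring, jacobiTheta₂_add_left', e,
    show (1 / 2 : ℂ) ^ 2 * τ + 2 * (1 / 2) * (ξ + τ + 1 / 2)
      = ((1 / 2 : ℂ) ^ 2 * τ + 2 * (1 / 2) * (ξ + 1 / 2)) + τ by ring, ePi_add,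
    show -(τ + 2 * ξ) = -(2 * τ + 2 * ξ) + τ by ring, ePi_add (-(2 * τ + 2 * ξ))]
  ring

/-- Oddness comes from the evenness of `jacobiTheta₂`, since the reflected half-period point returns
to the original one after translations by `τ` and by `1`. -/
lemma thetaChar_half_neg (ξ τ : ℂ) :
    thetaChar (1 / 2) (1 / 2) (-ξ) τ = -thetaChar (1 / 2) (1 / 2) ξ τ := by
  have h1 := jacobiTheta₂_add_left' (-(ξ + 1 / 2 + 1 / 2 * τ)) τ
  have h2 := jacobiTheta₂_add_left (-(ξ + 1 / 2 + 1 / 2 * τ) + τ) τ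
  rw [h1, jacobiTheta₂_neg_left] at h2
  rw [thetaChar_eq_jacobiTheta₂, thetaChar_eq_jacobiTheta₂,
    show -ξ + 1 / 2 + 1 / 2 * τ = -(ξ + 1 / 2 + 1 / 2 * τ) + τ + 1 by ring, h2, ← mul_assoc]
  rw [← neg_mul]
  congr 1
  have h : -ePi ((1 / 2) ^ 2 * τ + 2 * (1 / 2) * (ξ + 1 / 2))
      = ePi 1 * ePi ((1 / 2) ^ 2 * τ + 2 * (1 / 2) * (ξ + 1 / 2)) := by
    rw [ePi_one]; ring
  rw [h, ← ePi_add, ePi, ePi, ← Complex.exp_add]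
  congr 1; ring

/-- The constant Fourier coefficient, that is the integral over `[0, 1]`, equals `1`. The norms of
the terms do not depend on real `t`, so integration term by term is justified by domination. -/
lemma exists_jacobiTheta₂_ne_zero {τ : ℂ} (hτ : 0 < τ.im) : ∃ z, jacobiTheta₂ z τ ≠ 0 := by
  by_contra! hcon
  have hnorm : ∀ (n : ℤ) (t : ℝ), ‖jacobiTheta₂_term n t τ‖ = ‖jacobiTheta₂_term n 0 τ‖ := by
    intro n t
    rw [norm_jacobiTheta₂_term, norm_jacobiTheta₂_term]; simp
  have hs : Summable fun n : ℤ => ‖jacobiTheta₂_term n 0 τ‖ :=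
    ((summable_jacobiTheta₂_term_iff 0 τ).mpr hτ).norm
  have hcont : ∀ n : ℤ, Continuous fun t : ℝ => jacobiTheta₂_term n t τ := by
    intro n; unfold jacobiTheta₂_term; fun_prop
  have key := intervalIntegral.hasSum_integral_of_dominated_convergence
    (μ := MeasureTheory.volume) (a := 0) (b := 1)
    (F := fun (n : ℤ) (t : ℝ) => jacobiTheta₂_term n t τ) (f := fun t => jacobiTheta₂ t τ)
    (fun n _ => ‖jacobiTheta₂_term n 0 τ‖)
    (fun n => (hcont n).aestronglyMeasurable)
    (fun n => .of_forall fun t _ => (hnorm n t).le)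
    (.of_forall fun t _ => hs)
    intervalIntegrable_const
    (.of_forall fun t _ => hasSum_jacobiTheta₂_term t hτ)
  have hint : ∀ n : ℤ, n ≠ 0 → ∫ t in (0 : ℝ)..1, jacobiTheta₂_term n t τ = 0 := by
    intro n hn
    have hc : (2 * Real.pi * Complex.I * n : ℂ) ≠ 0 := by
      have hπ : (Real.pi : ℂ) ≠ 0 := by exact_mod_cast Real.pi_ne_zero
      have hn' : (n : ℂ) ≠ 0 := by exact_mod_cast hn
      exact mul_ne_zero (mul_ne_zero (mul_ne_zero two_ne_zero hπ) Complex.I_ne_zero) hn'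
    simp only [jacobiTheta₂_term, Complex.exp_add]
    rw [intervalIntegral.integral_mul_const, integral_exp_mul_complex hc]
    have h1 : Complex.exp (2 * Real.pi * Complex.I * n * (1 : ℝ)) = 1 := by
      rw [Complex.exp_eq_one_iff]; exact ⟨n, by push_cast; ring⟩
    rw [h1]; simp
  have h0 : ∫ t in (0 : ℝ)..1, jacobiTheta₂_term 0 t τ = 1 := by
    simp [jacobiTheta₂_term]
  have h1 := hasSum_ite_eq (0 : ℤ) (1 : ℂ)
  have h2 : (fun n : ℤ => ∫ t in (0 : ℝ)..1, jacobiTheta₂_term n t τ)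
      = fun n => if n = 0 then (1 : ℂ) else 0 := by
    funext n
    split_ifs with hn
    · rw [hn, h0]
    · exact hint n hn
  rw [h2] at key
  have := key.unique h1
  simp [hcon] at this

/-- The Jacobi triple product up to its constant: series and product have the same multipliers and
the series vanishes at `0`, so their quotient is entire with a doubly periodic norm, hence constant.
-/
lemma exists_thetaChar_eq {τ : ℂ} (hτ : 0 < τ.im) :
    ∃ C : ℂ, C ≠ 0 ∧ ∀ x, thetaChar (1 / 2) (1 / 2) x τ
      = C * (ePi (-x) * Theta (ePi (2 * τ)) (ePi (2 * x))) := by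
  have hS := isTheta_Theta hτ
  have hce : Continuous fun x => -ePi (-(τ + 2 * x)) :=
    (differentiable_ePi.continuous.comp (by fun_prop)).neg
  have h0 : thetaChar (1 / 2) (1 / 2) 0 τ = 0 := by
    have := thetaChar_half_neg 0 τ
    rw [neg_zero] at this
    exact self_eq_neg.mp this
  obtain ⟨k, hk, hFk, hk1, hk2, -⟩ := hS.exists_quotient (differentiable_thetaChar hτ (1 / 2) (1 / 2))
    (c₁ := fun _ => -1) continuous_const hce (fun _ => by norm_num)
    (fun x => neg_ne_zero.mpr (ePi_ne_zero _))
    (fun x => by rw [thetaChar_half_add_one]; ring) (fun x => thetaChar_half_add_tau x τ) h0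
  obtain ⟨c, hc⟩ := exists_const_of_norm_periodic hτ hk
    (fun x => by rw [hk1]; simp)
    (fun x => by
      rw [hk2, sub_zero, neg_mul (ePi _), ← ePi_add, neg_add_cancel, ePi_zero]; simp)
  refine ⟨c, ?_, fun x => by rw [hFk, hc, sub_zero, mul_comm]⟩
  rintro rfl
  obtain ⟨z, hz⟩ := exists_jacobiTheta₂_ne_zero hτ
  have h2 := hFk (z - 1 / 2 - 1 / 2 * τ)
  rw [hc, mul_zero, thetaChar_eq_jacobiTheta₂,
    show z - 1 / 2 - 1 / 2 * τ + 1 / 2 + 1 / 2 * τ = z by ring] at h2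
  exact mul_ne_zero (ePi_ne_zero _) hz h2

lemma isTheta_thetaChar {τ : ℂ} (hτ : 0 < τ.im) :
    IsTheta τ fun x => thetaChar (1 / 2) (1 / 2) x τ := by
  obtain ⟨C, hC, h⟩ := exists_thetaChar_eq hτ
  have hS := isTheta_Theta hτ
  refine ⟨differentiable_thetaChar hτ _ _, fun x => thetaChar_half_add_one x τ,
    fun x => thetaChar_half_add_tau x τ, fun x => thetaChar_half_neg x τ, fun x hx => ?_, ?_⟩
  · simp only [h] at hx
    exact hS.lattice x ((mul_eq_zero.mp hx).resolve_left hC)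
  · simp only [h]
    rw [deriv_const_mul _ (hS.diff 0)]
    exact mul_ne_zero hC hS.deriv_zero

/-! ### Sums over the `N`-torsion points -/

/-- The sum of a function on `ℤ²` over `{0, …, N-1}²`. -/
noncomputable def torsSum (N : ℕ) (f : ℤ × ℤ → ℂ) : ℂ :=
  ∑ α : Fin N × Fin N, f (((α.1 : ℕ) : ℤ), ((α.2 : ℕ) : ℤ))

/-- `f` depends on its arguments modulo `N` only. -/
def IsPer {A : Type*} (N : ℕ) (f : ℤ × ℤ → A) : Prop :=
  (∀ b, f (b + ((N : ℤ), (0 : ℤ))) = f b) ∧ ∀ b, f (b + ((0 : ℤ), (N : ℤ))) = f b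

lemma sum_fin_add_one {A : Type*} [AddCommGroup A] {N : ℕ} {f : ℤ → A} (h : ∀ i, f (i + N) = f i) :
    ∑ i : Fin N, f (((i : ℕ) : ℤ) + 1) = ∑ i : Fin N, f ((i : ℕ) : ℤ) := by
  rw [Fin.sum_univ_eq_sum_range (fun i : ℕ => f ((i : ℤ) + 1)) N,
    Fin.sum_univ_eq_sum_range (fun i : ℕ => f (i : ℤ)) N]
  have h1 := Finset.sum_range_succ (fun i : ℕ => f (i : ℤ)) N
  have h2 := Finset.sum_range_succ' (fun i : ℕ => f (i : ℤ)) N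
  have h3 := h 0
  rw [zero_add] at h3
  rw [h1] at h2
  simp only [Nat.cast_add, Nat.cast_one, Nat.cast_zero, h3] at h2
  exact (add_right_cancel h2).symm

lemma sum_fin_add {A : Type*} [AddCommGroup A] {N : ℕ} {f : ℤ → A} (h : ∀ i, f (i + N) = f i) (k : ℤ) :
    ∑ i : Fin N, f (((i : ℕ) : ℤ) + k) = ∑ i : Fin N, f ((i : ℕ) : ℤ) := by
  have hper : ∀ k i : ℤ, f (i + N + k) = f (i + k) := fun k i => by
    rw [add_right_comm]; exact h _
  induction k using Int.induction_on with
  | zero => simp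
  | succ k ih =>
    rw [← ih, ← sum_fin_add_one (f := fun i => f (i + k)) (fun i => hper k i)]
    exact Finset.sum_congr rfl fun i _ => by congr 1; ring
  | pred k ih =>
    rw [← ih, ← sum_fin_add_one (f := fun i => f (i + (-k - 1))) (fun i => hper (-k - 1) i)]
    exact Finset.sum_congr rfl fun i _ => by congr 1; ring

lemma IsPer.sum_add {A : Type*} [AddCommGroup A] {N : ℕ} {f : ℤ × ℤ → A} (h : IsPer N f) (g : ℤ × ℤ) :
    ∑ α : Fin N × Fin N, f ((((α.1 : ℕ) : ℤ), ((α.2 : ℕ) : ℤ)) + g)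
      = ∑ α : Fin N × Fin N, f (((α.1 : ℕ) : ℤ), ((α.2 : ℕ) : ℤ)) := by
  rw [Fintype.sum_prod_type, Fintype.sum_prod_type]
  have h1 : ∀ i : ℤ, ∑ j : Fin N, f ((i, ((j : ℕ) : ℤ)) + g)
      = ∑ j : Fin N, f (i + g.1, ((j : ℕ) : ℤ)) := fun i =>
    sum_fin_add (f := fun j => f (i + g.1, j))
      (fun j => by simpa using h.2 (i + g.1, j)) g.2
  refine (Finset.sum_congr rfl fun (i : Fin N) _ => h1 ((i : ℕ) : ℤ)).trans ?_
  exact sum_fin_add (f := fun i => ∑ j : Fin N, f (i, ((j : ℕ) : ℤ)))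
    (fun i => Finset.sum_congr rfl fun j _ => by simpa using h.1 (i, ((j : ℕ) : ℤ))) g.1

lemma IsPer.torsSum_add {N : ℕ} {f : ℤ × ℤ → ℂ} (h : IsPer N f) (g : ℤ × ℤ) :
    torsSum N (fun b => f (b + g)) = torsSum N f := h.sum_add g

lemma IsPer.mul {N : ℕ} {f g : ℤ × ℤ → ℂ} (hf : IsPer N f) (hg : IsPer N g) :
    IsPer N fun b => f b * g b :=
  ⟨fun b => by simp only [hf.1, hg.1], fun b => by simp only [hf.2, hg.2]⟩

lemma torsSum_congr {N : ℕ} {f g : ℤ × ℤ → ℂ} (h : ∀ b, f b = g b) : torsSum N f = torsSum N g :=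
  congrArg _ (funext h)

lemma torsSum_mul_left {N : ℕ} (c : ℂ) (f : ℤ × ℤ → ℂ) :
    torsSum N (fun b => c * f b) = c * torsSum N f := (Finset.mul_sum _ _ _).symm

lemma torsSum_sub {N : ℕ} (f g : ℤ × ℤ → ℂ) :
    torsSum N (fun b => f b - g b) = torsSum N f - torsSum N g := Finset.sum_sub_distrib _ _

lemma torsSum_comm {N : ℕ} (f : ℤ × ℤ → ℤ × ℤ → ℂ) :
    torsSum N (fun b => torsSum N (f b)) = torsSum N fun d => torsSum N fun b => f b d :=
  Finset.sum_comm

lemma torsSum_const {N : ℕ} (c : ℂ) : torsSum N (fun _ => c) = (N : ℂ) ^ 2 * c := by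
  simp [torsSum, sq]

/-- The point `(b₁ τ + b₂) / N`. -/
noncomputable def tors (N : ℕ) (τ : ℂ) (b : ℤ × ℤ) : ℂ := (b.1 * τ + b.2) / N

/-- The character `b ↦ ω^{γ₂ b₁ - γ₁ b₂}`. -/
noncomputable def chi (N : ℕ) (γ b : ℤ × ℤ) : ℂ := ePi (2 * (γ.2 * b.1 - γ.1 * b.2) / N)

/-- `e^{2iπ b₁ s/N} θ(s + ζ/N + (b₁τ+b₂)/N) / θ(ζ/N + (b₁τ+b₂)/N)`. -/
noncomputable def wFun (N : ℕ) (τ : ℂ) (θ : ℂ → ℂ) (ζ : ℂ) (b : ℤ × ℤ) (s : ℂ) : ℂ :=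
  ePi (2 * b.1 * s / N) * (θ (s + ζ / N + tors N τ b) / θ (ζ / N + tors N τ b))

section

variable {N : ℕ} {τ : ℂ} {θ : ℂ → ℂ}

lemma tors_add (b g : ℤ × ℤ) : tors N τ (b + g) = tors N τ b + tors N τ g := by
  simp only [tors, Prod.fst_add, Prod.snd_add]; push_cast; ring

lemma tors_neg (b : ℤ × ℤ) : tors N τ (-b) = -tors N τ b := by
  simp only [tors, Prod.fst_neg, Prod.snd_neg]; push_cast; ring

lemma tors_zero : tors N τ 0 = 0 := by simp [tors]

lemma eq_zero_of_mul_tau_add (hτ : 0 < τ.im) {j k : ℤ} (h : (j : ℂ) * τ + k = 0) :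
    j = 0 ∧ k = 0 := by
  have h1 := congrArg Complex.im h
  simp only [Complex.add_im, Complex.mul_im, Complex.intCast_re, Complex.intCast_im, zero_mul,
    add_zero, Complex.zero_im] at h1
  have h2 : (j : ℝ) = 0 := (mul_eq_zero.mp h1).resolve_right hτ.ne'
  have h3 : j = 0 := by exact_mod_cast h2
  subst h3
  refine ⟨rfl, ?_⟩
  simp only [Int.cast_zero, zero_mul, zero_add] at h
  exact_mod_cast h

lemma chi_add (γ b g : ℤ × ℤ) : chi N γ (b + g) = chi N γ b * chi N γ g := by
  rw [chi, chi, chi, ← ePi_add]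
  congr 1
  simp only [Prod.fst_add, Prod.snd_add]; push_cast; ring

lemma chi_self (γ : ℤ × ℤ) : chi N γ γ = 1 := by
  rw [chi, mul_comm (γ.2 : ℂ), sub_self, mul_zero, zero_div, ePi_zero]

lemma chi_swap (γ b : ℤ × ℤ) : chi N γ b = chi N (-b) γ := by
  rw [chi, chi]; congr 1; simp only [Prod.fst_neg, Prod.snd_neg]; push_cast; ring

lemma wFun_zero {ζ : ℂ} {b : ℤ × ℤ} (hb : θ (ζ / N + tors N τ b) ≠ 0) : wFun N τ θ ζ b 0 = 1 := by
  rw [wFun, mul_zero, zero_div, ePi_zero, zero_add, div_self hb, one_mul]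

lemma differentiable_wFun (h : IsTheta τ θ) (ζ : ℂ) (b : ℤ × ℤ) :
    Differentiable ℂ (wFun N τ θ ζ b) := by
  have h1 : Differentiable ℂ fun s : ℂ => ePi (2 * b.1 * s / N) := Differentiable.ePi (by fun_prop)
  exact h1.mul ((h.diff.comp (by fun_prop)).div_const _)

lemma wFun_add_one (h : IsTheta τ θ) (ζ : ℂ) (b : ℤ × ℤ) (s : ℂ) :
    wFun N τ θ ζ b (s + 1) = -ePi (2 * b.1 / N) * wFun N τ θ ζ b s := by
  rw [wFun, wFun, show s + 1 + ζ / N + tors N τ b = s + ζ / N + tors N τ b + 1 by ring, h.add_one,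
    show (2 * b.1 * (s + 1) / N : ℂ) = 2 * b.1 / N + 2 * b.1 * s / N by ring, ePi_add]
  ring

lemma wFun_add_tau (h : IsTheta τ θ) (ζ : ℂ) (b : ℤ × ℤ) (s : ℂ) :
    wFun N τ θ ζ b (s + τ)
      = -ePi (-(τ + 2 * s + 2 * ζ / N + 2 * b.2 / N)) * wFun N τ θ ζ b s := by
  rw [wFun, wFun, show s + τ + ζ / N + tors N τ b = s + ζ / N + tors N τ b + τ by ring, h.add_tau,
    show (2 * b.1 * (s + τ) / N : ℂ) = 2 * b.1 * τ / N + 2 * b.1 * s / N by ring, ePi_add,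
    show -(τ + 2 * (s + ζ / N + tors N τ b))
      = -(τ + 2 * s + 2 * ζ / N + 2 * b.2 / N) + -(2 * b.1 * τ / N) by rw [tors]; ring, ePi_add,
    ePi_neg (2 * b.1 * τ / N)]
  have := ePi_ne_zero (2 * b.1 * τ / N)
  field_simp

lemma wFun_neg_add_one (h : IsTheta τ θ) (ζ : ℂ) (b : ℤ × ℤ) (s : ℂ) :
    wFun N τ θ ζ b (-(s + 1)) = -ePi (-(2 * b.1 / N)) * wFun N τ θ ζ b (-s) := by
  have := wFun_add_one (N := N) h ζ b (-(s + 1))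
  rw [neg_add, neg_add_cancel_right] at this
  rw [this, ePi_neg]
  have := ePi_ne_zero (2 * b.1 / N)
  field_simp
  rw [neg_add]

lemma wFun_neg_add_tau (h : IsTheta τ θ) (ζ : ℂ) (b : ℤ × ℤ) (s : ℂ) :
    wFun N τ θ ζ b (-(s + τ))
      = -ePi (-(τ + 2 * s - 2 * ζ / N - 2 * b.2 / N)) * wFun N τ θ ζ b (-s) := by
  have := wFun_add_tau (N := N) h ζ b (-(s + τ))
  rw [show -(s + τ) + τ = -s by ring,
    show -(τ + 2 * -(s + τ) + 2 * ζ / N + 2 * b.2 / N)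
      = -(-(τ + 2 * s - 2 * ζ / N - 2 * b.2 / N)) by ring, ePi_neg (-_)] at this
  have h0 := ePi_ne_zero (-(τ + 2 * s - 2 * ζ / N - 2 * b.2 / N))
  rw [this, neg_mul, neg_mul, mul_neg, neg_neg, mul_inv_cancel_left₀ h0]

variable [NeZero N]

lemma cast_ne_zero' (N : ℕ) [NeZero N] : (N : ℂ) ≠ 0 := Nat.cast_ne_zero.mpr (NeZero.ne N)

lemma tors_eq_lattice (hτ : 0 < τ.im) {b : ℤ × ℤ} {j k : ℤ} (h : tors N τ b = j * τ + k) :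
    b = (N * j, N * k) := by
  have hN := cast_ne_zero' N
  have h1 : ((b.1 - N * j : ℤ) : ℂ) * τ + ((b.2 - N * k : ℤ) : ℂ) = 0 := by
    rw [tors, div_eq_iff hN] at h
    push_cast
    linear_combination h
  obtain ⟨h2, h3⟩ := eq_zero_of_mul_tau_add hτ h1
  exact Prod.ext (by dsimp only; omega) (by dsimp only; omega)

lemma chi_isPer (γ : ℤ × ℤ) : IsPer N (chi N γ) := by
  have hN := cast_ne_zero' N
  constructor
  · intro b
    rw [chi, chi, ← mul_one (ePi (2 * (γ.2 * b.1 - γ.1 * b.2) / N)), ← ePi_two_mul_int γ.2,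
      ← ePi_add]
    congr 1
    simp only [Prod.fst_add, Prod.snd_add]; push_cast; field_simp; ring
  · intro b
    rw [chi, chi, ← mul_one (ePi (2 * (γ.2 * b.1 - γ.1 * b.2) / N)), ← ePi_two_mul_int (-γ.1),
      ← ePi_add]
    congr 1
    simp only [Prod.fst_add, Prod.snd_add]; push_cast; field_simp; ring

lemma ePi_div_eq_one_iff (k : ℤ) : ePi (2 * k / N) = 1 ↔ (N : ℤ) ∣ k := by
  have hN := cast_ne_zero' N
  rw [ePi_eq_one_iff]
  refine exists_congr fun n => ?_
  rw [div_eq_iff hN]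
  constructor
  · intro h
    have : (k : ℂ) = N * n := by linear_combination h / 2
    exact_mod_cast this
  · intro h
    rw [h]; push_cast; ring

/-- Orthogonality of characters. -/
lemma torsSum_chi {γ : ℤ × ℤ} (hγ : ¬((N : ℤ) ∣ γ.1 ∧ (N : ℤ) ∣ γ.2)) : torsSum N (chi N γ) = 0 := by
  -- Translating the summation index by `g` multiplies the sum by `χ_γ(g)` without changing it.
  have h : ∀ g, (chi N γ g - 1) * torsSum N (chi N γ) = 0 := fun g => by
    have h1 := (chi_isPer (N := N) γ).torsSum_add g
    rw [torsSum_congr fun b => (chi_add γ b g).trans (mul_comm _ _), torsSum_mul_left] at h1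
    linear_combination h1
  by_contra hne
  have h' : ∀ g, chi N γ g = 1 := fun g =>
    sub_eq_zero.mp ((mul_eq_zero.mp (h g)).resolve_right hne)
  refine hγ ⟨?_, ?_⟩
  · rw [← ePi_div_eq_one_iff, ← h' (0, -1), chi]; congr 1; push_cast; ring
  · rw [← ePi_div_eq_one_iff, ← h' (1, 0), chi]; congr 1; push_cast; ring

/-- The exponential prefactor is chosen to cancel the ratio of the multipliers of numerator and
denominator when `b₁` grows by `N`. The weights thus become functions on the torsion group, whose
sums may be re-indexed freely. -/
lemma wFun_isPer (h : IsTheta τ θ) (ζ s : ℂ) : IsPer N fun b => wFun N τ θ ζ b s := by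
  have hN := cast_ne_zero' N
  constructor
  · intro b
    simp only [wFun]
    have e : tors N τ (b + ((N : ℤ), 0)) = tors N τ b + τ := by
      rw [tors_add]; congr 1; simp [tors, hN]
    rw [e, ← add_assoc, ← add_assoc, h.add_tau, h.add_tau]
    rw [mul_div_mul_comm, ← mul_assoc]
    congr 1
    rw [neg_div_neg_eq, ← ePi_sub, ← ePi_add]
    congr 1
    simp only [Prod.fst_add]; push_cast; field_simp; ring
  · intro b
    simp only [wFun]
    have e : tors N τ (b + (0, (N : ℤ))) = tors N τ b + 1 := by
      rw [tors_add]; congr 1; simp [tors, hN]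
    rw [e, ← add_assoc, ← add_assoc, h.add_one, h.add_one, neg_div_neg_eq]
    simp

/-- If `ζ/N` plus a torsion point were in the lattice, multiplication by `N` would put `ζ` there
too. One condition on `ζ` therefore controls all denominators. -/
lemma theta_div_ne_zero (h : IsTheta τ θ) {ζ : ℂ} (hζ : θ ζ ≠ 0) (b : ℤ × ℤ) :
    θ (ζ / N + tors N τ b) ≠ 0 := by
  have hN := cast_ne_zero' N
  intro h0
  obtain ⟨j, k, hjk⟩ := h.lattice _ h0
  refine hζ (h.eq_zero_iff.mpr ⟨N * j - b.1, N * k - b.2, ?_⟩)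
  rw [tors] at hjk
  field_simp at hjk
  push_cast
  linear_combination hjk

end

/-! ### The finite Fourier transform of the theta weights. -/

section

variable {N : ℕ} [NeZero N] {τ : ℂ} {θ : ℂ → ℂ}

/-- The entire functions `θ(ζ) / θ(ζ/N + (α₁τ+α₂)/N)`. -/
lemma exists_theta_quotient (h : IsTheta τ θ) (b : ℤ × ℤ) :
    ∃ Q : ℂ → ℂ, Differentiable ℂ Q ∧ (∀ ζ, θ ζ = θ (ζ / N + tors N τ b) * Q ζ) ∧
      ∀ ζ, θ (ζ / N + tors N τ b) = 0 →
        Q ζ = deriv θ ζ / (deriv θ (ζ / N + tors N τ b) / N) := by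
  have hN := cast_ne_zero' N
  have hder : ∀ ζ, deriv (fun ζ => θ (ζ / N + tors N τ b)) ζ
      = deriv θ (ζ / N + tors N τ b) / N := fun ζ => by
    have h1 : HasDerivAt (fun ζ : ℂ => ζ / N + tors N τ b) (1 / N) ζ :=
      ((hasDerivAt_id ζ).div_const _).add_const _
    have h2 := (h.diff (ζ / N + tors N τ b)).hasDerivAt.comp ζ h1
    rw [show (fun ζ => θ (ζ / N + tors N τ b)) = θ ∘ fun ζ => ζ / N + tors N τ b from rfl,
      h2.deriv, mul_one_div]
  obtain ⟨Q, hQ, hQ1, hQ2⟩ := exists_entire_quotient (F := θ)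
    (φ := fun ζ => θ (ζ / N + tors N τ b)) h.diff (h.diff.comp (by fun_prop))
    (fun ζ hζ => by
      by_contra hne
      exact theta_div_ne_zero h hne b hζ)
    (fun ζ hζ => by
      rw [hder]
      exact div_ne_zero (h.deriv_ne_zero hζ) hN)
  exact ⟨Q, hQ, hQ1, fun ζ hζ => by rw [hQ2 ζ hζ, hder]⟩

lemma tors_ne_zero_of_fin (hτ : 0 < τ.im) (h : IsTheta τ θ) {α : Fin N × Fin N}
    (hα : ((((α.1 : ℕ) : ℤ), ((α.2 : ℕ) : ℤ)) : ℤ × ℤ) ≠ 0) :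
    θ (tors N τ (((α.1 : ℕ) : ℤ), ((α.2 : ℕ) : ℤ))) ≠ 0 := by
  intro h0
  obtain ⟨j, k, hjk⟩ := h.lattice _ h0
  have h1 := tors_eq_lattice hτ hjk
  have h2 : ((α.1 : ℕ) : ℤ) = N * j := congrArg Prod.fst h1
  have h3 : ((α.2 : ℕ) : ℤ) = N * k := congrArg Prod.snd h1
  have h4 : ((α.1 : ℕ) : ℤ) = 0 := Int.eq_zero_of_dvd_of_nonneg_of_lt (by omega)
    (by exact_mod_cast α.1.isLt) ⟨j, h2⟩
  have h5 : ((α.2 : ℕ) : ℤ) = 0 := Int.eq_zero_of_dvd_of_nonneg_of_lt (by omega)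
    (by exact_mod_cast α.2.isLt) ⟨k, h3⟩
  exact hα (Prod.ext h4 h5)

/-- The finite Fourier transform of `b ↦ wFun b s`. -/
lemma torsSum_chi_mul_wFun (hτ : 0 < τ.im) (h : IsTheta τ θ) {ζ : ℂ} (hζ : θ ζ ≠ 0) (γ : ℤ × ℤ)
    (s : ℂ) :
    θ (s / N + tors N τ γ) * (torsSum N (fun b => chi N γ b * wFun N τ θ ζ b s) * θ ζ)
      = N * θ s * (ePi (2 * γ.1 * ζ / N) * θ (ζ + s / N + tors N τ γ)) := by
  have hN := cast_ne_zero' N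
  set ix : Fin N × Fin N → ℤ × ℤ := fun α => (((α.1 : ℕ) : ℤ), ((α.2 : ℕ) : ℤ)) with hix
  choose Q hQ hQ1 hQ2 using fun α => exists_theta_quotient (N := N) h (ix α)
  -- The identity is proved as one between entire functions of `ζ`, with `s` fixed. Multiplication
  -- by `θ(ζ)` clears the denominators, and `Q α` is the resulting entire quotient.
  set H : ℂ → ℂ := fun ζ => ∑ α, chi N γ (ix α) * ePi (2 * (ix α).1 * s / N) *
    θ (s + ζ / N + tors N τ (ix α)) * Q α ζ with hH
  have hHd : Differentiable ℂ H := by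
    refine Differentiable.fun_sum fun α _ => Differentiable.mul ?_ (hQ α)
    exact (h.diff.comp (by fun_prop)).const_mul _
  have hHT : ∀ ζ, θ ζ ≠ 0 →
      H ζ = torsSum N (fun b => chi N γ b * wFun N τ θ ζ b s) * θ ζ := by
    intro ζ hζ
    rw [torsSum, Finset.sum_mul]
    refine Finset.sum_congr rfl fun α _ => ?_
    have h0 := theta_div_ne_zero (N := N) h hζ (ix α)
    change _ = chi N γ (ix α) * wFun N τ θ ζ (ix α) s * θ ζ
    rw [hQ1 α ζ, wFun]
    generalize θ (ζ / N + tors N τ (ix α)) = u at h0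
    field_simp
  set K : ℂ → ℂ := fun ζ => ePi (2 * γ.1 * ζ / N) * θ (ζ + s / N + tors N τ γ) with hK
  have hKd : Differentiable ℂ K := by
    have h1 : Differentiable ℂ fun ζ : ℂ => ePi (2 * γ.1 * ζ / N) :=
      Differentiable.ePi (by fun_prop)
    exact h1.mul (h.diff.comp (by fun_prop))
  -- A shift of `ζ` by `1` or `τ` moves `ζ/N` by a torsion point, which is absorbed by translating
  -- the summation index at the cost of a value of `χ_γ`.
  have hH1 : ∀ ζ, H (ζ + 1) = -ePi (2 * γ.1 / N) * H ζ := by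
    refine eq_of_eventually_codiscrete (hHd.continuous.comp (continuous_add_const 1))
      (continuous_const.mul hHd.continuous) ?_
    filter_upwards [h.eventually_ne_zero] with ζ hζ
    have hζ1 : θ (ζ + 1) ≠ 0 := by rw [h.add_one]; exact neg_ne_zero.mpr hζ
    rw [hHT ζ hζ, hHT (ζ + 1) hζ1, h.add_one]
    have e := ((chi_isPer (N := N) γ).mul (wFun_isPer (N := N) h ζ s)).torsSum_add (0, 1)
    have e3 : torsSum N (fun b => chi N γ b * wFun N τ θ (ζ + 1) b s)
        = ePi (2 * γ.1 / N) * torsSum N (fun b => chi N γ b * wFun N τ θ ζ b s) := by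
      rw [← e, ← torsSum_mul_left]
      refine torsSum_congr fun b => ?_
      have e1 : wFun N τ θ (ζ + 1) b s = wFun N τ θ ζ (b + (0, 1)) s := by
        have : (ζ + 1) / N + tors N τ b = ζ / N + tors N τ (b + (0, 1)) := by
          rw [tors_add]; simp only [tors]; push_cast; ring
        rw [wFun, wFun, add_assoc, add_assoc, this]
        simp
      have e2 : ePi (2 * γ.1 / N) * chi N γ (0, 1) = 1 := by
        rw [chi, ← ePi_add, ← ePi_zero]; congr 1; push_cast; ring
      rw [e1, chi_add]
      linear_combination -chi N γ b * wFun N τ θ ζ (b + (0, 1)) s * e2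
    rw [e3]; ring
  have hH2 : ∀ ζ, H (ζ + τ)
      = -(ePi (-(τ + 2 * ζ)) * ePi (-(2 * s / N + 2 * γ.2 / N))) * H ζ := by
    refine eq_of_eventually_codiscrete (hHd.continuous.comp (continuous_add_const τ))
      (((differentiable_ePi.continuous.comp (by fun_prop)).mul continuous_const).neg.mul
        hHd.continuous) ?_
    filter_upwards [h.eventually_ne_zero] with ζ hζ
    have hζ1 : θ (ζ + τ) ≠ 0 := by
      rw [h.add_tau]; exact mul_ne_zero (neg_ne_zero.mpr (ePi_ne_zero _)) hζ
    rw [hHT ζ hζ, hHT (ζ + τ) hζ1, h.add_tau]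
    have e := ((chi_isPer (N := N) γ).mul (wFun_isPer (N := N) h ζ s)).torsSum_add (1, 0)
    have e3 : torsSum N (fun b => chi N γ b * wFun N τ θ (ζ + τ) b s)
        = ePi (-(2 * s / N + 2 * γ.2 / N)) *
          torsSum N (fun b => chi N γ b * wFun N τ θ ζ b s) := by
      rw [← e, ← torsSum_mul_left]
      refine torsSum_congr fun b => ?_
      have e1 : wFun N τ θ (ζ + τ) b s
          = ePi (-(2 * s / N)) * wFun N τ θ ζ (b + (1, 0)) s := by
        have : (ζ + τ) / N + tors N τ b = ζ / N + tors N τ (b + (1, 0)) := by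
          rw [tors_add]; simp only [tors]; push_cast; ring
        rw [wFun, wFun, add_assoc, add_assoc, this, ← mul_assoc, ← ePi_add]
        congr 2
        simp only [Prod.fst_add]; push_cast; ring
      have e2 : ePi (-(2 * γ.2 / N)) * chi N γ (1, 0) = 1 := by
        rw [chi, ← ePi_add, ← ePi_zero]; congr 1; push_cast; ring
      rw [e1, chi_add, neg_add, ePi_add]
      linear_combination
        -chi N γ b * ePi (-(2 * s / N)) * wFun N τ θ ζ (b + (1, 0)) s * e2
    rw [e3]; ring
  have hK1 : ∀ ζ, K (ζ + 1) = -ePi (2 * γ.1 / N) * K ζ := by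
    intro ζ
    simp only [hK]
    rw [show ζ + 1 + s / N + tors N τ γ = ζ + s / N + tors N τ γ + 1 by ring, h.add_one,
      show (2 * γ.1 * (ζ + 1) / N : ℂ) = 2 * γ.1 / N + 2 * γ.1 * ζ / N by ring, ePi_add]
    ring
  have hK2 : ∀ ζ, K (ζ + τ)
      = -(ePi (-(τ + 2 * ζ)) * ePi (-(2 * s / N + 2 * γ.2 / N))) * K ζ := by
    intro ζ
    simp only [hK]
    rw [show ζ + τ + s / N + tors N τ γ = ζ + s / N + tors N τ γ + τ by ring, h.add_tau,
      show (2 * γ.1 * (ζ + τ) / N : ℂ) = 2 * γ.1 * τ / N + 2 * γ.1 * ζ / N by ring, ePi_add,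
      ← ePi_add (-(τ + 2 * ζ)), show -(τ + 2 * (ζ + s / N + tors N τ γ))
        = -(2 * γ.1 * τ / N) + (-(τ + 2 * ζ) + -(2 * s / N + 2 * γ.2 / N)) by
          rw [tors]; ring, ePi_add, ePi_neg (2 * γ.1 * τ / N)]
    have := ePi_ne_zero (2 * γ.1 * τ / N)
    field_simp
  -- At `ζ = 0` every term with a nonzero torsion point contains the factor `θ(0)`; the term `b = 0`
  -- gives `N θ(s)` by l'Hôpital.
  have hH0 : H 0 = N * θ s := by
    have hz : ∀ α, ix α ≠ 0 → Q α 0 = 0 := fun α hα => by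
      have h1 := hQ1 α 0
      rw [h.zero, zero_div, zero_add] at h1
      exact (mul_eq_zero.mp h1.symm).resolve_left (tors_ne_zero_of_fin hτ h hα)
    have hix0 : ix (0, 0) = 0 := by simp [hix]
    have hinj : ∀ α, ix α = 0 → α = (0, 0) := fun α hα => by
      have h1 : ((α.1 : ℕ) : ℤ) = 0 := congrArg Prod.fst hα
      have h2 : ((α.2 : ℕ) : ℤ) = 0 := congrArg Prod.snd hα
      refine Prod.ext (Fin.ext ?_) (Fin.ext ?_)
      · simpa using h1
      · simpa using h2
    simp only [hH]
    rw [Finset.sum_eq_single (0, 0)]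
    · have hq := hQ2 (0, 0) 0 (by rw [hix0, tors_zero, zero_div, add_zero, h.zero])
      rw [hq, hix0, tors_zero]
      have := h.deriv_zero
      simp [chi, ePi_zero]
      field_simp
    · intro α _ hα
      rw [hz α fun h0 => hα (hinj α h0), mul_zero]
    · simp
  -- The coefficients are chosen so that `D` vanishes at `0`. The quotient `D/θ` then has constant
  -- multipliers, hence is zero or an exponential.
  set D : ℂ → ℂ := fun ζ => θ (s / N + tors N τ γ) * H ζ - N * θ s * K ζ with hD
  have hD0 : D 0 = 0 := by
    simp only [hD, hH0, hK]
    rw [mul_zero, zero_div, ePi_zero, zero_add]; ring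
  obtain ⟨k, hk, hDk, hk1, hk2, -⟩ := h.exists_quotient
    (F := D) (c₁ := fun _ => -ePi (2 * γ.1 / N))
    (c₂ := fun ζ => -(ePi (-(τ + 2 * ζ)) * ePi (-(2 * s / N + 2 * γ.2 / N))))
    ((hHd.const_mul _).sub (hKd.const_mul _)) continuous_const
    ((differentiable_ePi.continuous.comp (by fun_prop)).mul continuous_const).neg
    (fun _ => neg_ne_zero.mpr (ePi_ne_zero _))
    (fun _ => neg_ne_zero.mpr (mul_ne_zero (ePi_ne_zero _) (ePi_ne_zero _)))
    (fun ζ => by simp only [hD, hH1, hK1]; ring) (fun ζ => by simp only [hD, hH2, hK2]; ring) hD0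
  have hk1' : ∀ x, k (x + 1) = ePi (2 * γ.1 / N) * k x := fun x => by rw [hk1, neg_neg]
  have hk2' : ∀ x, k (x + τ) = ePi (-(2 * s / N + 2 * γ.2 / N)) * k x := fun x => by
    rw [hk2, sub_zero]
    have e : ePi (-(τ + 2 * x)) * ePi (τ + 2 * x) = 1 := by
      rw [← ePi_add, neg_add_cancel, ePi_zero]
    linear_combination ePi (-(2 * s / N + 2 * γ.2 / N)) * k x * e
  have hDz : D ζ = 0 := by
    rcases eq_zero_or_exponential hτ hk (ePi_ne_zero _) (ePi_ne_zero _) hk1' hk2' with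
      h0 | ⟨l, hl1, hl2⟩
    · rw [hDk, h0, mul_zero]
    -- An exponential with these multipliers exists only if `s/N + (γ₁τ+γ₂)/N` is a lattice point.
    -- Then `s` is one as well, both coefficients in `D` vanish, and `D` is zero in this case too.
    · have a1 : ePi (2 * γ.1 / N - l) = 1 := by rw [ePi_sub, hl1, div_self (ePi_ne_zero _)]
      have a2 : ePi (-(2 * s / N + 2 * γ.2 / N) - l * τ) = 1 := by
        rw [ePi_sub, hl2, div_self (ePi_ne_zero _)]
      obtain ⟨i, hi⟩ := ePi_eq_one_iff.mp a1
      obtain ⟨j, hj⟩ := ePi_eq_one_iff.mp a2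
      have hl : s / N + tors N τ γ = i * τ + (-j : ℤ) := by
        rw [tors]; push_cast
        linear_combination -hj / 2 + τ * hi / 2
      have z1 : θ (s / N + tors N τ γ) = 0 := h.eq_zero_iff.mpr ⟨_, _, hl⟩
      have z2 : θ s = 0 := by
        refine h.eq_zero_iff.mpr ⟨N * i - γ.1, N * (-j) - γ.2, ?_⟩
        rw [tors] at hl
        field_simp at hl
        push_cast at hl ⊢
        linear_combination hl
      simp only [hD, z1, z2]; ring
  rw [← hHT ζ hζ]
  simp only [hD, sub_eq_zero] at hDz
  exact hDz

end

/-! ### Quadratic sums behind unitarity and crossing. -/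

section

variable {N : ℕ} {τ : ℂ} {θ : ℂ → ℂ}

lemma norm_ePi_int_div (k : ℤ) : ‖ePi (2 * k / N)‖ = 1 := by
  rw [norm_ePi]
  have : (2 * k / N : ℂ).im = 0 := by
    rw [show (2 * k / N : ℂ) = ((2 * k / N : ℝ) : ℂ) by push_cast; ring, Complex.ofReal_im]
  rw [this]; simp

/-- The quadratic sum `∑ χ_γ(b) w_{γ+b}(x+s) w_b(-x)` appearing in products of two R-matrices, with
or without the character. -/
lemma torsSum_mul_multipliers (h : IsTheta τ θ) (ζ s : ℂ) (γ : ℤ × ℤ) (c : ℤ × ℤ → ℂ) :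
    (∀ x, torsSum N (fun b => c b * (wFun N τ θ ζ (γ + b) (x + 1 + s) * wFun N τ θ ζ b (-(x + 1))))
      = ePi (2 * γ.1 / N) *
        torsSum N (fun b => c b * (wFun N τ θ ζ (γ + b) (x + s) * wFun N τ θ ζ b (-x)))) ∧
    ∀ x, torsSum N (fun b => c b * (wFun N τ θ ζ (γ + b) (x + τ + s) * wFun N τ θ ζ b (-(x + τ))))
      = ePi (2 * (-γ.2 : ℤ) / N) * ePi (-(2 * τ + 4 * x + 2 * s)) *
        torsSum N (fun b => c b * (wFun N τ θ ζ (γ + b) (x + s) * wFun N τ θ ζ b (-x))) := by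
  constructor
  · intro x
    rw [← torsSum_mul_left]
    refine torsSum_congr fun b => ?_
    rw [show x + 1 + s = x + s + 1 by ring, wFun_add_one h, wFun_neg_add_one h]
    have e : ePi (2 * (γ + b).1 / N) * ePi (-(2 * b.1 / N)) = ePi (2 * γ.1 / N) := by
      rw [← ePi_add]; congr 1; simp only [Prod.fst_add]; push_cast; ring
    rw [← e]; ring
  · intro x
    rw [← torsSum_mul_left]
    refine torsSum_congr fun b => ?_
    rw [show x + τ + s = x + s + τ by ring, wFun_add_tau h, wFun_neg_add_tau h, ← ePi_add]
    have e : ePi (-(τ + 2 * (x + s) + 2 * ζ / N + 2 * (γ + b).2 / N))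
        * ePi (-(τ + 2 * x - 2 * ζ / N - 2 * b.2 / N))
        = ePi (2 * (-γ.2 : ℤ) / N + -(2 * τ + 4 * x + 2 * s)) := by
      rw [← ePi_add]; congr 1; simp only [Prod.snd_add]; push_cast; ring
    rw [← e]; ring

lemma differentiable_torsSum_mul (h : IsTheta τ θ) (ζ s : ℂ) (γ : ℤ × ℤ) (c : ℤ × ℤ → ℂ) :
    Differentiable ℂ fun x => torsSum N
      (fun b => c b * (wFun N τ θ ζ (γ + b) (x + s) * wFun N τ θ ζ b (-x))) := by
  unfold torsSum
  refine Differentiable.fun_sum fun α _ => Differentiable.const_mul (Differentiable.mul ?_ ?_) _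
  · exact (differentiable_wFun h ζ _).comp (by fun_prop)
  · exact (differentiable_wFun h ζ _).comp (by fun_prop)

variable [NeZero N]

/-- Off-diagonal part of unitarity. -/
lemma unitarity_sum_eq_zero (hτ : 0 < τ.im) (h : IsTheta τ θ) {ζ : ℂ} (hζ : θ ζ ≠ 0) {γ : ℤ × ℤ}
    (hγ : ¬((N : ℤ) ∣ γ.1 ∧ (N : ℤ) ∣ γ.2)) (x : ℂ) :
    torsSum N (fun b => chi N γ b * (wFun N τ θ ζ (γ + b) x * wFun N τ θ ζ b (-x))) = 0 := by
  set F : ℂ → ℂ := fun x => torsSum N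
    (fun b => chi N γ b * (wFun N τ θ ζ (γ + b) (x + 0) * wFun N τ θ ζ b (-x))) with hF
  have h0 := theta_div_ne_zero (N := N) h hζ
  obtain ⟨h1, h2⟩ := torsSum_mul_multipliers (N := N) h ζ 0 γ (chi N γ)
  have hF0 : F 0 = 0 := by
    simp only [hF, add_zero, neg_zero, wFun_zero (h0 _), mul_one]
    exact torsSum_chi hγ
  -- All weights equal `1` at `0`, so the derivative is a difference of two character sums of `w'`;
  -- translation by `γ` identifies them because `χ_γ(γ) = 1`.
  have hFd : deriv F 0 = 0 := by
    have hd : HasDerivAt F (torsSum N fun b => chi N γ b *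
        (deriv (wFun N τ θ ζ (γ + b)) 0 - deriv (wFun N τ θ ζ b) 0)) 0 := by
      simp only [hF, torsSum]
      refine HasDerivAt.fun_sum fun α _ => HasDerivAt.const_mul _ ?_
      generalize ((((α.1 : ℕ) : ℤ), ((α.2 : ℕ) : ℤ)) : ℤ × ℤ) = b
      have d1 : HasDerivAt (fun x => wFun N τ θ ζ (γ + b) (x + 0)) (deriv (wFun N τ θ ζ (γ + b)) 0) 0 := by
        simpa using (differentiable_wFun h ζ (γ + b) 0).hasDerivAt
      have d2 : HasDerivAt (fun x => wFun N τ θ ζ b (-x)) (-deriv (wFun N τ θ ζ b) 0) 0 := by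
        have := (differentiable_wFun (N := N) h ζ b (-0)).hasDerivAt.comp 0 (hasDerivAt_neg (0 : ℂ))
        simpa [Function.comp_def] using this
      have d3 := d1.mul d2
      convert! d3 using 1
      simp only [add_zero, neg_zero, wFun_zero (h0 _)]; ring
    rw [hd.deriv]
    simp only [mul_sub]
    rw [torsSum_sub, sub_eq_zero]
    have hper : IsPer N fun b => deriv (wFun N τ θ ζ b) 0 := by
      have hw := fun s => wFun_isPer (N := N) h ζ s
      exact ⟨fun b => congrArg (fun f => deriv f 0) (funext fun s => (hw s).1 b),
        fun b => congrArg (fun f => deriv f 0) (funext fun s => (hw s).2 b)⟩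
    rw [← ((chi_isPer γ).mul hper).torsSum_add γ]
    exact torsSum_congr fun b => by rw [chi_add, chi_self, mul_one, add_comm γ b]
  obtain ⟨c, hc, hc'⟩ := h.eq_const_mul_mul hτ (F := F) (d₁ := 0) (d₂ := 0)
    (differentiable_torsSum_mul h ζ 0 γ _) (norm_ePi_int_div (N := N) γ.1) (norm_ePi_int_div (N := N) (-γ.2)) h1
    (fun x => by
      have e := h2 x
      rw [show (2 * τ + 4 * x + 2 * 0 : ℂ) = 2 * τ + 4 * x - 2 * 0 - 2 * 0 by ring] at e
      exact e) hF0 (Or.inr ⟨rfl, hFd⟩)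
  have hx : F x = 0 := by
    -- The multipliers are `N`-th roots of unity that are both trivial only if `N` divides `γ`;
    -- otherwise the constant is zero.
    rcases hc' with rfl | ⟨e1, e2⟩
    · rw [hc, zero_mul]
    · rw [ePi_div_eq_one_iff (N := N)] at e1 e2
      exact absurd ⟨e1, (dvd_neg.mp e2)⟩ hγ
  simpa only [hF, add_zero] using hx

/-- At `s = ζ` the theta functions in the Fourier transform are those of the weight itself, so `b ↦
w_b(ζ)` is self-dual with eigenvalue `N`. -/
lemma torsSum_chi_mul_wFun_self (hτ : 0 < τ.im) (h : IsTheta τ θ) {ζ : ℂ} (hζ : θ ζ ≠ 0)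
    (γ : ℤ × ℤ) : torsSum N (fun b => chi N γ b * wFun N τ θ ζ b ζ) = N * wFun N τ θ ζ γ ζ := by
  have e := torsSum_chi_mul_wFun (N := N) hτ h hζ γ ζ
  have h0 := theta_div_ne_zero (N := N) h hζ γ
  rw [wFun]
  rw [show ζ + ζ / N + tors N τ γ = ζ + (ζ / N + tors N τ γ) by ring] at e ⊢
  generalize θ (ζ + (ζ / N + tors N τ γ)) = v at *
  generalize θ (ζ / N + tors N τ γ) = u at *
  generalize ePi (2 * γ.1 * ζ / N) = w at *
  field_simp
  apply mul_right_cancel₀ hζ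
  linear_combination e

/-- At `s = -ζ` the oddness of `θ` adds a sign and a reflection to the self-duality. The opposite
sign is what makes the unitarity sum vanish at `ζ`. -/
lemma torsSum_chi_mul_wFun_neg (hτ : 0 < τ.im) (h : IsTheta τ θ) {ζ : ℂ} (hζ : θ ζ ≠ 0)
    (γ : ℤ × ℤ) :
    torsSum N (fun b => chi N γ b * wFun N τ θ ζ b (-ζ)) = -N * wFun N τ θ ζ (-γ) (-ζ) := by
  have e := torsSum_chi_mul_wFun (N := N) hτ h hζ γ (-ζ)
  have h0 := theta_div_ne_zero (N := N) h hζ (-γ)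
  rw [tors_neg] at h0
  rw [show -ζ / N + tors N τ γ = -(ζ / N + -tors N τ γ) by ring,
    show ζ + -ζ / N + tors N τ γ = -(-ζ + ζ / N + -tors N τ γ) by ring, h.odd, h.odd, h.odd] at e
  rw [wFun, tors_neg, show (2 * (-γ).1 * -ζ / N : ℂ) = 2 * γ.1 * ζ / N by
    simp only [Prod.fst_neg]; push_cast; ring]
  generalize θ (ζ / N + -tors N τ γ) = u at *
  generalize θ (-ζ + ζ / N + -tors N τ γ) = v at *
  generalize ePi (2 * γ.1 * ζ / N) = w at *
  field_simp
  apply mul_right_cancel₀ hζ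
  linear_combination -e

/-- Diagonal part of unitarity. -/
lemma unitarity_sum_diagonal (hτ : 0 < τ.im) (h : IsTheta τ θ) {ζ : ℂ} (hζ : θ ζ ≠ 0) (x : ℂ) :
    θ ζ ^ 2 * torsSum N (fun b => wFun N τ θ ζ b x * wFun N τ θ ζ b (-x))
      = (N : ℂ) ^ 2 * (θ (x + ζ) * θ (ζ - x)) := by
  have hN := cast_ne_zero' N
  have h0 := theta_div_ne_zero (N := N) h hζ
  set f : ℂ → ℂ := fun x => torsSum N (fun b => wFun N τ θ ζ b x * wFun N τ θ ζ b (-x)) with hf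
  have hfe : ∀ x, f (-x) = f x := fun x => by
    simp only [hf, neg_neg]
    exact torsSum_congr fun b => mul_comm _ _
  have hfeq : f = fun x => torsSum N
      (fun b => 1 * (wFun N τ θ ζ (0 + b) (x + 0) * wFun N τ θ ζ b (-x))) := by
    funext x; simp only [hf, zero_add, add_zero, one_mul]
  have hfd : Differentiable ℂ f := by
    rw [hfeq]; exact differentiable_torsSum_mul h ζ 0 0 _
  obtain ⟨h1, h2⟩ := torsSum_mul_multipliers (N := N) h ζ 0 0 (fun _ => 1)
  have hf1 : ∀ x, f (x + 1) = f x := fun x => by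
    have := h1 x
    simp only [hfeq]; rw [this]; simp [ePi_zero]
  have hf2 : ∀ x, f (x + τ) = ePi (-(2 * τ + 4 * x)) * f x := fun x => by
    have := h2 x
    simp only [hfeq]; rw [this]; simp [ePi_zero]
  -- Expanding `w(ζ)` or `w(-ζ)` as a Fourier transform evaluates one double sum both as `N f(ζ)`
  -- and as `-N f(ζ)`.
  have hfz : f ζ = 0 := by
    have e1 : N * f ζ = torsSum N fun b => torsSum N fun d =>
        chi N b d * wFun N τ θ ζ d ζ * wFun N τ θ ζ b (-ζ) := by
      simp only [hf]
      rw [← torsSum_mul_left]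
      refine torsSum_congr fun b => ?_
      rw [← mul_assoc, ← torsSum_chi_mul_wFun_self hτ h hζ b, mul_comm, ← torsSum_mul_left]
      exact torsSum_congr fun d => mul_comm _ _
    have e2 : (torsSum N fun b => torsSum N fun d =>
        chi N b d * wFun N τ θ ζ d ζ * wFun N τ θ ζ b (-ζ)) = -N * f ζ := by
      rw [torsSum_comm]
      simp only [hf]
      rw [← torsSum_mul_left]
      refine torsSum_congr fun d => ?_
      have e3 := torsSum_chi_mul_wFun_neg (N := N) hτ h hζ (-d)
      rw [neg_neg] at e3
      rw [mul_left_comm, ← e3, ← torsSum_mul_left]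
      refine torsSum_congr fun b => ?_
      rw [chi_swap b d]
      ring
    rw [e2] at e1
    have : (2 * N : ℂ) * f ζ = 0 := by linear_combination e1
    exact (mul_eq_zero.mp this).resolve_left (mul_ne_zero two_ne_zero hN)
  set D : ℂ → ℂ := fun x => θ ζ ^ 2 * f x - (N : ℂ) ^ 2 * (θ (x + ζ) * θ (ζ - x)) with hD
  have hDd : Differentiable ℂ D :=
    (hfd.const_mul _).sub (((h.diff.comp (by fun_prop)).mul (h.diff.comp (by fun_prop))).const_mul _)
  have hf0 : f 0 = (N : ℂ) ^ 2 := by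
    simp only [hf, neg_zero, wFun_zero (h0 _), mul_one, torsSum_const]
  have hD0 : D 0 = 0 := by simp only [hD, hf0, zero_add, sub_zero]; ring
  have hDe : ∀ x, D (-x) = D x := fun x => by
    simp only [hD, hfe]; rw [show -x + ζ = ζ - x by ring, show ζ - -x = x + ζ by ring]; ring
  -- `D` is even, so its zero at `0` is double and `D = c θ(x)²`; the further zero at `ζ` then gives
  -- `c = 0`.
  have hDd0 : deriv D 0 = 0 := by
    have e1 := deriv_comp_neg D 0
    rw [show (fun x => D (-x)) = D from funext hDe, neg_zero] at e1
    exact self_eq_neg.mp e1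
  obtain ⟨c, hc, -⟩ := h.eq_const_mul_mul hτ (F := D) (d₁ := 0) (d₂ := 0) (α := 1) (β := 1) hDd
    (by simp) (by simp)
    (fun x => by
      simp only [hD, hf1]
      rw [show x + 1 + ζ = x + ζ + 1 by ring, show ζ - (x + 1) = ζ - x - 1 by ring, h.add_one,
        h.sub_one]; ring)
    (fun x => by
      simp only [hD, hf2]
      rw [show x + τ + ζ = x + ζ + τ by ring, show ζ - (x + τ) = ζ - x - τ by ring, h.add_tau,
        h.sub_tau]
      have e : ePi (-(2 * τ + 4 * x)) = ePi (-(τ + 2 * (x + ζ))) * ePi (-(τ - 2 * (ζ - x))) := by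
        rw [← ePi_add]; congr 1; ring
      rw [show 2 * τ + 4 * x - 2 * 0 - 2 * 0 = 2 * τ + 4 * x by ring, e]; ring)
    hD0 (Or.inr ⟨rfl, hDd0⟩)
  have hDz : D ζ = 0 := by simp only [hD, hfz, sub_self, h.zero]; ring
  rw [hc, sub_zero] at hDz
  have hc0 : c = 0 := (mul_eq_zero.mp hDz).resolve_right (mul_ne_zero hζ hζ)
  have := hc x
  rw [hc0, zero_mul] at this
  exact sub_eq_zero.mp this

/-- The value `s = -Nζ` is where `θ(ζ + s/N)`, on the right of the Fourier transform at the trivial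
character, becomes `θ(0)`. This produces both zeros of the crossing sum, at `0` and at `Nζ`. -/
lemma torsSum_wFun_crossing (hτ : 0 < τ.im) (h : IsTheta τ θ) {ζ : ℂ} (hζ : θ ζ ≠ 0) :
    torsSum N (fun b => wFun N τ θ ζ b (-(N * ζ))) = 0 := by
  have hN := cast_ne_zero' N
  have e := torsSum_chi_mul_wFun (N := N) hτ h hζ 0 (-(N * ζ))
  have e1 : ∀ b, chi N 0 b = 1 := fun b => by simp [chi, ePi_zero]
  simp only [e1, one_mul, tors_zero, add_zero] at e
  rw [show -(N * ζ) / N = -ζ by field_simp, add_neg_cancel, h.zero, mul_zero, mul_zero] at e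
  have hζ' : θ (-ζ) ≠ 0 := by rw [h.odd]; exact neg_ne_zero.mpr hζ
  exact (mul_eq_zero.mp ((mul_eq_zero.mp e).resolve_left hζ')).resolve_right hζ

/-- The sum appearing in crossing symmetry, up to a constant. -/
lemma crossing_sum_eq_const_mul (hτ : 0 < τ.im) (h : IsTheta τ θ) {ζ : ℂ} (hζ : θ ζ ≠ 0)
    (hNζ : θ (N * ζ) ≠ 0) (γ : ℤ × ℤ) :
    ∃ c, (∀ x, torsSum N (fun b => wFun N τ θ ζ (γ + b) (x - N * ζ) * wFun N τ θ ζ b (-x))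
      = c * (θ x * θ (x - N * ζ))) ∧ (c = 0 ∨ ((N : ℤ) ∣ γ.1 ∧ (N : ℤ) ∣ γ.2)) := by
  have h0 := theta_div_ne_zero (N := N) h hζ
  set F : ℂ → ℂ := fun x => torsSum N
    (fun b => 1 * (wFun N τ θ ζ (γ + b) (x + -(N * ζ)) * wFun N τ θ ζ b (-x))) with hF
  have hFx : ∀ x, torsSum N (fun b => wFun N τ θ ζ (γ + b) (x - N * ζ) * wFun N τ θ ζ b (-x))
      = F x := fun x => by simp only [hF, one_mul, sub_eq_add_neg]
  obtain ⟨h1, h2⟩ := torsSum_mul_multipliers (N := N) h ζ (-(N * ζ)) γ (fun _ => 1)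
  have hF0 : F 0 = 0 := by
    simp only [hF, zero_add, neg_zero, wFun_zero (h0 _), mul_one, one_mul]
    have e1 := (wFun_isPer (N := N) h ζ (-(N * ζ))).torsSum_add γ
    rw [torsSum_wFun_crossing hτ h hζ] at e1
    rw [← e1]
    exact torsSum_congr fun b => by rw [add_comm]
  have hFN : F (N * ζ) = 0 := by
    simp only [hF, add_neg_cancel, wFun_zero (h0 _), one_mul]
    exact torsSum_wFun_crossing hτ h hζ
  obtain ⟨c, hc, hc'⟩ := h.eq_const_mul_mul hτ (F := F) (d₁ := 0) (d₂ := N * ζ)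
    (differentiable_torsSum_mul h ζ _ γ _) (norm_ePi_int_div (N := N) γ.1) (norm_ePi_int_div (N := N) (-γ.2)) h1
    (fun x => by
      have e := h2 x
      rw [show (2 * τ + 4 * x + 2 * -(N * ζ) : ℂ) = 2 * τ + 4 * x - 2 * 0 - 2 * (N * ζ) by ring] at e
      exact e) hF0 (Or.inl ⟨hFN, by rwa [sub_zero]⟩)
  refine ⟨c, fun x => by rw [hFx, hc, sub_zero], hc'.imp_right fun ⟨e1, e2⟩ => ?_⟩
  rw [ePi_div_eq_one_iff (N := N)] at e1 e2
  exact ⟨e1, dvd_neg.mp e2⟩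

/-- This fixes the constant in the diagonal crossing sum. At `x = -ζ` the factor `w_b(ζ)` is
replaced by its Fourier transform; after exchanging the sums, the theta functions cancel in every
term and all `N²` terms are equal. The cancellation needs `hg`. -/
lemma crossing_sum_at_neg (hτ : 0 < τ.im) (h : IsTheta τ θ) {ζ : ℂ} (hζ : θ ζ ≠ 0)
    (hg : ∀ α : Fin N × Fin N,
      θ (ζ + ζ / N + tors N τ (((α.1 : ℕ) : ℤ), ((α.2 : ℕ) : ℤ))) ≠ 0) :
    θ ζ * torsSum N (fun b => wFun N τ θ ζ b (-ζ - N * ζ) * wFun N τ θ ζ b ζ)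
      = (N : ℂ) ^ 2 * θ (-ζ - N * ζ) := by
  have hN := cast_ne_zero' N
  set s := -ζ - N * ζ with hs
  have e1 : N * torsSum N (fun b => wFun N τ θ ζ b s * wFun N τ θ ζ b ζ)
      = torsSum N fun d => wFun N τ θ ζ d ζ *
        torsSum N fun b => chi N (-d) b * wFun N τ θ ζ b s := by
    rw [← torsSum_mul_left]
    have e2 : ∀ b, N * (wFun N τ θ ζ b s * wFun N τ θ ζ b ζ)
        = torsSum N fun d => wFun N τ θ ζ d ζ * (chi N (-d) b * wFun N τ θ ζ b s) := fun b => by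
      rw [mul_left_comm, ← torsSum_chi_mul_wFun_self hτ h hζ b, ← torsSum_mul_left]
      exact torsSum_congr fun d => by rw [chi_swap b d]; ring
    rw [torsSum_congr e2, torsSum_comm]
    exact torsSum_congr fun d => torsSum_mul_left _ _
  have e3 : ∀ α : Fin N × Fin N, wFun N τ θ ζ (((α.1 : ℕ) : ℤ), ((α.2 : ℕ) : ℤ)) ζ *
      (torsSum N fun b => chi N (-(((α.1 : ℕ) : ℤ), ((α.2 : ℕ) : ℤ))) b * wFun N τ θ ζ b s)
      = N * θ s / θ ζ := fun α => by
    have hα := hg α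
    generalize ((((α.1 : ℕ) : ℤ), ((α.2 : ℕ) : ℤ)) : ℤ × ℤ) = d at *
    have e4 := torsSum_chi_mul_wFun (N := N) hτ h hζ (-d) s
    have hd := theta_div_ne_zero (N := N) h hζ d
    rw [tors_neg, show s / N + -tors N τ d = -(ζ + ζ / N + tors N τ d) by
        rw [hs]; field_simp; ring, show ζ + s / N + -tors N τ d = -(ζ / N + tors N τ d) by
        rw [hs]; field_simp; ring, h.odd, h.odd, show (2 * (-d).1 * ζ / N : ℂ)
          = -(2 * d.1 * ζ / N) by simp only [Prod.fst_neg]; push_cast; ring, ePi_neg] at e4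
    rw [wFun]
    have he := ePi_ne_zero (2 * d.1 * ζ / N)
    generalize θ (ζ / N + tors N τ d) = u at *
    generalize θ (ζ + ζ / N + tors N τ d) = v at *
    generalize ePi (2 * d.1 * ζ / N) = e at *
    field_simp at e4 ⊢
    linear_combination -e4
  have e5 : (torsSum N fun d => wFun N τ θ ζ d ζ *
        torsSum N fun b => chi N (-d) b * wFun N τ θ ζ b s) = (N : ℂ) ^ 2 * (N * θ s / θ ζ) := by
    rw [← torsSum_const (N := N)]
    exact Finset.sum_congr rfl fun α _ => e3 α
  rw [e5] at e1
  field_simp at e1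
  linear_combination e1

/-- Diagonal part of crossing symmetry. -/
lemma crossing_sum_diagonal (hτ : 0 < τ.im) (h : IsTheta τ θ) {ζ : ℂ} (hζ : θ ζ ≠ 0)
    (hNζ : θ (N * ζ) ≠ 0) (hNζ' : θ (-ζ - N * ζ) ≠ 0)
    (hg : ∀ α : Fin N × Fin N,
      θ (ζ + ζ / N + tors N τ (((α.1 : ℕ) : ℤ), ((α.2 : ℕ) : ℤ))) ≠ 0) (x : ℂ) :
    θ ζ ^ 2 * torsSum N (fun b => wFun N τ θ ζ b (x - N * ζ) * wFun N τ θ ζ b (-x))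
      = (N : ℂ) ^ 2 * (θ (x - N * ζ) * θ (-x)) := by
  obtain ⟨c, hc, -⟩ := crossing_sum_eq_const_mul hτ h hζ hNζ 0
  have e1 := crossing_sum_at_neg hτ h hζ hg
  have e2 := hc (-ζ)
  simp only [zero_add] at hc
  simp only [zero_add, neg_neg] at e2
  rw [e2, h.odd ζ] at e1
  have e3 : c * θ ζ ^ 2 = -(N : ℂ) ^ 2 := by
    apply mul_right_cancel₀ hNζ'
    linear_combination -e1
  rw [hc, h.odd]
  linear_combination (θ x * θ (x - N * ζ)) * e3

end

/-! ### The coefficients of the elliptic R-matrix -/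

/-- The pair of integers of an index `α`. -/
def ix {N : ℕ} (α : Fin N × Fin N) : ℤ × ℤ := (((α.1 : ℕ) : ℤ), ((α.2 : ℕ) : ℤ))

/-- The coefficient of `I_α ⊗ I_α⁻¹` in the R-matrix, up to a common factor. -/
noncomputable def coeffR (N : ℕ) (ζ τ : ℂ) (α : Fin N × Fin N) (x : ℂ) : ℂ :=
  thetaRatio N α ζ τ * thetaAlpha N α (x + ζ / N) τ

/-- The exponential factor relating a theta function with characteristics to `θ`. -/
noncomputable def charFactor (N : ℕ) (τ : ℂ) (α : Fin N × Fin N) (x : ℂ) : ℂ :=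
  ePi (((α.1 : ℕ) / N) ^ 2 * τ + 2 * ((α.1 : ℕ) / N) * (x + 1 / 2 + (α.2 : ℕ) / N))

/-- The theta function with characteristics `(1/2, 1/2)`. -/
noncomputable def theta (τ x : ℂ) : ℂ := thetaChar (1 / 2) (1 / 2) x τ

lemma isTheta_theta {τ : ℂ} (hτ : 0 < τ.im) : IsTheta τ (theta τ) := isTheta_thetaChar hτ

lemma thetaAlpha_eq (N : ℕ) (τ : ℂ) (α : Fin N × Fin N) (x : ℂ) :
    thetaAlpha N α x τ = charFactor N τ α x * theta τ (x + tors N τ (ix α)) := by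
  rw [thetaAlpha, thetaChar_add_left, charFactor, theta, tors, ix]
  congr 3
  push_cast; ring

lemma continuous_charFactor (N : ℕ) (τ : ℂ) (α : Fin N × Fin N) : Continuous (charFactor N τ α) :=
  differentiable_ePi.continuous.comp (by fun_prop)

lemma charFactor_ne_zero (N : ℕ) (τ : ℂ) (α : Fin N × Fin N) (x : ℂ) : charFactor N τ α x ≠ 0 :=
  ePi_ne_zero _

lemma charFactor_add (N : ℕ) (τ : ℂ) (α : Fin N × Fin N) (x y : ℂ) :
    charFactor N τ α (x + y) = ePi (2 * (ix α).1 * x / N) * charFactor N τ α y := by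
  rw [charFactor, charFactor, ← ePi_add, ix]; congr 1; push_cast; ring

section

variable {N : ℕ} [NeZero N] {τ : ℂ}

/-- The limit defining `thetaRatio` exists, and depends analytically on `ζ`. -/
lemma exists_thetaRatio_eq (hτ : 0 < τ.im) (α : Fin N × Fin N) :
    ∃ Q : ℂ → ℂ, Differentiable ℂ Q ∧
      (∀ ζ, theta τ ζ = theta τ (ζ / N + tors N τ (ix α)) * Q ζ) ∧
      ∀ ζ, thetaRatio N α ζ τ = Q ζ / (N * charFactor N τ α (ζ / N)) := by
  have hN := cast_ne_zero' N
  have h := isTheta_theta hτ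
  obtain ⟨Q, hQ, hQ1, -⟩ := exists_theta_quotient (N := N) h (ix α)
  refine ⟨Q, hQ, hQ1, fun ζ => ?_⟩
  refine Filter.Tendsto.limUnder_eq ?_
  have hcont : Continuous fun ζ => Q ζ / (N * charFactor N τ α (ζ / N)) :=
    hQ.continuous.div (continuous_const.mul ((continuous_charFactor N τ α).comp (by fun_prop)))
      fun ζ => mul_ne_zero hN (charFactor_ne_zero _ _ _ _)
  refine (hcont.continuousAt.tendsto.mono_left nhdsWithin_le_nhds).congr' ?_
  have h2 := eventually_codiscrete_iff.mp h.eventually_ne_zero ζ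
  filter_upwards [h2] with ζ' hζ'
  have h0 := theta_div_ne_zero (N := N) h hζ' (ix α)
  rw [thetaAlpha_eq]
  have e : thetaChar (1 / 2) (1 / 2) ζ' τ = theta τ (ζ' / N + tors N τ (ix α)) * Q ζ' := hQ1 ζ'
  rw [e]
  have := charFactor_ne_zero N τ α (ζ' / N)
  generalize theta τ (ζ' / N + tors N τ (ix α)) = u at *
  field_simp

/-- Bridge from the R-matrix to the torsion sums: for generic `ζ` the exponential factors of the
characteristics combine into the prefactor of `wFun`. -/
lemma coeffR_eq (hτ : 0 < τ.im) {ζ : ℂ} (hζ : theta τ ζ ≠ 0) (α : Fin N × Fin N) (x : ℂ) :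
    coeffR N ζ τ α x = theta τ ζ / N * wFun N τ (theta τ) ζ (ix α) x := by
  have hN := cast_ne_zero' N
  obtain ⟨Q, -, hQ1, hQ2⟩ := exists_thetaRatio_eq hτ α
  have h0 := theta_div_ne_zero (N := N) (isTheta_theta hτ) hζ (ix α)
  have hc := charFactor_ne_zero N τ α (ζ / N)
  rw [coeffR, hQ2, thetaAlpha_eq, charFactor_add, wFun, hQ1 ζ]
  generalize theta τ (ζ / N + tors N τ (ix α)) = u at *
  field_simp

/-- Continuity in `ζ`, also when the argument moves with `ζ` as it does in crossing, is what removes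
the genericity conditions. -/
lemma continuous_coeffR (hτ : 0 < τ.im) (α : Fin N × Fin N) {f : ℂ → ℂ} (hf : Continuous f) :
    Continuous fun ζ => coeffR N ζ τ α (f ζ) := by
  have hN := cast_ne_zero' N
  obtain ⟨Q, hQ, -, hQ2⟩ := exists_thetaRatio_eq hτ α
  simp only [coeffR, hQ2, thetaAlpha_eq]
  have hcf := continuous_charFactor N τ α
  have hθ := (isTheta_theta hτ).diff.continuous
  refine (hQ.continuous.div (continuous_const.mul (hcf.comp (by fun_prop)))
      fun ζ => mul_ne_zero hN (charFactor_ne_zero _ _ _ _)).mul ?_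
  exact (hcf.comp (by fun_prop)).mul (hθ.comp (by fun_prop))

end

lemma differentiable_coeffR (N : ℕ) {τ : ℂ} (hτ : 0 < τ.im) (ζ : ℂ) (α : Fin N × Fin N) :
    Differentiable ℂ (coeffR N ζ τ α) :=
  ((differentiable_thetaChar hτ _ _).comp (differentiable_id.add_const _)).const_mul _

/-- The multiplier depends on `α` only through the character `ω^{α₁-α₂}`, by which conjugation with
`gh` acts on `I_α`. This is why `Γ` appears. -/
lemma coeffR_add_tau_add_one (N : ℕ) {τ : ℂ} (hτ : 0 < τ.im) (ζ : ℂ) (α : Fin N × Fin N) (x : ℂ) :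
    coeffR N ζ τ α (x + (τ + 1))
      = ePi (-(τ + 2 * x + 2 * ζ / N)) * ePi (2 * ((ix α).1 - (ix α).2) / N)
        * coeffR N ζ τ α x := by
  have h := isTheta_theta hτ
  have e1 : ePi (2 * x + 2) = ePi (2 * x) := by rw [ePi_add, ePi_two, mul_one]
  rw [coeffR, coeffR, thetaAlpha_eq, thetaAlpha_eq, show x + (τ + 1) + ζ / N
    = (τ + 1) + (x + ζ / N) by ring, charFactor_add,
    show τ + 1 + (x + ζ / N) + tors N τ (ix α) = (x + ζ / N + tors N τ (ix α)) + τ + 1 by ring,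
    h.add_one, h.add_tau]
  have e2 : ePi (2 * (ix α).1 * (τ + 1) / N) * ePi (-(τ + 2 * (x + ζ / N + tors N τ (ix α))))
      = ePi (-(τ + 2 * x + 2 * ζ / N)) * ePi (2 * ((ix α).1 - (ix α).2) / N) := by
    rw [← ePi_add, ← ePi_add]; congr 1; rw [tors]; ring
  rw [← e2]; ring

/-- The coefficients are functions on the curve of pairs `(z, z^{2/N})`. -/
lemma coeffR_add_of_samePoint (N : ℕ) (ζ τ : ℂ) (α : Fin N × Fin N) {d : ℂ} (h1 : ePi d = 1)
    (h2 : ePi (2 * d / N) = 1) (x : ℂ) : coeffR N ζ τ α (x + d) = coeffR N ζ τ α x := by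
  rw [coeffR, coeffR, thetaAlpha, thetaAlpha, thetaChar, thetaChar]
  congr 1
  refine tsum_congr fun m => ?_
  have e : ePi (((2 * m : ℤ) : ℂ) * d) * ePi d * ePi (((α.1 : ℕ) : ℂ) * (2 * d / N)) = 1 := by
    rw [ePi_int_mul, ePi_nat_mul, h1, h2]; simp
  have e2 : ∀ A B : ℂ, B = A + Complex.I * Real.pi * (((2 * m : ℤ) : ℂ) * d + d
      + ((α.1 : ℕ) : ℂ) * (2 * d / N)) → Complex.exp B = Complex.exp A := by
    intro A B hAB
    rw [hAB, Complex.exp_add, ← ePi, ePi_add, ePi_add, e, mul_one]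
  apply e2
  push_cast; ring

/-! ### The matrices `g`, `h` and the finite Heisenberg group -/

lemma zpow_mul_zpow_of_central {G : Type*} [Group G] {c g h : G} (hc : ∀ x, Commute c x)
    (hgh : h * g = c * g * h) (a b : ℤ) : h ^ a * g ^ b = c ^ (a * b) * g ^ b * h ^ a := by
  have h1 : SemiconjBy h g (c * g) := hgh
  have h2 : SemiconjBy h (g ^ b) (c ^ b * g ^ b) := by
    simpa [(hc g).mul_zpow] using h1.zpow_right b
  have h3 : SemiconjBy (g ^ b) (c ^ b * h) h := by
    have := ((hc (g ^ b)).zpow_left b).eq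
    rw [SemiconjBy, h2.eq, ← mul_assoc, this]
  have h4 := h3.zpow_right a
  rw [((hc h).zpow_left b).mul_zpow, ← zpow_mul, mul_comm b] at h4
  rw [← h4.eq, ← mul_assoc, ((hc (g ^ b)).zpow_left (a * b)).eq]

lemma hMat_pow (N k : ℕ) (i j : Fin N) :
    (hMat N ^ k) i j = if ((i : ℕ) + k) % N = (j : ℕ) then 1 else 0 := by
  have hN : 0 < N := i.pos
  induction k generalizing j with
  | zero =>
    rw [pow_zero, Matrix.one_apply, add_zero, Nat.mod_eq_of_lt i.2]
    simp only [Fin.ext_iff]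
  | succ k ih =>
    rw [pow_succ, Matrix.mul_apply,
      Finset.sum_eq_single (⟨((i : ℕ) + k) % N, Nat.mod_lt _ hN⟩ : Fin N)]
    · rw [ih, if_pos rfl, one_mul, hMat, Matrix.of_apply]
      simp [Nat.add_assoc]
    · intro l _ hl
      rw [ih, if_neg, zero_mul]
      intro h; exact hl (Fin.ext h.symm)
    · simp

lemma hMat_pow_card (N : ℕ) : hMat N ^ N = 1 := by
  ext i j
  rw [hMat_pow, Nat.add_mod_right, Nat.mod_eq_of_lt i.2, Matrix.one_apply]
  simp only [Fin.ext_iff]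

lemma gMat_pow_card (N : ℕ) : gMat N ^ N = 1 := by
  rw [gMat, Matrix.diagonal_pow, ← Matrix.diagonal_one]
  congr 1
  funext i
  have hN : (N : ℂ) ≠ 0 := Nat.cast_ne_zero.mpr i.pos.ne'
  rw [Pi.pow_apply, ← ePi_nat_mul,
    show (N : ℂ) * (2 * ((i : ℕ) + 1) / N) = 2 * (((i : ℕ) + 1 : ℕ) : ℂ) by push_cast; field_simp,
    ePi_two_mul_nat]

lemma hMat_mul_gMat (N : ℕ) : hMat N * gMat N = ePi (2 / N) • (gMat N * hMat N) := by
  ext i j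
  have hN : (N : ℂ) ≠ 0 := Nat.cast_ne_zero.mpr i.pos.ne'
  rw [gMat, Matrix.mul_diagonal, Matrix.smul_apply, Matrix.diagonal_mul, hMat, Matrix.of_apply,
    smul_eq_mul]
  split_ifs with h
  -- The wrap-around of the index contributes a multiple of `N`, invisible to `ω`.
  · have e : ((i : ℕ) : ℂ) + 1 = (j : ℕ) + N * (((i : ℕ) + 1) / N : ℕ) := by
      have := Nat.mod_add_div ((i : ℕ) + 1) N
      rw [h] at this
      exact_mod_cast this.symm
    rw [e, one_mul, mul_one, ← ePi_add, show (2 / N + 2 * (((j : ℕ) : ℂ) + N * ((((i : ℕ) + 1) / N : ℕ) : ℂ)) / N : ℂ)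
      = 2 * ((j : ℕ) + 1) / N + 2 * (((((i : ℕ) + 1) / N : ℕ)) : ℂ) by field_simp; ring, ePi_add (_ / _),
      ePi_two_mul_nat, mul_one]
  · simp

/-- The scalar matrix `ω`. -/
noncomputable def omegaUnit (N : ℕ) : (Matrix (Fin N) (Fin N) ℂ)ˣ :=
  Units.map (algebraMap ℂ (Matrix (Fin N) (Fin N) ℂ)).toMonoidHom
    (Units.mk0 (ePi (2 / N)) (ePi_ne_zero _))

lemma omegaUnit_commute (N : ℕ) (x : (Matrix (Fin N) (Fin N) ℂ)ˣ) : Commute (omegaUnit N) x :=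
  Units.ext (Algebra.commutes _ _)

lemma omegaUnit_zpow_mul (N : ℕ) (k : ℤ) (x : (Matrix (Fin N) (Fin N) ℂ)ˣ) :
    ((omegaUnit N ^ k * x : (Matrix (Fin N) (Fin N) ℂ)ˣ) : Matrix (Fin N) (Fin N) ℂ)
      = ePi (2 * k / N) • (x : Matrix (Fin N) (Fin N) ℂ) := by
  rw [Units.val_mul, omegaUnit, ← map_zpow, Units.coe_map, Units.val_zpow_eq_zpow_val,
    Units.val_mk0, ← ePi_int_mul, Algebra.smul_def]
  rw [show (k : ℂ) * (2 / N) = 2 * k / N by ring]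
  rfl

section

variable (N : ℕ) [NeZero N]

/-- `g` as an invertible matrix. -/
noncomputable def gUnit : (Matrix (Fin N) (Fin N) ℂ)ˣ :=
  Units.ofPowEqOne (gMat N) N (gMat_pow_card N) (NeZero.ne N)

/-- `h` as an invertible matrix. -/
noncomputable def hUnit : (Matrix (Fin N) (Fin N) ℂ)ˣ :=
  Units.ofPowEqOne (hMat N) N (hMat_pow_card N) (NeZero.ne N)

lemma gUnit_val : (gUnit N : Matrix (Fin N) (Fin N) ℂ) = gMat N := rfl

lemma hUnit_val : (hUnit N : Matrix (Fin N) (Fin N) ℂ) = hMat N := rfl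

lemma hUnit_mul_gUnit : hUnit N * gUnit N = omegaUnit N * gUnit N * hUnit N := by
  refine Units.ext ?_
  have h := omegaUnit_zpow_mul N 1 (gUnit N * hUnit N)
  rw [zpow_one, ← mul_assoc] at h
  rw [h, Units.val_mul, gUnit_val, hUnit_val, hMat_mul_gMat, Units.val_mul, gUnit_val, hUnit_val]
  norm_num

/-- `g^{b₂} h^{b₁}` for integers `b₁, b₂`. -/
noncomputable def heis (b : ℤ × ℤ) : (Matrix (Fin N) (Fin N) ℂ)ˣ := gUnit N ^ b.2 * hUnit N ^ b.1

lemma heis_isPer : IsPer N (heis N) := by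
  have h1 : gUnit N ^ N = 1 := Units.pow_ofPowEqOne _ _
  have h2 : hUnit N ^ N = 1 := Units.pow_ofPowEqOne _ _
  constructor <;> intro b <;> simp [heis, zpow_add, h1, h2]

lemma heis_zero : heis N 0 = 1 := by simp [heis]

lemma heis_mul (γ b : ℤ × ℤ) : heis N γ * heis N b = omegaUnit N ^ (γ.1 * b.2) * heis N (γ + b) := by
  have h := zpow_mul_zpow_of_central (omegaUnit_commute N) (hUnit_mul_gUnit N) γ.1 b.2
  have h' := ((omegaUnit_commute N (gUnit N ^ γ.2)).zpow_left (γ.1 * b.2)).eq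
  rw [heis, heis, heis, Prod.fst_add, Prod.snd_add, zpow_add, zpow_add]
  calc gUnit N ^ γ.2 * hUnit N ^ γ.1 * (gUnit N ^ b.2 * hUnit N ^ b.1)
      = gUnit N ^ γ.2 * (hUnit N ^ γ.1 * gUnit N ^ b.2) * hUnit N ^ b.1 := by group
    _ = gUnit N ^ γ.2 * omegaUnit N ^ (γ.1 * b.2) * gUnit N ^ b.2 * hUnit N ^ γ.1 * hUnit N ^ b.1 := by
        rw [h]; group
    _ = _ := by rw [← h']; group

lemma heis_add_mul_inv (γ b : ℤ × ℤ) :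
    heis N (γ + b) * (heis N b)⁻¹ = omegaUnit N ^ (-(γ.1 * b.2)) * heis N γ := by
  rw [mul_inv_eq_iff_eq_mul, mul_assoc, heis_mul, ← mul_assoc, ← zpow_add, neg_add_cancel,
    zpow_zero, one_mul]

lemma heis_inv_mul_add (γ b : ℤ × ℤ) :
    (heis N b)⁻¹ * heis N (γ + b) = omegaUnit N ^ (-(b.1 * γ.2)) * heis N γ := by
  have h := ((omegaUnit_commute N (heis N b)).zpow_left (-(b.1 * γ.2))).eq
  rw [inv_mul_eq_iff_eq_mul, ← mul_assoc, ← h, mul_assoc, heis_mul, ← mul_assoc, ← zpow_add,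
    neg_add_cancel, zpow_zero, one_mul, add_comm]

lemma heis_add_inv_mul (γ b : ℤ × ℤ) :
    (heis N (γ + b))⁻¹ * heis N b = omegaUnit N ^ (b.1 * γ.2) * (heis N γ)⁻¹ := by
  have h := congrArg (·⁻¹) (heis_inv_mul_add N γ b)
  simp only [mul_inv_rev, inv_inv, zpow_neg] at h
  rw [h, ((omegaUnit_commute N (heis N γ)⁻¹).zpow_left _).eq]

lemma IMat_eq_heis (α : Fin N × Fin N) :
    IMat N α = (heis N (ix α) : Matrix (Fin N) (Fin N) ℂ) := by
  simp [IMat, heis, ix, gUnit_val, hUnit_val]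

lemma IMat_inv_eq_heis (α : Fin N × Fin N) :
    (IMat N α)⁻¹ = (((heis N (ix α))⁻¹ : (Matrix (Fin N) (Fin N) ℂ)ˣ) : Matrix (Fin N) (Fin N) ℂ) := by
  rw [IMat_eq_heis, Matrix.coe_units_inv]

/-- `(gh)⁻¹ I_α gh = ω^{α₁ - α₂} I_α`. -/
lemma heis_conj (b : ℤ × ℤ) :
    (heis N (1, 1))⁻¹ * heis N b * heis N (1, 1) = omegaUnit N ^ (b.1 - b.2) * heis N b := by
  have h := ((omegaUnit_commute N (heis N (1, 1))).zpow_left (b.1 - b.2)).eq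
  rw [mul_assoc, inv_mul_eq_iff_eq_mul, ← mul_assoc, ← h, mul_assoc, heis_mul, heis_mul,
    ← mul_assoc, ← zpow_add, add_comm (1, 1)]
  congr 2; ring

end

/-! ### The R-matrix without its scalar factor -/

lemma transpose₁_kronecker {N : ℕ} (A B : Matrix (Fin N) (Fin N) ℂ) :
    transpose₁ (A ⊗ₖ B) = A.transpose ⊗ₖ B := rfl

lemma transpose₁_sum {N : ℕ} {ι : Type*} (s : Finset ι)
    (f : ι → Matrix (Fin N × Fin N) (Fin N × Fin N) ℂ) :
    transpose₁ (∑ i ∈ s, f i) = ∑ i ∈ s, transpose₁ (f i) := by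
  ext a b; simp [transpose₁, Matrix.sum_apply]

lemma transpose₁_smul {N : ℕ} (c : ℂ) (X : Matrix (Fin N × Fin N) (Fin N × Fin N) ℂ) :
    transpose₁ (c • X) = c • transpose₁ X := rfl

lemma continuous_transpose₁ {N : ℕ} : Continuous (transpose₁ (N := N)) :=
  continuous_matrix fun a b => continuous_id.matrix_elem (b.1, a.2) (a.1, b.2)

/-- `∑_α W_α(x) I_α ⊗ I_α⁻¹`. -/
noncomputable def ZSum (N : ℕ) (ζ τ x : ℂ) : Matrix (Fin N × Fin N) (Fin N × Fin N) ℂ :=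
  ∑ α : Fin N × Fin N, coeffR N ζ τ α x • (IMat N α ⊗ₖ (IMat N α)⁻¹)

/-- `∑_α W_α(x) I_α⁻¹ ⊗ I_α`. -/
noncomputable def ZFlip (N : ℕ) (ζ τ x : ℂ) : Matrix (Fin N × Fin N) (Fin N × Fin N) ℂ :=
  ∑ α : Fin N × Fin N, coeffR N ζ τ α x • ((IMat N α)⁻¹ ⊗ₖ IMat N α)

/-- The substitution `α = γ + β` sorts a product of two R-matrices by the Heisenberg element `γ`
that it produces. -/
lemma sum_sum_shift {N : ℕ} {A : Type*} [AddCommGroup A] {K : ℤ × ℤ → ℤ × ℤ → A}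
    (hK : ∀ b, IsPer N fun a => K a b) :
    ∑ α : Fin N × Fin N, ∑ β : Fin N × Fin N, K (ix α) (ix β)
      = ∑ γ : Fin N × Fin N, ∑ β : Fin N × Fin N, K (ix γ + ix β) (ix β) := by
  refine Finset.sum_comm.trans (Eq.trans ?_ Finset.sum_comm)
  exact Finset.sum_congr rfl fun β _ => ((hK (ix β)).sum_add (ix β)).symm

/-! ### Unitarity, crossing and quasi-periodicity of the matrix part. -/

section

variable {N : ℕ} [NeZero N] {τ : ℂ}

lemma continuous_ZSum (hτ : 0 < τ.im) {f : ℂ → ℂ} (hf : Continuous f) :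
    Continuous fun ζ => ZSum N ζ τ (f ζ) :=
  continuous_finsetSum _ fun α _ => (continuous_coeffR hτ α hf).smul continuous_const

lemma continuous_ZFlip (hτ : 0 < τ.im) {f : ℂ → ℂ} (hf : Continuous f) :
    Continuous fun ζ => ZFlip N ζ τ (f ζ) :=
  continuous_finsetSum _ fun α _ => (continuous_coeffR hτ α hf).smul continuous_const

lemma ix_zero : ix (0 : Fin N × Fin N) = 0 := by simp [ix]

lemma eq_zero_of_dvd_ix {γ : Fin N × Fin N} (h : (N : ℤ) ∣ (ix γ).1 ∧ (N : ℤ) ∣ (ix γ).2) : γ = 0 := by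
  have aux : ∀ i : Fin N, (N : ℤ) ∣ ((i : ℕ) : ℤ) → i = 0 := fun i hi => by
    have := Nat.eq_zero_of_dvd_of_lt (Int.natCast_dvd_natCast.mp hi) i.2
    exact Fin.ext (by simpa using this)
  exact Prod.ext (aux _ h.1) (aux _ h.2)

/-- After regrouping, the powers of `ω` from the two tensor factors combine to `χ_γ(β)`; the terms
with `γ ≠ 0` vanish by `unitarity_sum_eq_zero`. -/
lemma ZSum_mul_ZFlip_generic (hτ : 0 < τ.im) {ζ : ℂ} (hζ : theta τ ζ ≠ 0) (x : ℂ) :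
    ZSum N ζ τ x * ZFlip N ζ τ (-x) = (theta τ (x + ζ) * theta τ (ζ - x)) • 1 := by
  have hN := cast_ne_zero' N
  have hθ := isTheta_theta hτ
  set w := wFun N τ (theta τ) ζ with hw
  let K : ℤ × ℤ → ℤ × ℤ → Matrix (Fin N × Fin N) (Fin N × Fin N) ℂ := fun a b =>
    (w a x * w b (-x)) • (((heis N a * (heis N b)⁻¹ : (Matrix (Fin N) (Fin N) ℂ)ˣ) : Matrix _ _ ℂ)
      ⊗ₖ (((heis N a)⁻¹ * heis N b : (Matrix (Fin N) (Fin N) ℂ)ˣ) : Matrix _ _ ℂ))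
  have hK : ∀ b, IsPer N fun a => K a b := fun b => by
    have h1 := wFun_isPer (N := N) hθ ζ x
    have h2 := heis_isPer N
    exact ⟨fun a => by simp only [K, hw, h1.1, h2.1], fun a => by simp only [K, hw, h1.2, h2.2]⟩
  have e1 : ZSum N ζ τ x * ZFlip N ζ τ (-x)
      = (theta τ ζ / N) ^ 2 • ∑ α : Fin N × Fin N, ∑ β : Fin N × Fin N, K (ix α) (ix β) := by
    rw [ZSum, ZFlip, Finset.sum_mul_sum, Finset.smul_sum]
    refine Finset.sum_congr rfl fun α _ => ?_
    rw [Finset.smul_sum]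
    refine Finset.sum_congr rfl fun β _ => ?_
    rw [coeffR_eq hτ hζ, coeffR_eq hτ hζ, Matrix.smul_mul, Matrix.mul_smul,
      ← Matrix.mul_kronecker_mul, smul_smul, IMat_inv_eq_heis, IMat_inv_eq_heis, IMat_eq_heis,
      IMat_eq_heis, ← Units.val_mul, ← Units.val_mul, smul_smul]
    congr 1
    ring
  have e2 : ∀ γ b : ℤ × ℤ, K (γ + b) b = (chi N γ b * (w (γ + b) x * w b (-x))) •
      ((heis N γ : Matrix _ _ ℂ) ⊗ₖ (((heis N γ)⁻¹ : (Matrix (Fin N) (Fin N) ℂ)ˣ) : Matrix _ _ ℂ)) := by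
    intro γ b
    simp only [K]
    rw [heis_add_mul_inv, heis_add_inv_mul, omegaUnit_zpow_mul, omegaUnit_zpow_mul,
      Matrix.smul_kronecker, Matrix.kronecker_smul, smul_smul, smul_smul]
    congr 1
    have e : chi N γ b = ePi (2 * ((-(γ.1 * b.2) : ℤ) : ℂ) / N) * ePi (2 * ((b.1 * γ.2 : ℤ) : ℂ) / N) := by
      rw [chi, ← ePi_add]; congr 1; push_cast; ring
    rw [e]; ring
  rw [e1, sum_sum_shift hK, Finset.sum_eq_single 0]
  · simp only [e2, ← Finset.sum_smul, ix_zero, heis_zero, inv_one, Units.val_one,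
      Matrix.one_kronecker_one, smul_smul]
    congr 1
    have h := unitarity_sum_diagonal (N := N) hτ hθ hζ x
    have h2 : ∑ β : Fin N × Fin N, chi N 0 (ix β) * (w (0 + ix β) x * w (ix β) (-x))
        = torsSum N fun b => w b x * w b (-x) :=
      Finset.sum_congr rfl fun β _ => by
        rw [zero_add, show chi N 0 (ix β) = 1 by simp [chi, ePi_zero], one_mul]; rfl
    rw [h2, div_pow, div_mul_eq_mul_div, h]
    field_simp
  · intro γ _ hγ
    simp only [e2, ← Finset.sum_smul]
    have h := unitarity_sum_eq_zero (N := N) hτ hθ hζ (fun h => hγ (eq_zero_of_dvd_ix h)) x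
    have h2 : ∑ β : Fin N × Fin N, chi N (ix γ) (ix β) * (w (ix γ + ix β) x * w (ix β) (-x)) = 0 := h
    rw [h2, zero_smul]
  · simp

/-- Unitarity. -/
lemma ZSum_mul_ZFlip (hτ : 0 < τ.im) (ζ x : ℂ) :
    ZSum N ζ τ x * ZFlip N ζ τ (-x) = (theta τ (x + ζ) * theta τ (ζ - x)) • 1 := by
  have hθ := (isTheta_theta hτ).diff.continuous
  ext a b
  refine eq_of_eventually_codiscrete
    (f := fun ζ => (ZSum N ζ τ x * ZFlip N ζ τ (-x)) a b)
    (g := fun ζ => ((theta τ (x + ζ) * theta τ (ζ - x)) •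
      (1 : Matrix (Fin N × Fin N) (Fin N × Fin N) ℂ)) a b) ?_ ?_ ?_ ζ
  · exact ((continuous_ZSum hτ continuous_const).matrix_mul
      (continuous_ZFlip hτ continuous_const)).matrix_elem a b
  · simp only [Matrix.smul_apply, smul_eq_mul]; fun_prop
  · filter_upwards [(isTheta_theta hτ).eventually_ne_zero] with ζ hζ
    rw [ZSum_mul_ZFlip_generic hτ hζ]

/-- Transposition reverses the product in the first factor, so the powers of `ω` from the two
factors now cancel. This is why the crossing sums carry no character, unlike the unitarity sums. -/
lemma ZSum_crossing_generic (hτ : 0 < τ.im) {ζ : ℂ} (hζ : theta τ ζ ≠ 0) (hNζ : theta τ (N * ζ) ≠ 0)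
    (hNζ' : theta τ (-ζ - N * ζ) ≠ 0)
    (hg : ∀ α : Fin N × Fin N, theta τ (ζ + ζ / N + tors N τ (ix α)) ≠ 0) (x : ℂ) :
    transpose₁ (ZSum N ζ τ (x - N * ζ)) * transpose₁ (ZFlip N ζ τ (-x))
      = (theta τ (x - N * ζ) * theta τ (-x)) • 1 := by
  have hN := cast_ne_zero' N
  have hθ := isTheta_theta hτ
  set w := wFun N τ (theta τ) ζ with hw
  let K : ℤ × ℤ → ℤ × ℤ → Matrix (Fin N × Fin N) (Fin N × Fin N) ℂ := fun a b =>
    (w a (x - N * ζ) * w b (-x)) •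
      (((((heis N b)⁻¹ * heis N a : (Matrix (Fin N) (Fin N) ℂ)ˣ) : Matrix _ _ ℂ)).transpose
      ⊗ₖ (((heis N a)⁻¹ * heis N b : (Matrix (Fin N) (Fin N) ℂ)ˣ) : Matrix _ _ ℂ))
  have hK : ∀ b, IsPer N fun a => K a b := fun b => by
    have h1 := wFun_isPer (N := N) hθ ζ (x - N * ζ)
    have h2 := heis_isPer N
    exact ⟨fun a => by simp only [K, hw, h1.1, h2.1], fun a => by simp only [K, hw, h1.2, h2.2]⟩
  have e1 : transpose₁ (ZSum N ζ τ (x - N * ζ)) * transpose₁ (ZFlip N ζ τ (-x))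
      = (theta τ ζ / N) ^ 2 • ∑ α : Fin N × Fin N, ∑ β : Fin N × Fin N, K (ix α) (ix β) := by
    rw [ZSum, ZFlip, transpose₁_sum, transpose₁_sum, Finset.sum_mul_sum, Finset.smul_sum]
    refine Finset.sum_congr rfl fun α _ => ?_
    rw [Finset.smul_sum]
    refine Finset.sum_congr rfl fun β _ => ?_
    rw [coeffR_eq hτ hζ, coeffR_eq hτ hζ, transpose₁_smul, transpose₁_smul, Matrix.smul_mul,
      Matrix.mul_smul, transpose₁_kronecker, transpose₁_kronecker,
      ← Matrix.mul_kronecker_mul, smul_smul, IMat_inv_eq_heis, IMat_inv_eq_heis, IMat_eq_heis,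
      IMat_eq_heis, ← Matrix.transpose_mul, ← Units.val_mul, ← Units.val_mul, smul_smul]
    congr 1
    ring
  have e2 : ∀ γ b : ℤ × ℤ, K (γ + b) b = (w (γ + b) (x - N * ζ) * w b (-x)) •
      ((heis N γ : Matrix _ _ ℂ).transpose ⊗ₖ
        (((heis N γ)⁻¹ : (Matrix (Fin N) (Fin N) ℂ)ˣ) : Matrix _ _ ℂ)) := by
    intro γ b
    simp only [K]
    rw [heis_inv_mul_add, heis_add_inv_mul, omegaUnit_zpow_mul, omegaUnit_zpow_mul,
      Matrix.transpose_smul, Matrix.smul_kronecker, Matrix.kronecker_smul, smul_smul, smul_smul]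
    congr 1
    rw [mul_assoc, ← ePi_add, show (2 * ((-(b.1 * γ.2) : ℤ) : ℂ) / N + 2 * ((b.1 * γ.2 : ℤ) : ℂ) / N : ℂ)
      = 0 by push_cast; ring, ePi_zero, mul_one]
  rw [e1, sum_sum_shift hK, Finset.sum_eq_single 0]
  · simp only [e2, ← Finset.sum_smul, ix_zero, heis_zero, inv_one, Units.val_one,
      Matrix.transpose_one, Matrix.one_kronecker_one, smul_smul]
    congr 1
    have h := crossing_sum_diagonal (N := N) hτ hθ hζ hNζ hNζ' hg x
    have h2 : ∑ β : Fin N × Fin N, (w (0 + ix β) (x - N * ζ) * w (ix β) (-x))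
        = torsSum N fun b => w b (x - N * ζ) * w b (-x) :=
      Finset.sum_congr rfl fun β _ => by rw [zero_add]; rfl
    rw [h2, div_pow, div_mul_eq_mul_div, h]
    field_simp
  · intro γ _ hγ
    simp only [e2, ← Finset.sum_smul]
    obtain ⟨c, h, hc⟩ := crossing_sum_eq_const_mul (N := N) hτ hθ hζ hNζ (ix γ)
    have h2 : ∑ β : Fin N × Fin N, (w (ix γ + ix β) (x - N * ζ) * w (ix β) (-x))
        = c * (theta τ x * theta τ (x - N * ζ)) := h x
    rw [h2, hc.resolve_right fun h => hγ (eq_zero_of_dvd_ix h), zero_mul, zero_smul]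
  · simp

/-- Crossing symmetry. -/
lemma ZSum_crossing (hτ : 0 < τ.im) (ζ x : ℂ) :
    transpose₁ (ZSum N ζ τ (x - N * ζ)) * transpose₁ (ZFlip N ζ τ (-x))
      = (theta τ (x - N * ζ) * theta τ (-x)) • 1 := by
  have hN := cast_ne_zero' N
  have hθ := (isTheta_theta hτ).diff.continuous
  have hk : (1 : ℂ) + (N : ℂ)⁻¹ ≠ 0 := by
    have : (N : ℂ) + 1 ≠ 0 := Nat.cast_add_one_ne_zero N
    intro h; apply this; field_simp at h; rw [h, mul_zero]
  have hk' : -(1 : ℂ) - N ≠ 0 := by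
    have : (N : ℂ) + 1 ≠ 0 := Nat.cast_add_one_ne_zero N
    intro h; apply this; linear_combination -h
  ext a b
  refine eq_of_eventually_codiscrete
    (f := fun ζ => (transpose₁ (ZSum N ζ τ (x - N * ζ)) * transpose₁ (ZFlip N ζ τ (-x))) a b)
    (g := fun ζ => ((theta τ (x - N * ζ) * theta τ (-x)) •
      (1 : Matrix (Fin N × Fin N) (Fin N × Fin N) ℂ)) a b) ?_ ?_ ?_ ζ
  · exact ((continuous_transpose₁.comp (continuous_ZSum hτ (by fun_prop))).matrix_mul
      (continuous_transpose₁.comp (continuous_ZFlip hτ continuous_const))).matrix_elem a b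
  · simp only [Matrix.smul_apply, smul_eq_mul]; fun_prop
  · have h := isTheta_theta hτ
    -- Each genericity condition is the nonvanishing of `θ` at a nonconstant affine function of `ζ`,
    -- so it excludes only a discrete set.
    filter_upwards [h.eventually_ne_zero, h.eventually_affine_ne_zero hN 0,
      h.eventually_affine_ne_zero hk' 0,
      Filter.eventually_all.mpr fun α : Fin N × Fin N =>
        h.eventually_affine_ne_zero hk (tors N τ (ix α))] with ζ h1 h2 h3 h4
    rw [add_zero] at h2 h3
    rw [ZSum_crossing_generic hτ h1 h2]
    · convert h3 using 2; ring
    · intro α; convert h4 α using 2; ring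

/-- Quasi-periodicity under `z ↦ -p^{1/2} z`. -/
lemma ZSum_add_tau_add_one (hτ : 0 < τ.im) (ζ x : ℂ) :
    ZSum N ζ τ (x + (τ + 1)) = ePi (-(τ + 2 * x + 2 * ζ / N)) •
      (((gMat N * hMat N)⁻¹ ⊗ₖ (1 : Matrix (Fin N) (Fin N) ℂ)) * ZSum N ζ τ x
        * ((gMat N * hMat N) ⊗ₖ (1 : Matrix (Fin N) (Fin N) ℂ))) := by
  have e : gMat N * hMat N = (heis N (1, 1) : Matrix _ _ ℂ) := by
    simp [heis, gUnit_val, hUnit_val]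
  rw [ZSum, ZSum, Finset.mul_sum, Finset.sum_mul, Finset.smul_sum]
  refine Finset.sum_congr rfl fun α _ => ?_
  rw [coeffR_add_tau_add_one N hτ, Matrix.mul_smul, Matrix.smul_mul, ← Matrix.mul_kronecker_mul,
    ← Matrix.mul_kronecker_mul, one_mul, mul_one, e, ← Matrix.coe_units_inv, IMat_eq_heis,
    ← Units.val_mul, ← Units.val_mul, heis_conj, omegaUnit_zpow_mul, Matrix.smul_kronecker,
    smul_smul, smul_smul]
  push_cast
  congr 1; ring

end

/-! ### The scalar factor of the R-matrix -/

/-- The scalar factor of the R-matrix, up to an exponential factor. -/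
noncomputable def scalarProd (p a b y : ℂ) : ℂ :=
  (qPoch₂ (a * b * y) p a * qPoch₂ (a * b⁻¹ * y) p a * qPoch₂ (p * y⁻¹) p a
      * qPoch₂ (p * a * y⁻¹) p a)
    / (qPoch₂ y p a * qPoch₂ (a * y) p a * qPoch₂ (p * b * y⁻¹) p a * qPoch₂ (p * b⁻¹ * y⁻¹) p a)

section

variable {p a b y : ℂ}

/-- The shift by `p` telescopes each double product in `p`; the remaining single products of nome
`a` pair up into `Θ_a`. This is the origin of `𝒰`. -/
lemma scalarProd_mul (hp : ‖p‖ < 1) (ha : ‖a‖ < 1) (hp0 : p ≠ 0) (hb : b ≠ 0) (hy : y ≠ 0)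
    (h1 : qPoch₂ y p a ≠ 0) (h2 : qPoch₂ (a * y) p a ≠ 0) (h3 : qPoch₂ (b * y⁻¹) p a ≠ 0)
    (h4 : qPoch₂ (b⁻¹ * y⁻¹) p a ≠ 0) :
    scalarProd p a b (p * y) * (Theta a (b * y) * Theta a (b * y⁻¹))
      = -(b * y) * (Theta a y * Theta a y⁻¹) * scalarProd p a b y := by
  have r : ∀ z w, w = p * z → qPoch₂ z p a = qPoch z a * qPoch₂ w p a := fun z w hw => by
    rw [hw]; exact qPoch₂_eq_mul_left hp ha z
  have e1 := r (a * b * y) (a * b * (p * y)) (by ring)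
  have e2 := r (a * b⁻¹ * y) (a * b⁻¹ * (p * y)) (by ring)
  have e3 := r y⁻¹ (p * y⁻¹) rfl
  have e4 := r (a * y⁻¹) (p * a * y⁻¹) (by ring)
  have e5 := r y (p * y) rfl
  have e6 := r (a * y) (a * (p * y)) (by ring)
  have e7 := r (b * y⁻¹) (p * b * y⁻¹) (by ring)
  have e8 := r (b⁻¹ * y⁻¹) (p * b⁻¹ * y⁻¹) (by ring)
  have f1 : qPoch (b * y) a = (1 - b * y) * qPoch (a * b * y) a := by
    rw [qPoch_eq_mul ha, mul_assoc]
  have f2 : qPoch (b⁻¹ * y⁻¹) a = (1 - b⁻¹ * y⁻¹) * qPoch (a * (b * y)⁻¹) a := by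
    rw [qPoch_eq_mul ha, mul_inv]
  have i : ∀ c, c * p * (p * y)⁻¹ = c * y⁻¹ := fun c => by field_simp
  have i1 : p * (p * y)⁻¹ = y⁻¹ := by field_simp
  have i2 : p * a * (p * y)⁻¹ = a * y⁻¹ := by field_simp
  have i3 : p * b * (p * y)⁻¹ = b * y⁻¹ := by field_simp
  have i4 : p * b⁻¹ * (p * y)⁻¹ = b⁻¹ * y⁻¹ := by field_simp
  have i5 : a * (b * y⁻¹)⁻¹ = a * b⁻¹ * y := by field_simp
  rw [scalarProd, scalarProd, Theta, Theta, Theta, Theta, i1, i2, i3, i4, i5, inv_inv, f1]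
  rw [e8, f2] at h4
  rw [e7] at h3
  rw [e6] at h2
  rw [e5] at h1
  rw [e1, e2, e3, e4, e5, e6, e7, e8, f2]
  simp only [ne_eq, mul_eq_zero, not_or] at h1 h2 h3 h4
  obtain ⟨h11, h12⟩ := h1
  obtain ⟨h21, h22⟩ := h2
  obtain ⟨h31, h32⟩ := h3
  obtain ⟨⟨h40, h41⟩, h42⟩ := h4
  -- Expressed through the factor of `h4` known to be nonzero, so that it can be cancelled.
  have hby : 1 - b * y = -(b * y) * (1 - b⁻¹ * y⁻¹) := by field_simp; ring
  rw [hby]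
  generalize qPoch₂ (a * b * (p * y)) p a = X1
  generalize qPoch₂ (a * b⁻¹ * (p * y)) p a = X2
  generalize qPoch₂ (p * y⁻¹) p a = X3
  generalize qPoch₂ (p * a * y⁻¹) p a = X4
  generalize qPoch₂ (p * y) p a = X5 at *
  generalize qPoch₂ (a * (p * y)) p a = X6 at *
  generalize qPoch₂ (p * b * y⁻¹) p a = X7 at *
  generalize qPoch₂ (p * b⁻¹ * y⁻¹) p a = X8 at *
  generalize qPoch y a = x5 at *
  generalize qPoch (a * y) a = x6 at *
  generalize qPoch (b * y⁻¹) a = x7 at *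
  generalize qPoch (a * (b * y)⁻¹) a = x8 at *
  generalize 1 - b⁻¹ * y⁻¹ = s at *
  generalize b * y = u
  field_simp

/-- The shift by `a = q^{2N}` telescopes in the other nome and leaves `Θ_p`, matching the scalars in
`ZSum_mul_ZFlip` and `ZSum_crossing`. -/
lemma scalarProd_crossing (hp : ‖p‖ < 1) (ha : ‖a‖ < 1) (ha0 : a ≠ 0) (hb : b ≠ 0) (hy : y ≠ 0)
    (h1 : qPoch₂ (a⁻¹ * y) p a ≠ 0) (h2 : qPoch₂ (p * b * y⁻¹) p a ≠ 0)
    (h3 : qPoch₂ (p * b⁻¹ * y⁻¹) p a ≠ 0) :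
    b * scalarProd p a b (a⁻¹ * y) * (Theta p (a⁻¹ * y) * Theta p y⁻¹)
      = scalarProd p a b y * (Theta p (b * y) * Theta p (b * y⁻¹)) := by
  have r : ∀ z w, w = a * z → qPoch₂ z p a = qPoch z p * qPoch₂ w p a := fun z w hw => by
    rw [hw]; exact qPoch₂_eq_mul_right hp ha z
  have e1 := r (b * y) (a * b * y) (by ring)
  have e2 := r (b⁻¹ * y) (a * b⁻¹ * y) (by ring)
  have e3 := r (p * y⁻¹) (p * a * y⁻¹) (by ring)
  have e4 := r (p * a * y⁻¹) (p * a * a * y⁻¹) (by ring)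
  have e5 := r (a⁻¹ * y) y (by field_simp)
  have e6 := r y (a * y) rfl
  have e7 := r (p * b * y⁻¹) (p * a * b * y⁻¹) (by ring)
  have e8 := r (p * b⁻¹ * y⁻¹) (p * a * b⁻¹ * y⁻¹) (by ring)
  have i1 : a * b * (a⁻¹ * y) = b * y := by field_simp
  have i2 : a * b⁻¹ * (a⁻¹ * y) = b⁻¹ * y := by field_simp
  have i3 : p * (a⁻¹ * y)⁻¹ = p * a * y⁻¹ := by field_simp
  have i4 : p * a * (a⁻¹ * y)⁻¹ = p * a * a * y⁻¹ := by field_simp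
  have i5 : a * (a⁻¹ * y) = y := by field_simp
  have i6 : p * b * (a⁻¹ * y)⁻¹ = p * a * b * y⁻¹ := by field_simp
  have i7 : p * b⁻¹ * (a⁻¹ * y)⁻¹ = p * a * b⁻¹ * y⁻¹ := by field_simp
  have j1 : p * (b * y)⁻¹ = p * b⁻¹ * y⁻¹ := by rw [mul_inv, mul_assoc]
  have j2 : p * (b⁻¹ * y)⁻¹ = p * b * y⁻¹ := by rw [mul_inv, inv_inv, mul_assoc]
  have t1 := Theta_inv hp hy
  have t2 := Theta_inv hp (mul_ne_zero (inv_ne_zero hb) hy)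
  rw [mul_inv, inv_inv] at t2
  rw [t1, t2, scalarProd, scalarProd, Theta, Theta, Theta, Theta, i1, i2, i3, i4, i5, i6, i7, j1, j2]
  rw [e5, e6] at h1
  rw [e7] at h2
  rw [e8] at h3
  rw [e1, e2, e3, e4, e5, e6, e7, e8]
  simp only [ne_eq, mul_eq_zero, not_or] at h1 h2 h3
  obtain ⟨h11, h12, h13⟩ := h1
  obtain ⟨h21, h22⟩ := h2
  obtain ⟨h31, h32⟩ := h3
  generalize qPoch₂ (a * b * y) p a = X1
  generalize qPoch₂ (a * b⁻¹ * y) p a = X2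
  generalize qPoch₂ (p * a * a * y⁻¹) p a = X4
  generalize qPoch₂ (a * y) p a = X6 at *
  generalize qPoch₂ (p * a * b * y⁻¹) p a = X7 at *
  generalize qPoch₂ (p * a * b⁻¹ * y⁻¹) p a = X8 at *
  generalize qPoch (a⁻¹ * y) p = x5 at *
  generalize qPoch y p = x6 at *
  generalize qPoch (p * b * y⁻¹) p = x7 at *
  generalize qPoch (p * b⁻¹ * y⁻¹) p = x8 at *
  generalize qPoch p p = P
  field_simp

/-- The scalar factor of `R̂` in terms of `y = z²`, up to an exponential factor. -/
lemma scalarProd_eq (hp : ‖p‖ < 1) (ha : ‖a‖ < 1)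
    (h1 : qPoch₂ (b * y) p a ≠ 0) (h2 : qPoch₂ (p * b⁻¹ * y⁻¹) p a ≠ 0)
    (h3 : qPoch₂ (b * y⁻¹) p a ≠ 0) (h4 : qPoch₂ y p a ≠ 0) (h5 : qPoch₂ (a * y⁻¹) p a ≠ 0)
    (h6 : qPoch₂ (a * y) p a ≠ 0) :
    Theta a (b * y⁻¹) / Theta a y
      * ((qPoch₂ (a * y⁻¹) p a * qPoch₂ (b * y) p a * qPoch₂ (p * y⁻¹) p a
        * qPoch₂ (p * a * b⁻¹ * y) p a)
      / (qPoch₂ (a * y) p a * qPoch₂ (b * y⁻¹) p a * qPoch₂ (p * y) p a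
        * qPoch₂ (p * a * b⁻¹ * y⁻¹) p a)) / Theta p (b * y)
      = (qPoch p p)⁻¹ * scalarProd p a b y := by
  have r : ∀ z w, w = p * z → qPoch₂ z p a = qPoch z a * qPoch₂ w p a := fun z w hw => by
    rw [hw]; exact qPoch₂_eq_mul_left hp ha z
  have r' : ∀ z w, w = a * z → qPoch₂ z p a = qPoch z p * qPoch₂ w p a := fun z w hw => by
    rw [hw]; exact qPoch₂_eq_mul_right hp ha z
  have e1 := r' (b * y) (a * b * y) (by ring)
  have e2 := r (a * b⁻¹ * y) (p * a * b⁻¹ * y) (by ring)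
  have e3 := r (b * y⁻¹) (p * b * y⁻¹) (by ring)
  have e4 := r' (p * b⁻¹ * y⁻¹) (p * a * b⁻¹ * y⁻¹) (by ring)
  have e5 := r y (p * y) rfl
  have e6 := r (a * y⁻¹) (p * a * y⁻¹) (by ring)
  have j1 : p * (b * y)⁻¹ = p * b⁻¹ * y⁻¹ := by rw [mul_inv, mul_assoc]
  have j2 : a * (b * y⁻¹)⁻¹ = a * b⁻¹ * y := by rw [mul_inv, inv_inv, mul_assoc]
  have hpp : qPoch p p ≠ 0 := qPoch_ne_zero_of_norm_lt hp hp
  have haa : qPoch a a ≠ 0 := qPoch_ne_zero_of_norm_lt ha ha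
  rw [scalarProd, Theta, Theta, Theta, j1, j2]
  rw [e1] at h1
  rw [e4] at h2
  rw [e3] at h3
  rw [e5] at h4
  rw [e6] at h5
  rw [e1, e2, e3, e4, e5, e6]
  simp only [ne_eq, mul_eq_zero, not_or] at h1 h2 h3 h4 h5
  obtain ⟨h11, h12⟩ := h1
  obtain ⟨h21, h22⟩ := h2
  obtain ⟨h31, h32⟩ := h3
  obtain ⟨h41, h42⟩ := h4
  obtain ⟨h51, h52⟩ := h5
  generalize qPoch₂ (a * b * y) p a = X1 at *
  generalize qPoch₂ (p * a * b⁻¹ * y) p a = X2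
  generalize qPoch₂ (p * b * y⁻¹) p a = X3 at *
  generalize qPoch₂ (p * a * b⁻¹ * y⁻¹) p a = X4 at *
  generalize qPoch₂ (p * y) p a = X5 at *
  generalize qPoch₂ (p * a * y⁻¹) p a = X6 at *
  generalize qPoch₂ (a * y) p a = X7 at *
  generalize qPoch (b * y) p = x1 at *
  generalize qPoch (b * y⁻¹) a = x3 at *
  generalize qPoch (p * b⁻¹ * y⁻¹) p = x4 at *
  generalize qPoch y a = x5 at *
  generalize qPoch (a * y⁻¹) a = x6 at *
  generalize qPoch p p = P at *
  generalize qPoch a a = A at *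
  field_simp

end

/-! ### The scalar factor of `R̂` -/

/-- The scalar in front of the matrix part of `R̂`. -/
noncomputable def scalarR (N : ℕ) (ζ τ ξ : ℂ) : ℂ :=
  tauN N ζ (ζ / 2 - ξ) * (ePi (ξ * (2 / N - 2)) * kappaInv N ζ τ ξ / theta τ (ξ + ζ))

lemma RHat_eq (N : ℕ) (ζ τ ξ : ℂ) :
    RHat N ζ τ ξ = scalarR N ζ τ ξ • ((gHalf N ⊗ₖ gHalf N) * ZSum N ζ τ ξ
      * ((gHalf N)⁻¹ ⊗ₖ (gHalf N)⁻¹)) := by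
  rw [RHat, RMat, ZMat, Matrix.mul_smul, Matrix.smul_mul, smul_smul]
  rfl

lemma eventually_eventually_nhds_of_codiscrete {P : ℂ → Prop} (h : ∀ᶠ x in Filter.codiscrete ℂ, P x) :
    ∀ᶠ x in Filter.codiscrete ℂ, ∀ᶠ y in 𝓝 x, P y := by
  have h1 := (mem_codiscrete'.mp h).1
  filter_upwards [h] with x hx
  exact h1.mem_nhds hx

lemma norm_pow_lt_one {q : ℂ} (hq : ‖q‖ < 1) {k : ℕ} (hk : k ≠ 0) : ‖q ^ k‖ < 1 := by
  rw [norm_pow]; exact pow_lt_one₀ (norm_nonneg _) hq hk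

lemma eventually_qPoch_ne_zero {p : ℂ} (hp : ‖p‖ < 1) (b : ℂ) :
    (∀ᶠ x in Filter.codiscrete ℂ, qPoch (b * ePi (2 * x)) p ≠ 0) ∧
      ∀ᶠ x in Filter.codiscrete ℂ, qPoch (b * (ePi (2 * x))⁻¹) p ≠ 0 := by
  have h := eventually_comp_ePi_ne_zero (differentiable_qPoch hp) (by simp [qPoch_zero]) b
  refine ⟨h 2 two_ne_zero, ?_⟩
  simpa only [neg_mul, ePi_neg] using h (-2) (neg_ne_zero.mpr two_ne_zero)

lemma eventually_qPoch₂_ne_zero {p a : ℂ} (hp : ‖p‖ < 1) (ha : ‖a‖ < 1) (b : ℂ) :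
    (∀ᶠ x in Filter.codiscrete ℂ, qPoch₂ (b * ePi (2 * x)) p a ≠ 0) ∧
      ∀ᶠ x in Filter.codiscrete ℂ, qPoch₂ (b * (ePi (2 * x))⁻¹) p a ≠ 0 := by
  have h := eventually_comp_ePi_ne_zero (differentiable_qPoch₂ hp ha) (by simp [qPoch₂_zero]) b
  refine ⟨h 2 two_ne_zero, ?_⟩
  simpa only [neg_mul, ePi_neg] using h (-2) (neg_ne_zero.mpr two_ne_zero)

lemma eventually_Theta_ne_zero {p : ℂ} (hp : ‖p‖ < 1) (b : ℂ) :
    (∀ᶠ x in Filter.codiscrete ℂ, Theta p (b * ePi (2 * x)) ≠ 0) ∧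
      ∀ᶠ x in Filter.codiscrete ℂ, Theta p (b * (ePi (2 * x))⁻¹) ≠ 0 := by
  have h := qPoch_ne_zero_of_norm_lt hp hp
  constructor
  · filter_upwards [(eventually_qPoch_ne_zero hp b).1, (eventually_qPoch_ne_zero hp (p * b⁻¹)).2]
      with x h1 h2
    refine mul_ne_zero (mul_ne_zero h1 ?_) h
    rwa [mul_inv, ← mul_assoc]
  · filter_upwards [(eventually_qPoch_ne_zero hp b).2, (eventually_qPoch_ne_zero hp (p * b⁻¹)).1]
      with x h1 h2
    refine mul_ne_zero (mul_ne_zero h1 ?_) h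
    rwa [mul_inv, inv_inv, ← mul_assoc]

section

variable {N : ℕ} {ζ τ : ℂ}

lemma exists_theta_eq (hτ : 0 < τ.im) : ∃ C : ℂ, C ≠ 0 ∧
    ∀ x, theta τ x = C * (ePi (-x) * Theta (ePi (2 * τ)) (ePi (2 * x))) := exists_thetaChar_eq hτ

lemma norm_p_lt_one (hτ : 0 < τ.im) : ‖ePi (2 * τ)‖ < 1 := norm_ePi_lt_one (by simpa using hτ)

lemma eventually_scalarProd_ne_zero {p a : ℂ} (hp : ‖p‖ < 1) (ha : ‖a‖ < 1) (b : ℂ) :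
    ∀ᶠ x in Filter.codiscrete ℂ, scalarProd p a b (ePi (2 * x)) ≠ 0 := by
  have h := eventually_qPoch₂_ne_zero hp ha
  filter_upwards [(h (a * b)).1, (h (a * b⁻¹)).1, (h p).2, (h (p * a)).2, (h 1).1, (h a).1,
    (h (p * b)).2, (h (p * b⁻¹)).2] with x h1 h2 h3 h4 h5 h6 h7 h8
  rw [one_mul] at h5
  exact div_ne_zero (by simp [*]) (by simp [*])

lemma eventually_analyticAt_scalarProd {p a : ℂ} (hp : ‖p‖ < 1) (ha : ‖a‖ < 1) (b : ℂ) :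
    ∀ᶠ x in Filter.codiscrete ℂ, AnalyticAt ℂ (fun x => scalarProd p a b (ePi (2 * x))) x := by
  have h := eventually_qPoch₂_ne_zero hp ha
  have hd := differentiable_qPoch₂ hp ha
  have e : Differentiable ℂ fun x => ePi (2 * x) := (differentiable_id.const_mul 2).ePi
  have e' : Differentiable ℂ fun x => (ePi (2 * x))⁻¹ := e.inv fun x => ePi_ne_zero _
  have d1 : ∀ c, Differentiable ℂ fun x => qPoch₂ (c * ePi (2 * x)) p a := fun c =>
    hd.comp (e.const_mul c)
  have d2 : ∀ c, Differentiable ℂ fun x => qPoch₂ (c * (ePi (2 * x))⁻¹) p a := fun c =>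
    hd.comp (e'.const_mul c)
  have d3 : Differentiable ℂ fun x => qPoch₂ (ePi (2 * x)) p a := hd.comp e
  filter_upwards [(h 1).1, (h a).1, (h (p * b)).2, (h (p * b⁻¹)).2] with x h5 h6 h7 h8
  rw [one_mul] at h5
  simp only [scalarProd]
  refine AnalyticAt.fun_div ?_ ?_ (by simp [*])
  · exact ((((d1 (a * b)).fun_mul (d1 (a * b⁻¹))).fun_mul (d2 p)).fun_mul (d2 (p * a))).analyticAt x
  · exact (((d3.fun_mul (d1 a)).fun_mul (d2 (p * b))).fun_mul (d2 (p * b⁻¹))).analyticAt x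

variable [NeZero N]

lemma norm_a_lt_one (hζ : 0 < ζ.im) : ‖ePi ζ ^ (2 * N)‖ < 1 :=
  norm_pow_lt_one (norm_ePi_lt_one hζ) (mul_ne_zero two_ne_zero (NeZero.ne N))

lemma exists_scalarR_eq (hζ : 0 < ζ.im) (hτ : 0 < τ.im) : ∃ K : ℂ, K ≠ 0 ∧
    ∀ᶠ x in Filter.codiscrete ℂ, scalarR N ζ τ x
      = K * (ePi x * scalarProd (ePi (2 * τ)) (ePi ζ ^ (2 * N)) (ePi ζ ^ 2) (ePi (2 * x))) := by
  obtain ⟨C, hC, hθ⟩ := exists_theta_eq hτ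
  have hp := norm_p_lt_one hτ
  have ha := norm_a_lt_one (N := N) hζ
  have hq := ePi_ne_zero ζ
  have hpow : ePi ζ ^ (2 * N - 2) = ePi ζ ^ (2 * N) * (ePi ζ ^ 2)⁻¹ := by
    have := NeZero.pos N
    exact pow_sub₀ _ hq (by omega)
  set p := ePi (2 * τ) with hpdef
  set a := ePi ζ ^ (2 * N) with hadef
  set b := ePi ζ ^ 2 with hbdef
  have hpp : qPoch p p ≠ 0 := qPoch_ne_zero_of_norm_lt hp hp
  refine ⟨ePi (ζ / 2 * (2 / N - 2)) * (C⁻¹ * ePi ζ * (qPoch p p)⁻¹), ?_, ?_⟩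
  · exact mul_ne_zero (ePi_ne_zero _) (mul_ne_zero (mul_ne_zero (inv_ne_zero hC) hq) (inv_ne_zero hpp))
  have h := eventually_qPoch₂_ne_zero hp ha
  filter_upwards [(h b).1, (h (p * b⁻¹)).2, (h b).2, (h 1).1, (h a).2, (h a).1] with x h1 h2 h3 h4 h5 h6
  rw [one_mul] at h4
  have key := scalarProd_eq hp ha h1 h2 h3 h4 h5 h6
  have e1 : ePi (ζ + 2 * (ζ / 2 - x)) = b * (ePi (2 * x))⁻¹ := by
    rw [hbdef, ← ePi_two_mul, ← ePi_neg, ← ePi_add]; congr 1; ring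
  have e2 : ePi (ζ - 2 * (ζ / 2 - x)) = ePi (2 * x) := by congr 1; ring
  -- The fractional power of `z` in `τ_N(q^{1/2}z⁻¹)` cancels the one in `𝒵`; only a constant
  -- survives.
  have e3 : ePi ((ζ / 2 - x) * (2 / N - 2)) * ePi (x * (2 / N - 2)) = ePi (ζ / 2 * (2 / N - 2)) := by
    rw [← ePi_add]; congr 1; ring
  have e4 : ePi (2 * (x + ζ)) = b * ePi (2 * x) := by
    rw [hbdef, ← ePi_two_mul, ← ePi_add]; congr 1; ring
  have e5 : ePi (-(x + ζ)) = (ePi x * ePi ζ)⁻¹ := by rw [ePi_neg, ePi_add]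
  rw [scalarR, tauN, kappaInv, hθ, e1, e2, e4, e5, hpow]
  simp only [← hpdef, ← hadef, ← hbdef]
  have e6 : ePi (ζ / 2 * (2 / N - 2)) * (C⁻¹ * ePi ζ * (qPoch p p)⁻¹)
      * (ePi x * scalarProd p a b (ePi (2 * x)))
      = ePi (ζ / 2 * (2 / N - 2)) * (C⁻¹ * ePi ζ) * ePi x
        * ((qPoch p p)⁻¹ * scalarProd p a b (ePi (2 * x))) := by ring
  rw [e6, ← key, ← e3, ← mul_assoc p a b⁻¹]
  simp only [div_eq_mul_inv, mul_inv, inv_inv]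
  ring

lemma eventually_scalarR_ne_zero (hζ : 0 < ζ.im) (hτ : 0 < τ.im) :
    ∀ᶠ x in Filter.codiscrete ℂ, scalarR N ζ τ x ≠ 0 := by
  obtain ⟨K, hK, h⟩ := exists_scalarR_eq (N := N) hζ hτ
  filter_upwards [h, eventually_scalarProd_ne_zero (norm_p_lt_one hτ) (norm_a_lt_one (N := N) hζ)
    (ePi ζ ^ 2)] with x h1 h2
  rw [h1]
  exact mul_ne_zero hK (mul_ne_zero (ePi_ne_zero x) h2)

lemma eventually_analyticAt_scalarR (hζ : 0 < ζ.im) (hτ : 0 < τ.im) :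
    ∀ᶠ x in Filter.codiscrete ℂ, AnalyticAt ℂ (scalarR N ζ τ) x := by
  obtain ⟨K, hK, h⟩ := exists_scalarR_eq (N := N) hζ hτ
  filter_upwards [eventually_eventually_nhds_of_codiscrete h, eventually_analyticAt_scalarProd
    (norm_p_lt_one hτ) (norm_a_lt_one (N := N) hζ) (ePi ζ ^ 2)] with x h1 h2
  refine AnalyticAt.congr ?_ (h1.mono fun y hy => hy.symm)
  exact analyticAt_const.mul ((differentiable_ePi.analyticAt x).mul h2)

lemma UFun_eq (N : ℕ) (ζ x : ℂ) : UFun N ζ x = ePi (ζ * (2 / N - 2)) *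
    ((Theta (ePi ζ ^ (2 * N)) (ePi ζ ^ 2 * ePi (2 * x))
        * Theta (ePi ζ ^ (2 * N)) (ePi ζ ^ 2 * (ePi (2 * x))⁻¹))
      / (Theta (ePi ζ ^ (2 * N)) (ePi (2 * x)) * Theta (ePi ζ ^ (2 * N)) (ePi (2 * x))⁻¹)) := by
  rw [UFun, ePi_neg]

lemma eventually_UFun_ne_zero (hζ : 0 < ζ.im) :
    ∀ᶠ x in Filter.codiscrete ℂ, UFun N ζ x ≠ 0 := by
  have h := eventually_Theta_ne_zero (norm_a_lt_one (N := N) hζ)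
  filter_upwards [(h (ePi ζ ^ 2)).1, (h (ePi ζ ^ 2)).2, (h 1).1, (h 1).2] with x h1 h2 h3 h4
  rw [one_mul] at h3 h4
  rw [UFun_eq]
  exact mul_ne_zero (ePi_ne_zero _) (div_ne_zero (mul_ne_zero h1 h2) (mul_ne_zero h3 h4))

/-- The exponential on the right is the inverse of the multiplier of `ZSum`, so that `𝒰⁻¹` is all
that remains for `R̂`. -/
lemma scalarR_add_tau_add_one (hζ : 0 < ζ.im) (hτ : 0 < τ.im) :
    ∀ᶠ x in Filter.codiscrete ℂ, scalarR N ζ τ (x + (τ + 1)) * UFun N ζ x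
      = ePi (τ + 2 * x + 2 * ζ / N) * scalarR N ζ τ x := by
  obtain ⟨K, hK, hR⟩ := exists_scalarR_eq (N := N) hζ hτ
  have hp := norm_p_lt_one hτ
  have ha := norm_a_lt_one (N := N) hζ
  have hq := ePi_ne_zero ζ
  have h := eventually_qPoch₂_ne_zero hp ha
  have hT := eventually_Theta_ne_zero ha
  filter_upwards [hR, eventually_codiscrete_add hR (τ + 1), (h 1).1, (h (ePi ζ ^ (2 * N))).1,
    (h (ePi ζ ^ 2)).2, (h (ePi ζ ^ 2)⁻¹).2, (hT 1).1, (hT 1).2] with x r1 r2 h1 h2 h3 h4 h5 h6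
  rw [one_mul] at h1 h5 h6
  have key := scalarProd_mul hp ha (ePi_ne_zero _) (pow_ne_zero 2 hq) (ePi_ne_zero (2 * x)) h1 h2 h3 h4
  have e1 : ePi (2 * (x + (τ + 1))) = ePi (2 * τ) * ePi (2 * x) := by
    rw [show 2 * (x + (τ + 1)) = 2 * τ + 2 * x + 2 by ring, ePi_add, ePi_two, mul_one, ePi_add]
  have e2 : ePi (x + (τ + 1)) = -(ePi τ * ePi x) := by
    rw [show x + (τ + 1) = τ + x + 1 by ring, ePi_add, ePi_one, ePi_add]; ring
  have e3 : ePi (τ + 2 * x + 2 * ζ / N)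
      = ePi τ * ePi (2 * x) * (ePi (ζ * (2 / N - 2)) * ePi ζ ^ 2) := by
    rw [← ePi_two_mul, ← ePi_add, ← ePi_add, ← ePi_add]; congr 1; ring
  rw [r1, r2, e1, e2, e3, UFun_eq]
  generalize scalarProd _ _ _ (ePi (2 * τ) * ePi (2 * x)) = S₁ at *
  generalize scalarProd _ _ _ (ePi (2 * x)) = S₂ at *
  generalize Theta _ (ePi ζ ^ 2 * ePi (2 * x)) = t₁ at *
  generalize Theta _ (ePi ζ ^ 2 * (ePi (2 * x))⁻¹) = t₂ at *
  generalize Theta _ (ePi (2 * x)) = t₃ at *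
  generalize Theta _ (ePi (2 * x))⁻¹ = t₄ at *
  calc _ = -(K * ePi τ * ePi x * ePi (ζ * (2 / N - 2))) * ((S₁ * (t₁ * t₂)) / (t₃ * t₄)) := by ring
    _ = _ := by rw [key]; field_simp

/-- The normalisation `τ_N/κ` is made for this: the crossing scalar of `ZSum` at the shifted point
is balanced against its unitarity scalar, so crossing holds for `R̂` without a factor. -/
lemma scalarR_crossing (hζ : 0 < ζ.im) (hτ : 0 < τ.im) :
    ∀ᶠ x in Filter.codiscrete ℂ,
      scalarR N ζ τ (x - N * ζ) * (theta τ (x - N * ζ) * theta τ (-x))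
        = scalarR N ζ τ x * (theta τ (x + ζ) * theta τ (ζ - x)) := by
  obtain ⟨K, hK, hR⟩ := exists_scalarR_eq (N := N) hζ hτ
  obtain ⟨C, hC, hθ⟩ := exists_theta_eq hτ
  have hp := norm_p_lt_one hτ
  have ha := norm_a_lt_one (N := N) hζ
  have hq := ePi_ne_zero ζ
  have h := eventually_qPoch₂_ne_zero hp ha
  filter_upwards [hR, eventually_codiscrete_sub hR (N * ζ), (h (ePi ζ ^ (2 * N))⁻¹).1,
    (h (ePi (2 * τ) * ePi ζ ^ 2)).2, (h (ePi (2 * τ) * (ePi ζ ^ 2)⁻¹)).2] with x r1 r2 h1 h2 h3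
  have key := scalarProd_crossing hp ha (pow_ne_zero _ hq) (pow_ne_zero 2 hq) (ePi_ne_zero (2 * x))
    h1 h2 h3
  have ea : ePi ζ ^ (2 * N) = ePi (2 * (N * ζ)) := by
    rw [pow_mul, ← ePi_two_mul, ← ePi_nat_mul]; congr 1; ring
  have e1 : ePi (2 * (x - N * ζ)) = (ePi ζ ^ (2 * N))⁻¹ * ePi (2 * x) := by
    rw [ea, ← ePi_neg, ← ePi_add]; congr 1; ring
  have e2 : ePi (2 * -x) = (ePi (2 * x))⁻¹ := by rw [← ePi_neg]; congr 1; ring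
  have e3 : ePi (2 * (x + ζ)) = ePi ζ ^ 2 * ePi (2 * x) := by
    rw [← ePi_two_mul, ← ePi_add]; congr 1; ring
  have e4 : ePi (2 * (ζ - x)) = ePi ζ ^ 2 * (ePi (2 * x))⁻¹ := by
    rw [← ePi_two_mul, ← ePi_neg, ← ePi_add]; congr 1; ring
  have f1 : ePi (x - N * ζ) * ePi (-(x - N * ζ)) = 1 := by rw [← ePi_add, add_neg_cancel, ePi_zero]
  have f2 : ePi (-(x + ζ)) * ePi (-(ζ - x)) * ePi ζ ^ 2 = 1 := by
    rw [← ePi_two_mul, ← ePi_add, ← ePi_add, ← ePi_zero]; congr 1; ring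
  rw [r1, r2, hθ, hθ (-x), hθ (x + ζ), hθ (ζ - x), e1, e2, e3, e4, neg_neg]
  set a := ePi ζ ^ (2 * N)
  set p := ePi (2 * τ)
  set b := ePi ζ ^ 2
  set y := ePi (2 * x)
  calc _ = K * C ^ 2 * ePi x * (ePi (x - N * ζ) * ePi (-(x - N * ζ)))
        * (scalarProd p a b (a⁻¹ * y) * (Theta p (a⁻¹ * y) * Theta p y⁻¹)) := by ring
    _ = K * C ^ 2 * ePi x * (ePi (-(x + ζ)) * ePi (-(ζ - x)))
        * (b * scalarProd p a b (a⁻¹ * y) * (Theta p (a⁻¹ * y) * Theta p y⁻¹)) := by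
        rw [f1, ← f2]; ring
    _ = _ := by rw [key]; ring

end

lemma scalarR_add_of_samePoint (N : ℕ) {ζ τ : ℂ} (hτ : 0 < τ.im) {d : ℂ} (h1 : ePi d = 1) (x : ℂ) :
    scalarR N ζ τ (x + d) = scalarR N ζ τ x := by
  obtain ⟨n, rfl⟩ := ePi_eq_one_iff.mp h1
  have hθ : theta τ (x + 2 * n + ζ) = theta τ (x + ζ) := by
    have := (isTheta_theta hτ).add_int (x + ζ) (2 * n)
    rw [zpow_mul] at this
    push_cast at this
    rw [show x + 2 * n + ζ = x + ζ + 2 * n by ring, this]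
    norm_num
  have e0 : ∀ z : ℂ, ePi (z + 2 * (2 * n)) = ePi z := fun z => by
    have := ePi_two_mul_int (2 * n)
    push_cast at this
    rw [ePi_add, this, mul_one]
  have e1 : ePi (2 * (x + 2 * n)) = ePi (2 * x) := by rw [mul_add, e0]
  have e2 : ePi (ζ + 2 * (ζ / 2 - (x + 2 * n))) = ePi (ζ + 2 * (ζ / 2 - x)) := by
    rw [← e0]; congr 1; ring
  have e3 : ePi (ζ - 2 * (ζ / 2 - (x + 2 * n))) = ePi (ζ - 2 * (ζ / 2 - x)) := by
    rw [← e0 (ζ - 2 * (ζ / 2 - x))]; congr 1; ring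
  have e4 : ∀ u : ℂ, ePi ((ζ / 2 - u) * (2 / N - 2)) * ePi (u * (2 / N - 2))
      = ePi (ζ / 2 * (2 / N - 2)) := fun u => by rw [← ePi_add]; congr 1; ring
  have e5 : ∀ u : ℂ, scalarR N ζ τ u = ePi (ζ / 2 * (2 / N - 2))
      * (Theta (ePi ζ ^ (2 * N)) (ePi (ζ + 2 * (ζ / 2 - u)))
        / Theta (ePi ζ ^ (2 * N)) (ePi (ζ - 2 * (ζ / 2 - u))))
      * kappaInv N ζ τ u / theta τ (u + ζ) := fun u => by
    rw [← e4 u, scalarR, tauN]; ring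
  rw [e5, e5, e2, e3, hθ, kappaInv, kappaInv, e1]

/-! ### Properties of `R̂` -/

section

variable {N : ℕ}

lemma gHalf_mul_self (N : ℕ) : gHalf N * gHalf N = gMat N := by
  rw [gHalf, gMat, Matrix.diagonal_mul_diagonal]
  congr 1
  funext i
  rw [← ePi_add]; congr 1; ring

lemma isUnit_det_gHalf (N : ℕ) : IsUnit (gHalf N).det := by
  rw [gHalf, Matrix.det_diagonal, isUnit_iff_ne_zero]
  exact Finset.prod_ne_zero_iff.mpr fun i _ => ePi_ne_zero _

lemma gHalf_transpose (N : ℕ) : (gHalf N).transpose = gHalf N := Matrix.diagonal_transpose _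

/-- `Γ` is `gh` in the gauge of `R̂`, up to a scalar `ω` that drops out of conjugations. -/
lemma gammaMat_eq (N : ℕ) :
    gammaMat N = ePi (2 / N) • (gHalf N * (gMat N * hMat N) * (gHalf N)⁻¹) := by
  rw [gammaMat, ← Matrix.smul_mul, ← Matrix.mul_smul, ← hMat_mul_gMat, ← gHalf_mul_self]
  simp only [mul_assoc]
  rw [Matrix.mul_nonsing_inv _ (isUnit_det_gHalf N), mul_one]

/-- By linearity it suffices to take a matrix unit for `X`, which is a Kronecker product. -/
lemma transpose₁_kronecker_mul_mul (A B C D : Matrix (Fin N) (Fin N) ℂ)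
    (X : Matrix (Fin N × Fin N) (Fin N × Fin N) ℂ) :
    transpose₁ ((A ⊗ₖ B) * X * (C ⊗ₖ D))
      = (C.transpose ⊗ₖ B) * transpose₁ X * (A.transpose ⊗ₖ D) := by
  have hadd : ∀ X Y : Matrix (Fin N × Fin N) (Fin N × Fin N) ℂ,
      transpose₁ (X + Y) = transpose₁ X + transpose₁ Y := fun X Y => rfl
  induction X using Matrix.induction_on' with
  | h_zero =>
    have h0 : transpose₁ (0 : Matrix (Fin N × Fin N) (Fin N × Fin N) ℂ) = 0 := rfl
    simp [h0]
  | h_add X Y hX hY => rw [mul_add, add_mul, hadd, hX, hY, hadd, mul_add, add_mul]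
  | h_std_basis i j c =>
    have e : Matrix.single i j c
        = (Matrix.single i.1 j.1 c) ⊗ₖ (Matrix.single i.2 j.2 (1 : ℂ)) := by
      rw [Matrix.single_kronecker_single, mul_one]
    rw [e, ← Matrix.mul_kronecker_mul, ← Matrix.mul_kronecker_mul, transpose₁_kronecker,
      transpose₁_kronecker, ← Matrix.mul_kronecker_mul, ← Matrix.mul_kronecker_mul,
      Matrix.transpose_mul, Matrix.transpose_mul, mul_assoc, mul_assoc]

lemma RHat_add_of_samePoint {ζ τ : ℂ} (hτ : 0 < τ.im) {d : ℂ} (h1 : ePi d = 1) (h2 : ePi (2 * d / N) = 1)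
    (x : ℂ) : RHat N ζ τ (x + d) = RHat N ζ τ x := by
  rw [RHat_eq, RHat_eq, scalarR_add_of_samePoint N hτ h1, ZSum, ZSum]
  simp only [coeffR_add_of_samePoint N ζ τ _ h1 h2]

/-! ### The structure functions -/

lemma FFun_natCast (ζ τ : ℂ) (a : ℕ) (x : ℂ) :
    FFun N ζ τ (a : ℤ) x = ∏ k ∈ Finset.range a, UFun N ζ (x + k * (τ + 1)) := by
  rw [FFun, if_pos (Int.natCast_nonneg a), Int.natAbs_natCast]

lemma FFun_neg_natCast (ζ τ : ℂ) (a : ℕ) (x : ℂ) :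
    FFun N ζ τ (-(a : ℤ)) x = ∏ k ∈ Finset.Icc 1 a, (UFun N ζ (x - k * (τ + 1)))⁻¹ := by
  rw [FFun, Int.natAbs_neg, Int.natAbs_natCast]
  split_ifs with h
  · obtain rfl : a = 0 := by omega
    simp
  · rfl

lemma FFun_natCast_succ (ζ τ : ℂ) (a : ℕ) (x : ℂ) :
    FFun N ζ τ ((a : ℤ) + 1) x = FFun N ζ τ (a : ℤ) x * UFun N ζ (x + a * (τ + 1)) := by
  have := FFun_natCast (N := N) ζ τ (a + 1) x
  push_cast at this
  rw [this, FFun_natCast, Finset.prod_range_succ]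

lemma FFun_neg_natCast_sub_one (ζ τ : ℂ) (a : ℕ) (x : ℂ) :
    FFun N ζ τ (-(a : ℤ) - 1) x
      = FFun N ζ τ (-(a : ℤ)) x * (UFun N ζ (x - (a + 1) * (τ + 1)))⁻¹ := by
  have := FFun_neg_natCast (N := N) ζ τ (a + 1) x
  push_cast at this
  rw [show -(a : ℤ) - 1 = -((a : ℤ) + 1) by ring, this, FFun_neg_natCast,
    Finset.prod_Icc_succ_top (by omega)]
  push_cast; rfl

lemma FFun_zero (ζ τ x : ℂ) : FFun N ζ τ 0 x = 1 := by
  have := FFun_natCast (N := N) ζ τ 0 x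
  simpa using this

/-- `𝓕_a((-p^{1/2})^{-a} x) 𝓕_{-a}(x) = 1`, in a form without division. -/
lemma FFun_sub_mul (ζ τ : ℂ) (a : ℤ) (x : ℂ) :
    FFun N ζ τ a (x - a * (τ + 1)) = (FFun N ζ τ (-a) x)⁻¹ := by
  have key : ∀ (a : ℕ) (x : ℂ),
      FFun N ζ τ (a : ℤ) (x - a * (τ + 1)) = (FFun N ζ τ (-(a : ℤ)) x)⁻¹ := by
    intro a x
    rw [FFun_natCast, FFun_neg_natCast, Finset.prod_inv_distrib, inv_inv]
    -- Reversing the order by `k ↦ a - k` carries `0, …, a-1` to `1, …, a`.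
    refine Finset.prod_nbij' (fun k => a - k) (fun k => a - k) ?_ ?_ ?_ ?_ fun k hk => ?_ <;>
      simp only [Finset.mem_range, Finset.mem_Icc] at *
    · intro k hk; omega
    · intro k hk; omega
    · intro k hk; omega
    · intro k hk; omega
    · congr 1
      rw [Nat.cast_sub hk.le]
      ring
  obtain ⟨n, rfl | rfl⟩ := a.eq_nat_or_neg
  · exact_mod_cast key n x
  · have h := key n (x + n * (τ + 1))
    rw [add_sub_cancel_right] at h
    rw [neg_neg, h, inv_inv]
    push_cast
    congr 1; ring

variable [NeZero N] {ζ τ : ℂ}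

lemma isUnit_gHMat (N : ℕ) [NeZero N] : IsUnit (gMat N * hMat N).det := by
  have e : gMat N * hMat N = ((gUnit N * hUnit N : (Matrix (Fin N) (Fin N) ℂ)ˣ) : Matrix _ _ ℂ) := rfl
  rw [e]
  exact (Matrix.isUnit_iff_isUnit_det _).mp (Units.isUnit _)

lemma gammaMat_inv (N : ℕ) [NeZero N] :
    (gammaMat N)⁻¹ = (ePi (2 / N))⁻¹ • (gHalf N * (gMat N * hMat N)⁻¹ * (gHalf N)⁻¹) := by
  have hG := isUnit_det_gHalf N
  have hX := isUnit_gHMat N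
  refine Matrix.inv_eq_right_inv ?_
  rw [gammaMat_eq, Matrix.smul_mul, Matrix.mul_smul, smul_smul, mul_inv_cancel₀ (ePi_ne_zero _),
    one_smul]
  calc _ = gHalf N * (gMat N * hMat N) * ((gHalf N)⁻¹ * gHalf N) * (gMat N * hMat N)⁻¹
        * (gHalf N)⁻¹ := by noncomm_ring
    _ = 1 := by
      rw [Matrix.nonsing_inv_mul _ hG, mul_one, mul_assoc (gHalf N), Matrix.mul_nonsing_inv _ hX,
        mul_one, Matrix.mul_nonsing_inv _ hG]

lemma isUnit_det_gammaMat (N : ℕ) [NeZero N] : IsUnit (gammaMat N).det := by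
  have hG := isUnit_det_gHalf N
  rw [gammaMat, Matrix.det_mul, Matrix.det_mul]
  refine (hG.mul ?_).mul hG
  have := isUnit_gHMat N
  rw [Matrix.det_mul] at this
  exact isUnit_of_mul_isUnit_right this

lemma RHat_add_tau_add_one (hζ : 0 < ζ.im) (hτ : 0 < τ.im) :
    ∀ᶠ x in Filter.codiscrete ℂ, RHat N ζ τ (x + (τ + 1)) = (UFun N ζ x)⁻¹ •
      (((gammaMat N)⁻¹ ⊗ₖ (1 : Matrix (Fin N) (Fin N) ℂ)) * RHat N ζ τ x
        * (gammaMat N ⊗ₖ (1 : Matrix (Fin N) (Fin N) ℂ))) := by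
  filter_upwards [scalarR_add_tau_add_one (N := N) hζ hτ, eventually_UFun_ne_zero (N := N) hζ] with x h1 h2
  have hG := isUnit_det_gHalf N
  set A := gHalf N ⊗ₖ gHalf N
  set B := (gHalf N)⁻¹ ⊗ₖ (gHalf N)⁻¹
  set X := gMat N * hMat N
  have hAB : A * B = 1 := by
    rw [← Matrix.mul_kronecker_mul, Matrix.mul_nonsing_inv _ hG, Matrix.one_kronecker_one]
  have hBA : B * A = 1 := by
    rw [← Matrix.mul_kronecker_mul, Matrix.nonsing_inv_mul _ hG, Matrix.one_kronecker_one]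
  have e : ∀ Y : Matrix (Fin N) (Fin N) ℂ, (gHalf N * Y * (gHalf N)⁻¹) ⊗ₖ (1 : Matrix (Fin N) (Fin N) ℂ)
      = A * (Y ⊗ₖ (1 : Matrix (Fin N) (Fin N) ℂ)) * B := fun Y => by
    rw [← Matrix.mul_kronecker_mul, ← Matrix.mul_kronecker_mul, mul_one, Matrix.mul_nonsing_inv _ hG]
  have e1 : (gammaMat N)⁻¹ ⊗ₖ (1 : Matrix (Fin N) (Fin N) ℂ)
      = (ePi (2 / N))⁻¹ • (A * (X⁻¹ ⊗ₖ (1 : Matrix (Fin N) (Fin N) ℂ)) * B) := by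
    rw [gammaMat_inv, Matrix.smul_kronecker, e]
  have e2 : gammaMat N ⊗ₖ (1 : Matrix (Fin N) (Fin N) ℂ)
      = ePi (2 / N) • (A * (X ⊗ₖ (1 : Matrix (Fin N) (Fin N) ℂ)) * B) := by
    rw [gammaMat_eq, Matrix.smul_kronecker, e]
  have e3 : A * (X⁻¹ ⊗ₖ (1 : Matrix (Fin N) (Fin N) ℂ)) * B * (A * ZSum N ζ τ x * B)
      * (A * (X ⊗ₖ (1 : Matrix (Fin N) (Fin N) ℂ)) * B)
      = A * ((X⁻¹ ⊗ₖ (1 : Matrix (Fin N) (Fin N) ℂ)) * ZSum N ζ τ x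
        * (X ⊗ₖ (1 : Matrix (Fin N) (Fin N) ℂ))) * B := by
    calc _ = A * (X⁻¹ ⊗ₖ (1 : Matrix (Fin N) (Fin N) ℂ)) * (B * A) * ZSum N ζ τ x * (B * A)
          * (X ⊗ₖ (1 : Matrix (Fin N) (Fin N) ℂ)) * B := by noncomm_ring
      _ = _ := by rw [hBA]; noncomm_ring
  rw [RHat_eq, RHat_eq, ZSum_add_tau_add_one hτ, e1, e2]
  simp only [Matrix.smul_mul, Matrix.mul_smul, smul_smul]
  rw [e3]
  congr 1
  have h3 := ePi_ne_zero (2 / (N : ℂ))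
  have h4 : ePi (τ + 2 * x + 2 * ζ / N) * ePi (-(τ + 2 * x + 2 * ζ / N)) = 1 := by
    rw [← ePi_add, add_neg_cancel, ePi_zero]
  generalize ePi (-(τ + 2 * x + 2 * ζ / N)) = u at *
  generalize ePi (τ + 2 * x + 2 * ζ / N) = v at *
  generalize scalarR N ζ τ (x + (τ + 1)) = s at *
  field_simp
  linear_combination u * h1 + scalarR N ζ τ x * h4

/-- Unitarity gives an explicit inverse of `R̂`, in a form whose partial transpose can be computed
for crossing. -/
lemma eventually_RHat_mul_flip (hζ : 0 < ζ.im) (hτ : 0 < τ.im) :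
    ∀ᶠ x in Filter.codiscrete ℂ,
      scalarR N ζ τ x * (theta τ (x + ζ) * theta τ (ζ - x)) ≠ 0 ∧
      RHat N ζ τ x * ((scalarR N ζ τ x * (theta τ (x + ζ) * theta τ (ζ - x)))⁻¹ •
        ((gHalf N ⊗ₖ gHalf N) * ZFlip N ζ τ (-x) * ((gHalf N)⁻¹ ⊗ₖ (gHalf N)⁻¹))) = 1 := by
  have hθ := isTheta_theta hτ
  filter_upwards [eventually_scalarR_ne_zero (N := N) hζ hτ, hθ.eventually_affine_ne_zero one_ne_zero ζ,
    hθ.eventually_affine_ne_zero (neg_ne_zero.mpr one_ne_zero) ζ] with x h1 h2 h3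
  rw [one_mul] at h2
  rw [neg_mul, one_mul, neg_add_eq_sub] at h3
  have h4 := mul_ne_zero h1 (mul_ne_zero h2 h3)
  refine ⟨h4, ?_⟩
  have hG := isUnit_det_gHalf N
  have hAB : (gHalf N ⊗ₖ gHalf N) * ((gHalf N)⁻¹ ⊗ₖ (gHalf N)⁻¹) = 1 := by
    rw [← Matrix.mul_kronecker_mul, Matrix.mul_nonsing_inv _ hG, Matrix.one_kronecker_one]
  have hBA : ((gHalf N)⁻¹ ⊗ₖ (gHalf N)⁻¹) * (gHalf N ⊗ₖ gHalf N) = 1 := by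
    rw [← Matrix.mul_kronecker_mul, Matrix.nonsing_inv_mul _ hG, Matrix.one_kronecker_one]
  have hU := ZSum_mul_ZFlip (N := N) hτ ζ x
  set A := gHalf N ⊗ₖ gHalf N
  set B := (gHalf N)⁻¹ ⊗ₖ (gHalf N)⁻¹
  rw [RHat_eq, Matrix.smul_mul, Matrix.mul_smul, smul_smul]
  calc _ = (scalarR N ζ τ x * (scalarR N ζ τ x * (theta τ (x + ζ) * theta τ (ζ - x)))⁻¹) •
        (A * ZSum N ζ τ x * (B * A) * ZFlip N ζ τ (-x) * B) := by congr 1; noncomm_ring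
    _ = 1 := by
      rw [hBA, mul_one, mul_assoc A, hU, Matrix.mul_smul, Matrix.smul_mul, mul_one, hAB, smul_smul]
      convert one_smul ℂ _
      field_simp

/-- Crossing symmetry of `R̂`. -/
lemma RHat_crossing (hζ : 0 < ζ.im) (hτ : 0 < τ.im) :
    ∀ᶠ x in Filter.codiscrete ℂ, IsUnit (RHat N ζ τ x) ∧
      transpose₁ (RHat N ζ τ (x - N * ζ)) * transpose₁ (RHat N ζ τ x)⁻¹ = 1 := by
  filter_upwards [eventually_RHat_mul_flip (N := N) hζ hτ, scalarR_crossing (N := N) hζ hτ] with x h1 h2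
  obtain ⟨h0, h1⟩ := h1
  refine ⟨IsUnit.of_mul_eq_one _ h1, ?_⟩
  have hG := isUnit_det_gHalf N
  have hGt : ((gHalf N)⁻¹).transpose = (gHalf N)⁻¹ := by
    rw [Matrix.transpose_nonsing_inv, gHalf_transpose]
  rw [Matrix.inv_eq_right_inv h1, RHat_eq, transpose₁_smul, transpose₁_smul,
    transpose₁_kronecker_mul_mul, transpose₁_kronecker_mul_mul, gHalf_transpose, hGt,
    Matrix.smul_mul, Matrix.mul_smul, smul_smul]
  have hAB : ((gHalf N)⁻¹ ⊗ₖ gHalf N) * (gHalf N ⊗ₖ (gHalf N)⁻¹) = 1 := by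
    rw [← Matrix.mul_kronecker_mul, Matrix.mul_nonsing_inv _ hG, Matrix.nonsing_inv_mul _ hG,
      Matrix.one_kronecker_one]
  have hBA : (gHalf N ⊗ₖ (gHalf N)⁻¹) * ((gHalf N)⁻¹ ⊗ₖ gHalf N) = 1 := by
    rw [← Matrix.mul_kronecker_mul, Matrix.mul_nonsing_inv _ hG, Matrix.nonsing_inv_mul _ hG,
      Matrix.one_kronecker_one]
  have hC := ZSum_crossing (N := N) hτ ζ x
  set A := (gHalf N)⁻¹ ⊗ₖ gHalf N
  set B := gHalf N ⊗ₖ (gHalf N)⁻¹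
  set Z := transpose₁ (ZSum N ζ τ (x - N * ζ))
  set Z' := transpose₁ (ZFlip N ζ τ (-x))
  rw [show A * Z * B * (A * Z' * B) = A * Z * (B * A) * Z' * B by noncomm_ring, hBA, mul_one,
    mul_assoc A, hC, Matrix.mul_smul, Matrix.smul_mul, mul_one, hAB, smul_smul, mul_right_comm, h2,
    mul_inv_cancel₀ h0, one_smul]

/-- Crossing at `x` inverts the partial transpose of `R̂(x)⁻¹`, and crossing at `x + Nζ` that of
`R̂(x)`. Hence the RLL relation is available off a discrete set. -/
lemma eventually_isRegular (hζ : 0 < ζ.im) (hτ : 0 < τ.im) :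
    ∀ᶠ x in Filter.codiscrete ℂ, IsRegular N ζ τ x := by
  have h := RHat_crossing (N := N) hζ hτ
  filter_upwards [eventually_analyticAt_scalarR (N := N) hζ hτ, h, eventually_codiscrete_add h (N * ζ)]
    with x h1 h2 h3
  rw [add_sub_cancel_right] at h3
  refine ⟨fun a b => ?_, h2.1, IsUnit.of_mul_eq_one _ h3.2, IsUnit.of_mul_eq_one_right _ h2.2⟩
  have hd : Differentiable ℂ fun ξ => ((gHalf N ⊗ₖ gHalf N) * ZSum N ζ τ ξ
      * ((gHalf N)⁻¹ ⊗ₖ (gHalf N)⁻¹)) a b := by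
    have hc := fun α => differentiable_coeffR N hτ ζ α
    simp only [Matrix.mul_apply, ZSum, Matrix.sum_apply, Matrix.smul_apply, smul_eq_mul]
    fun_prop
  simp only [RHat_eq, Matrix.smul_apply, smul_eq_mul]
  exact h1.fun_mul (hd.analyticAt x)

lemma eventually_FFun_ne_zero (hζ : 0 < ζ.im) (τ : ℂ) (a : ℤ) :
    ∀ᶠ x in Filter.codiscrete ℂ, FFun N ζ τ a x ≠ 0 := by
  have hU := eventually_UFun_ne_zero (N := N) hζ
  obtain ⟨n, rfl | rfl⟩ := a.eq_nat_or_neg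
  · have h : ∀ᶠ x in Filter.codiscrete ℂ, ∀ k ∈ Finset.range n, UFun N ζ (x + k * (τ + 1)) ≠ 0 :=
      (Finset.range n).eventually_all.mpr fun k _ => eventually_codiscrete_add hU _
    filter_upwards [h] with x hx
    rw [FFun_natCast]
    exact Finset.prod_ne_zero_iff.mpr hx
  · have h : ∀ᶠ x in Filter.codiscrete ℂ, ∀ k ∈ Finset.Icc 1 n, UFun N ζ (x - k * (τ + 1)) ≠ 0 :=
      (Finset.Icc 1 n).eventually_all.mpr fun k _ => eventually_codiscrete_sub hU _
    filter_upwards [h] with x hx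
    rw [FFun_neg_natCast]
    exact Finset.prod_ne_zero_iff.mpr fun k hk => inv_ne_zero (hx k hk)

lemma RHat_add_zsmul (hζ : 0 < ζ.im) (hτ : 0 < τ.im) (a : ℤ) :
    ∀ᶠ x in Filter.codiscrete ℂ, RHat N ζ τ (x + a * (τ + 1)) = (FFun N ζ τ a x)⁻¹ •
      (((gammaMat N ^ (-a)) ⊗ₖ (1 : Matrix (Fin N) (Fin N) ℂ)) * RHat N ζ τ x
        * ((gammaMat N ^ a) ⊗ₖ (1 : Matrix (Fin N) (Fin N) ℂ))) := by
  have hΓ := isUnit_det_gammaMat N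
  have hk : ∀ X Y : Matrix (Fin N) (Fin N) ℂ, (X * Y) ⊗ₖ (1 : Matrix (Fin N) (Fin N) ℂ)
      = (X ⊗ₖ (1 : Matrix (Fin N) (Fin N) ℂ)) * (Y ⊗ₖ (1 : Matrix (Fin N) (Fin N) ℂ)) := fun X Y => by
    rw [← Matrix.mul_kronecker_mul, one_mul]
  have h1 := RHat_add_tau_add_one (N := N) hζ hτ
  induction a using Int.induction_on with
  | zero => exact .of_forall fun x => by simp [FFun_zero]
  | succ n ih =>
    filter_upwards [ih, eventually_codiscrete_add h1 (n * (τ + 1))] with x hx hx1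
    push_cast at hx ⊢
    rw [show x + (n + 1) * (τ + 1) = x + n * (τ + 1) + (τ + 1) by ring, hx1, hx, FFun_natCast_succ,
      Matrix.zpow_add_one hΓ, neg_add, add_comm (-(n : ℤ)), Matrix.zpow_add hΓ, Matrix.zpow_neg_one,
      hk, hk, mul_inv, Matrix.mul_smul, Matrix.smul_mul, smul_smul, mul_comm (UFun _ _ _)⁻¹]
    congr 1
    noncomm_ring
  | pred n ih =>
    filter_upwards [ih, eventually_codiscrete_sub h1 ((n + 1) * (τ + 1)),
      eventually_codiscrete_sub (eventually_UFun_ne_zero (N := N) hζ) ((n + 1) * (τ + 1))]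
      with x hx hx1 hx2
    push_cast at hx ⊢
    rw [show x - (n + 1) * (τ + 1) + (τ + 1) = x + -n * (τ + 1) by ring, hx] at hx1
    have e1 : (gammaMat N ⊗ₖ (1 : Matrix (Fin N) (Fin N) ℂ))
        * ((gammaMat N)⁻¹ ⊗ₖ (1 : Matrix (Fin N) (Fin N) ℂ)) = 1 := by
      rw [← hk, Matrix.mul_nonsing_inv _ hΓ, Matrix.one_kronecker_one]
    set G := gammaMat N ⊗ₖ (1 : Matrix (Fin N) (Fin N) ℂ)
    set Gi := (gammaMat N)⁻¹ ⊗ₖ (1 : Matrix (Fin N) (Fin N) ℂ)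
    -- Going backwards, the one-step relation at the target point is solved for `R̂` there, which
    -- requires `𝒰 ≠ 0`.
    have h3 := congrArg (fun M => UFun N ζ (x - (n + 1) * (τ + 1)) • (G * M * Gi)) hx1
    simp only [Matrix.mul_smul, Matrix.smul_mul, smul_smul, mul_inv_cancel₀ hx2, one_smul] at h3
    rw [show G * (Gi * RHat N ζ τ (x - (n + 1) * (τ + 1)) * G) * Gi
      = (G * Gi) * RHat N ζ τ (x - (n + 1) * (τ + 1)) * (G * Gi) by noncomm_ring, e1, one_mul,
      mul_one] at h3
    rw [show x + (-(n : ℂ) - 1) * (τ + 1) = x - (n + 1) * (τ + 1) by ring, ← h3,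
      FFun_neg_natCast_sub_one, Matrix.zpow_sub_one hΓ, neg_sub, sub_neg_eq_add, neg_neg,
      Matrix.zpow_add hΓ, zpow_one, hk, hk, mul_inv, inv_inv,
      mul_comm (UFun _ _ _)]
    congr 1
    noncomm_ring

end

/-! ### Matrices over an algebra -/

section

variable {N : ℕ} {A : Type*} [Ring A]

lemma first_mul_apply (X : Matrix (Fin N) (Fin N) A) (M : Matrix (Fin N × Fin N) (Fin N × Fin N) A)
    (a b : Fin N × Fin N) : (first X * M) a b = ∑ c, X a.1 c * M (c, a.2) b := by
  rw [Matrix.mul_apply, Fintype.sum_prod_type]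
  refine Finset.sum_congr rfl fun c _ => ?_
  rw [Finset.sum_eq_single a.2]
  · simp [first]
  · intro d _ hd; simp [first, Matrix.one_apply_ne' hd]
  · simp

lemma mul_first_apply (M : Matrix (Fin N × Fin N) (Fin N × Fin N) A) (X : Matrix (Fin N) (Fin N) A)
    (a b : Fin N × Fin N) : (M * first X) a b = ∑ c, M a (c, b.2) * X c b.1 := by
  rw [Matrix.mul_apply, Fintype.sum_prod_type]
  refine Finset.sum_congr rfl fun c _ => ?_
  rw [Finset.sum_eq_single b.2]
  · simp [first]
  · intro d _ hd; simp [first, Matrix.one_apply_ne hd]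
  · simp

lemma second_mul_apply (X : Matrix (Fin N) (Fin N) A) (M : Matrix (Fin N × Fin N) (Fin N × Fin N) A)
    (a b : Fin N × Fin N) : (second X * M) a b = ∑ c, X a.2 c * M (a.1, c) b := by
  rw [Matrix.mul_apply, Fintype.sum_prod_type, Finset.sum_comm]
  refine Finset.sum_congr rfl fun c _ => ?_
  rw [Finset.sum_eq_single a.1]
  · simp [second]
  · intro d _ hd; simp [second, Matrix.one_apply_ne' hd]
  · simp

lemma mul_second_apply (M : Matrix (Fin N × Fin N) (Fin N × Fin N) A) (X : Matrix (Fin N) (Fin N) A)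
    (a b : Fin N × Fin N) : (M * second X) a b = ∑ c, M a (b.1, c) * X c b.2 := by
  rw [Matrix.mul_apply, Fintype.sum_prod_type, Finset.sum_comm]
  refine Finset.sum_congr rfl fun c _ => ?_
  rw [Finset.sum_eq_single b.1]
  · simp [second]
  · intro d _ hd; simp [second, Matrix.one_apply_ne hd]
  · simp

lemma first_mul_first (X Y : Matrix (Fin N) (Fin N) A) : first X * first Y = first (X * Y) := by
  ext a b
  rw [first_mul_apply]
  simp [first, Matrix.mul_apply, Finset.sum_mul, mul_assoc]

lemma first_one : first (1 : Matrix (Fin N) (Fin N) A) = 1 := Matrix.one_kronecker_one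

/-- The trace over the first tensor factor. -/
def ptrace (X : Matrix (Fin N × Fin N) (Fin N × Fin N) A) : Matrix (Fin N) (Fin N) A :=
  Matrix.of fun k l => ∑ c, X (c, k) (c, l)

lemma ptrace_mul_second (X : Matrix (Fin N × Fin N) (Fin N × Fin N) A) (Y : Matrix (Fin N) (Fin N) A) :
    ptrace (X * second Y) = ptrace X * Y := by
  ext k l
  simp_rw [ptrace, Matrix.of_apply, mul_second_apply, Matrix.mul_apply, Matrix.of_apply, Finset.sum_mul]
  exact Finset.sum_comm

lemma ptrace_second_mul (X : Matrix (Fin N × Fin N) (Fin N × Fin N) A) (Y : Matrix (Fin N) (Fin N) A) :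
    ptrace (second Y * X) = Y * ptrace X := by
  ext k l
  simp_rw [ptrace, Matrix.of_apply, second_mul_apply, Matrix.mul_apply, Matrix.of_apply, Finset.mul_sum]
  exact Finset.sum_comm

lemma ptrace_first (X : Matrix (Fin N) (Fin N) A) :
    ptrace (first X) = Matrix.diagonal fun _ => X.trace := by
  ext k l
  simp only [ptrace, Matrix.of_apply, first, Matrix.kroneckerMap_apply, Matrix.trace, Matrix.diag,
    Matrix.diagonal_apply, Matrix.one_apply, mul_ite, mul_one, mul_zero]
  split_ifs <;> simp

variable [Algebra ℂ A]

lemma scal_mul {ι : Type*} [Fintype ι] (X Y : Matrix ι ι ℂ) : scal A (X * Y) = scal A X * scal A Y :=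
  Matrix.map_mul

lemma scal_one {ι : Type*} [DecidableEq ι] : scal A (1 : Matrix ι ι ℂ) = 1 := by
  simp [scal]

lemma scal_smul {ι : Type*} (c : ℂ) (X : Matrix ι ι ℂ) : scal A (c • X) = c • scal A X := by
  ext i j; simp [scal, Algebra.smul_def]

lemma ptrace_smul (c : ℂ) (X : Matrix (Fin N × Fin N) (Fin N × Fin N) A) :
    ptrace (c • X) = c • ptrace X := by
  ext k l; simp [ptrace, Finset.smul_sum]

lemma scal_kronecker_one (X : Matrix (Fin N) (Fin N) ℂ) :
    scal A (X ⊗ₖ (1 : Matrix (Fin N) (Fin N) ℂ)) = first (scal A X) := by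
  ext a b
  by_cases h : a.2 = b.2 <;> simp [scal, first, Matrix.one_apply, h]

lemma first_scal_mul_second (X : Matrix (Fin N) (Fin N) ℂ) (Y : Matrix (Fin N) (Fin N) A) :
    first (scal A X) * second Y = second Y * first (scal A X) := by
  ext a b
  rw [mul_second_apply, second_mul_apply, Finset.sum_eq_single a.2, Finset.sum_eq_single b.2]
  · simp [first, scal, Algebra.commutes]
  · intro c _ hc; simp [first, Matrix.one_apply_ne hc]
  · simp
  · intro c _ hc; simp [first, Matrix.one_apply_ne' hc]
  · simp

/-- Crossing symmetry removes the R-matrices from a partial trace. -/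
lemma ptrace_scal_mul_first_mul_scal {P S : Matrix (Fin N × Fin N) (Fin N × Fin N) ℂ}
    (h : transpose₁ P * transpose₁ S = 1) (X : Matrix (Fin N) (Fin N) A) :
    ptrace (scal A P * first X * scal A S) = Matrix.diagonal fun _ => X.trace := by
  ext k l
  have key : ∀ i j, ∑ c, ∑ d, P (c, k) (i, d) * S (j, d) (c, l)
      = (1 : Matrix (Fin N × Fin N) (Fin N × Fin N) ℂ) (i, k) (j, l) := fun i j => by
    rw [← h, Matrix.mul_apply, Fintype.sum_prod_type]; rfl
  have e : ∀ c, (scal A P * first X * scal A S) (c, k) (c, l)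
      = ∑ j, ∑ d, ∑ i, (P (c, k) (i, d) * S (j, d) (c, l)) • X i j := fun c => by
    rw [Matrix.mul_apply, Fintype.sum_prod_type]
    refine Finset.sum_congr rfl fun j _ => Finset.sum_congr rfl fun d _ => ?_
    rw [mul_first_apply, Finset.sum_mul]
    refine Finset.sum_congr rfl fun i _ => ?_
    simp only [scal, Matrix.map_apply]
    rw [mul_assoc, ← Algebra.commutes, ← Algebra.smul_def, ← Algebra.smul_def, smul_smul]
  rw [ptrace, Matrix.of_apply]
  simp only [e]
  have e2 : ∑ c, ∑ j, ∑ d, ∑ i, (P (c, k) (i, d) * S (j, d) (c, l)) • X i j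
      = ∑ j, ∑ i, (∑ c, ∑ d, P (c, k) (i, d) * S (j, d) (c, l)) • X i j := by
    rw [Finset.sum_comm]
    refine Finset.sum_congr rfl fun j _ => ?_
    simp only [Finset.sum_smul]
    rw [Finset.sum_comm (γ := Fin N) (s := Finset.univ) (t := Finset.univ)
      (f := fun i c => ∑ d, (P (c, k) (i, d) * S (j, d) (c, l)) • X i j)]
    exact Finset.sum_congr rfl fun c _ => Finset.sum_comm
  rw [e2]
  simp only [key, Matrix.one_apply, Prod.mk.injEq, Matrix.diagonal_apply]
  by_cases hkl : k = l
  · simp [hkl, Matrix.trace]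
  · simp [hkl]

end

/-! ### Exchange relations from R-matrix relations -/

section

variable {N : ℕ} {A : Type*} [Ring A] [Algebra ℂ A]
  {P R S : Matrix (Fin N × Fin N) (Fin N × Fin N) ℂ} {f : ℂ} {X Y L L' L₁ : Matrix (Fin N) (Fin N) A}

/-- The RLL relation multiplied on both sides by the inverses of its R-matrix and its first Lax
matrix. -/
lemma first_inv_exchange (hR : IsUnit R) (hS : IsUnit S) (h1 : L * L' = 1) (h2 : L' * L = 1)
    (h : scal A R * first L * second L₁ = second L₁ * first L * scal A S) :
    first L' * scal A R⁻¹ * second L₁ = second L₁ * scal A S⁻¹ * first L' := by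
  have hR' : scal A R⁻¹ * scal A R = 1 := by
    rw [← scal_mul, Matrix.nonsing_inv_mul _ ((Matrix.isUnit_iff_isUnit_det _).mp hR), scal_one]
  have hS' : scal A S * scal A S⁻¹ = 1 := by
    rw [← scal_mul, Matrix.mul_nonsing_inv _ ((Matrix.isUnit_iff_isUnit_det _).mp hS), scal_one]
  have h3 : first L * first L' = 1 := by rw [first_mul_first, h1, first_one]
  have h4 : first L' * first L = 1 := by rw [first_mul_first, h2, first_one]
  calc first L' * scal A R⁻¹ * second L₁
      = first L' * scal A R⁻¹ * second L₁ * (first L * (scal A S * scal A S⁻¹) * first L') := by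
        rw [hS', mul_one, h3, mul_one]
    _ = first L' * scal A R⁻¹ * (second L₁ * first L * scal A S) * scal A S⁻¹ * first L' := by
        simp only [mul_assoc]
    _ = first L' * (scal A R⁻¹ * scal A R) * first L * second L₁ * scal A S⁻¹ * first L' := by
        rw [← h]; simp only [mul_assoc]
    _ = _ := by rw [hR', mul_one, h4, one_mul]

/-- Composing the two hypotheses cancels `S` against `S⁻¹`. The partial trace over the first factor
then sees `P (XY)₁ R⁻¹` on one side, where crossing leaves `tr(XY)`, and `(XY)₁` alone on the other.
-/
lemma trace_exchange (hS : IsUnit S) (hP : transpose₁ P * transpose₁ R⁻¹ = 1)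
    (h1 : scal A P * first X * second L = f • (second L * first X * scal A S))
    (h2 : first Y * scal A R⁻¹ * second L = second L * scal A S⁻¹ * first Y) (i j : Fin N) :
    (X * Y).trace * L i j = f • (L i j * (X * Y).trace) := by
  have hS' : scal A S * scal A S⁻¹ = 1 := by
    rw [← scal_mul, Matrix.mul_nonsing_inv _ ((Matrix.isUnit_iff_isUnit_det _).mp hS), scal_one]
  have h : scal A P * first (X * Y) * scal A R⁻¹ * second L = f • (second L * first (X * Y)) := by
    calc _ = scal A P * first X * (first Y * scal A R⁻¹ * second L) := by
          rw [← first_mul_first]; simp only [mul_assoc]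
      _ = scal A P * first X * second L * (scal A S⁻¹ * first Y) := by
          rw [h2]; simp only [mul_assoc]
      _ = f • (second L * first X * (scal A S * scal A S⁻¹) * first Y) := by
          rw [h1, Matrix.smul_mul]; simp only [mul_assoc]
      _ = _ := by rw [hS', mul_one, ← first_mul_first]; simp only [mul_assoc]
  have h3 := congrArg ptrace h
  rw [ptrace_mul_second, ptrace_scal_mul_first_mul_scal hP, ptrace_smul, ptrace_second_mul,
    ptrace_first] at h3
  have h4 := congrFun (congrFun h3 i) j
  rwa [Matrix.diagonal_mul, Matrix.smul_apply, Matrix.mul_diagonal] at h4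

/-- Mirror image of `trace_exchange`: the matrices to be removed by crossing now stand on the
right-hand side. -/
lemma trace_exchange_star (hR : IsUnit R) (hP : transpose₁ P * transpose₁ S = 1)
    (h1 : first X * scal A R⁻¹ * second L = f • (second L * scal A P * first X))
    (h2 : scal A R * first Y * second L = second L * first Y * scal A S) (i j : Fin N) :
    (X * Y).trace * L i j = f • (L i j * (X * Y).trace) := by
  have hR' : scal A R⁻¹ * scal A R = 1 := by
    rw [← scal_mul, Matrix.nonsing_inv_mul _ ((Matrix.isUnit_iff_isUnit_det _).mp hR), scal_one]
  have h : first (X * Y) * second L = f • (second L * (scal A P * first (X * Y) * scal A S)) := by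
    calc _ = first X * (scal A R⁻¹ * scal A R) * first Y * second L := by
          rw [hR', mul_one, ← first_mul_first]
      _ = first X * scal A R⁻¹ * (scal A R * first Y * second L) := by simp only [mul_assoc]
      _ = first X * scal A R⁻¹ * second L * (first Y * scal A S) := by
          rw [h2]; simp only [mul_assoc]
      _ = _ := by rw [h1, Matrix.smul_mul, ← first_mul_first]; simp only [mul_assoc]
  have h3 := congrArg ptrace h
  rw [ptrace_mul_second, ptrace_smul, ptrace_second_mul, ptrace_scal_mul_first_mul_scal hP,
    ptrace_first] at h3
  have h4 := congrFun (congrFun h3 i) j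
  rwa [Matrix.diagonal_mul, Matrix.smul_apply, Matrix.mul_diagonal] at h4

/-- With `T` placed on the diagonal, the entrywise relation becomes one between matrices and can be
multiplied by `L'` on both sides. -/
lemma inv_exchange {T : A} (hf : f ≠ 0) (h1 : L * L' = 1) (h2 : L' * L = 1)
    (h : ∀ i j, T * L i j = f • (L i j * T)) (i j : Fin N) : T * L' i j = f⁻¹ • (L' i j * T) := by
  set D : Matrix (Fin N) (Fin N) A := Matrix.diagonal fun _ => T with hD
  have h3 : D * L = f • (L * D) := by
    ext i j; rw [hD, Matrix.diagonal_mul, Matrix.smul_apply, Matrix.mul_diagonal, h]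
  have h4 : L' * D = f • (D * L') := by
    calc L' * D = L' * (D * L) * L' := by rw [mul_assoc, mul_assoc, h1, mul_one]
      _ = f • ((L' * L) * D * L') := by
        rw [h3, Matrix.mul_smul, Matrix.smul_mul]; simp only [mul_assoc]
      _ = _ := by rw [h2, one_mul]
  have h5 := congrFun (congrFun h4 i) j
  rw [hD, Matrix.smul_apply, Matrix.diagonal_mul, Matrix.mul_diagonal] at h5
  rw [h5, smul_smul, inv_mul_cancel₀ hf, one_smul]

lemma trace_mul_exchange {T : A} {f g : ℂ} (C C' : Matrix (Fin N) (Fin N) ℂ)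
    (hX : ∀ i j, T * X i j = f • (X i j * T)) (hY : ∀ i j, T * Y i j = g • (Y i j * T)) :
    T * (scal A C * X * scal A C' * Y).trace
      = (f * g) • ((scal A C * X * scal A C' * Y).trace * T) := by
  set D : Matrix (Fin N) (Fin N) A := Matrix.diagonal fun _ => T with hD
  have hc : ∀ C : Matrix (Fin N) (Fin N) ℂ, D * scal A C = scal A C * D := fun C => by
    ext i j; rw [hD, Matrix.diagonal_mul, Matrix.mul_diagonal]; exact (Algebra.commutes _ _).symm
  have hX' : D * X = f • (X * D) := by
    ext i j; rw [hD, Matrix.diagonal_mul, Matrix.smul_apply, Matrix.mul_diagonal, hX]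
  have hY' : D * Y = g • (Y * D) := by
    ext i j; rw [hD, Matrix.diagonal_mul, Matrix.smul_apply, Matrix.mul_diagonal, hY]
  have h : D * (scal A C * X * scal A C' * Y) = (f * g) • ((scal A C * X * scal A C' * Y) * D) := by
    calc _ = (D * scal A C) * X * scal A C' * Y := by simp only [mul_assoc]
      _ = scal A C * (D * X) * scal A C' * Y := by rw [hc]; simp only [mul_assoc]
      _ = f • (scal A C * X * (D * scal A C') * Y) := by
        rw [hX']; simp only [Matrix.mul_smul, Matrix.smul_mul, mul_assoc]
      _ = f • (scal A C * X * scal A C' * (D * Y)) := by rw [hc]; simp only [mul_assoc]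
      _ = _ := by rw [hY']; simp only [Matrix.mul_smul, mul_assoc, smul_smul]
  have h2 := congrArg Matrix.trace h
  simpa only [hD, Matrix.trace, Matrix.diag, Matrix.diagonal_mul, Matrix.smul_apply,
    Matrix.mul_diagonal, ← Finset.mul_sum, ← Finset.sum_mul, ← Finset.smul_sum] using h2

end

/-! ### The elliptic quantum algebra -/

section

variable (N : ℕ) (ζ τ c : ℂ)

lemma map_scal {ι B C : Type*} [Ring B] [Algebra ℂ B] [Ring C] [Algebra ℂ C] (φ : B →ₐ[ℂ] C)
    (X : Matrix ι ι ℂ) : (scal B X).map φ = scal C X := by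
  ext i j; simp [scal]

lemma map_first {B C : Type*} [Ring B] [Algebra ℂ B] [Ring C] [Algebra ℂ C] (φ : B →ₐ[ℂ] C)
    (X : Matrix (Fin N) (Fin N) B) : (first X).map φ = first (X.map φ) := by
  ext a b
  by_cases h : a.2 = b.2 <;> simp [first, Matrix.one_apply, h]

lemma map_second {B C : Type*} [Ring B] [Algebra ℂ B] [Ring C] [Algebra ℂ C] (φ : B →ₐ[ℂ] C)
    (X : Matrix (Fin N) (Fin N) B) : (second X).map φ = second (X.map φ) := by
  ext a b
  by_cases h : a.1 = b.1 <;> simp [second, Matrix.one_apply, h]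

lemma LMat_eq (u : ℂ) : LMat N ζ τ c u = (freeL N u).map (RingQuot.mkAlgHom ℂ (Rel N ζ τ c)) := rfl

lemma LInv_eq (u : ℂ) : LInv N ζ τ c u = (freeLinv N u).map (RingQuot.mkAlgHom ℂ (Rel N ζ τ c)) := rfl

lemma LMat_mul_LInv (u : ℂ) : LMat N ζ τ c u * LInv N ζ τ c u = 1 := by
  rw [LMat_eq, LInv_eq, ← Matrix.map_mul]
  ext i j
  rw [Matrix.map_apply, RingQuot.mkAlgHom_rel ℂ (Rel.mul_inv u i j), Matrix.one_apply, Matrix.one_apply]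
  split_ifs <;> simp

lemma LInv_mul_LMat (u : ℂ) : LInv N ζ τ c u * LMat N ζ τ c u = 1 := by
  rw [LMat_eq, LInv_eq, ← Matrix.map_mul]
  ext i j
  rw [Matrix.map_apply, RingQuot.mkAlgHom_rel ℂ (Rel.inv_mul u i j), Matrix.one_apply, Matrix.one_apply]
  split_ifs <;> simp

lemma RLL {u v : ℂ} (h : IsRegular N ζ τ (u - v)) (h' : IsRegular N ζ (tauStar ζ τ c) (u - v)) :
    scal (EllAlg N ζ τ c) (RHat N ζ τ (u - v)) * first (LMat N ζ τ c u) * second (LMat N ζ τ c v)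
      = second (LMat N ζ τ c v) * first (LMat N ζ τ c u)
        * scal (EllAlg N ζ τ c) (RHat N ζ (tauStar ζ τ c) (u - v)) := by
  ext a b
  have h := RingQuot.mkAlgHom_rel ℂ (Rel.rll u v h h' a b)
  rw [← Matrix.map_apply (f := RingQuot.mkAlgHom ℂ (Rel N ζ τ c)),
    ← Matrix.map_apply (f := RingQuot.mkAlgHom ℂ (Rel N ζ τ c))] at h
  simp only [Matrix.map_mul, map_scal, map_first, map_second] at h
  exact h

end

/-! ### Invariance of the structure functions -/

lemma RLL_of_sub_eq (N : ℕ) (ζ τ c : ℂ) {u v x : ℂ} (hx : u - v = x) (h : IsRegular N ζ τ x)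
    (h' : IsRegular N ζ (tauStar ζ τ c) x) :
    scal (EllAlg N ζ τ c) (RHat N ζ τ x) * first (LMat N ζ τ c u) * second (LMat N ζ τ c v)
      = second (LMat N ζ τ c v) * first (LMat N ζ τ c u)
        * scal (EllAlg N ζ τ c) (RHat N ζ (tauStar ζ τ c) x) := by
  subst hx
  exact RLL N ζ τ c h h'

section

variable {N : ℕ} {ζ τ c : ℂ} {m n : ℤ}

lemma UFun_add_of_ePi_eq_one {d : ℂ} (h : ePi d = 1) (x : ℂ) : UFun N ζ (x + d) = UFun N ζ x := by
  have e : ePi (2 * (x + d)) = ePi (2 * x) := by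
    rw [mul_add, ePi_add, ePi_two_mul d, h, one_pow, mul_one]
  rw [UFun_eq, UFun_eq, e]

/-- The shift multiplies `y` by the nome `q^{2N}`. The multiplier of `Θ(by)Θ(b/y)` does not depend
on `b`, so it cancels between numerator and denominator. -/
lemma UFun_add_mul [NeZero N] (hζ : 0 < ζ.im) (x : ℂ) : UFun N ζ (x + N * ζ) = UFun N ζ x := by
  have ha := norm_a_lt_one (N := N) hζ
  have hq := ePi_ne_zero ζ
  have hy := ePi_ne_zero (2 * x)
  have e : ePi (2 * (x + N * ζ)) = ePi ζ ^ (2 * N) * ePi (2 * x) := by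
    rw [mul_add, ePi_add, pow_mul, ← ePi_two_mul ζ, ← ePi_nat_mul, mul_comm]
    congr 2; ring
  have ha0 : ePi ζ ^ (2 * N) ≠ 0 := pow_ne_zero _ hq
  rw [UFun_eq, UFun_eq, e]
  generalize ePi (2 * x) = y at *
  have key : ∀ b : ℂ, b ≠ 0 → Theta (ePi ζ ^ (2 * N)) (b * (ePi ζ ^ (2 * N) * y))
        * Theta (ePi ζ ^ (2 * N)) (b * (ePi ζ ^ (2 * N) * y)⁻¹)
      = (ePi ζ ^ (2 * N) * y ^ 2)⁻¹ * (Theta (ePi ζ ^ (2 * N)) (b * y)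
        * Theta (ePi ζ ^ (2 * N)) (b * y⁻¹)) := fun b hb => by
    have h1 := Theta_mul ha ha0 (mul_ne_zero hb hy)
    have h2 := Theta_mul ha ha0 (mul_ne_zero hb (inv_ne_zero (mul_ne_zero ha0 hy)))
    generalize ePi ζ ^ (2 * N) = a at *
    rw [show a * (b * y) = b * (a * y) by ring] at h1
    rw [show a * (b * (a * y)⁻¹) = b * y⁻¹ by field_simp] at h2
    rw [h1, h2]
    generalize Theta a (b * (a * y)⁻¹) = t
    generalize Theta a (b * y) = s
    field_simp
  have k1 := key _ (pow_ne_zero 2 hq)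
  have k2 := key 1 one_ne_zero
  simp only [one_mul] at k2
  rw [k1, k2, mul_div_mul_left]
  exact inv_ne_zero (mul_ne_zero ha0 (pow_ne_zero 2 hy))

lemma FFun_add {d : ℂ} (h : ∀ x, UFun N ζ (x + d) = UFun N ζ x) (τ : ℂ) (a : ℤ) (x : ℂ) :
    FFun N ζ τ a (x + d) = FFun N ζ τ a x := by
  simp only [FFun, add_right_comm x d, add_sub_right_comm x d, h]

lemma FFun_sub_mul_self [NeZero N] (hζ : 0 < ζ.im) (τ : ℂ) (a : ℤ) (x : ℂ) :
    FFun N ζ τ a (x - N * ζ) = FFun N ζ τ a x := by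
  conv_rhs => rw [← sub_add_cancel x (N * ζ), FFun_add (UFun_add_mul hζ)]

/-! ### The surface -/

/-- With `OnSurface.ePi_div_eq_one`, this says that the shift built from the surface relation is
trivial on the curve `(z, z^{2/N})`. -/
lemma OnSurface.ePi_eq_one (h : OnSurface N ζ τ c m n) :
    ePi (m * (τ + 1) + n * (tauStar ζ τ c + 1) + N * ζ) = 1 := by
  have h1 := h.1
  have e : ∀ x, ePi (x + 1) = -ePi x := fun x => by rw [ePi_add, ePi_one, mul_neg_one]
  rw [ePi_add, ePi_add, ePi_int_mul, ePi_int_mul, e, e, h1, ePi_nat_mul, zpow_neg, zpow_natCast,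
    inv_mul_cancel₀ (pow_ne_zero _ (ePi_ne_zero ζ))]

lemma OnSurface.ePi_div_eq_one [NeZero N] (h : OnSurface N ζ τ c m n) :
    ePi (2 * (m * (τ + 1) + n * (tauStar ζ τ c + 1) + N * ζ) / N) = 1 := by
  have hN := cast_ne_zero' N
  have e : 2 * (m * (τ + 1) + n * (tauStar ζ τ c + 1) + N * ζ) / N
      = 2 * (m * (τ + 1) + n * (tauStar ζ τ c + 1)) / N + 2 * ζ := by field_simp
  rw [e, ePi_add, h.2, ← ePi_add, neg_add_cancel, ePi_zero]

lemma OnSurface.RHat_add [NeZero N] (h : OnSurface N ζ τ c m n) {σ : ℂ} (hσ : 0 < σ.im) (x : ℂ) :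
    RHat N ζ σ (x + (m * (τ + 1) + n * (tauStar ζ τ c + 1) + N * ζ)) = RHat N ζ σ x :=
  RHat_add_of_samePoint hσ h.ePi_eq_one h.ePi_div_eq_one x

/-- Modulo the periods of `𝒰`, the shift by `-n(τ*+1)` is the shift by `m(τ+1)`, at which `𝓕_{-m}`
becomes `𝓕_m⁻¹`. -/
lemma OnSurface.FFun_add_left [NeZero N] (h : OnSurface N ζ τ c m n) (hζ : 0 < ζ.im) (x : ℂ) :
    FFun N ζ τ (-m) (x - n * (tauStar ζ τ c + 1)) = (FFun N ζ τ m x)⁻¹ := by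
  rw [← FFun_add (UFun_add_of_ePi_eq_one h.ePi_eq_one)]
  have e := FFun_sub_mul (N := N) ζ τ (-m) x
  rw [neg_neg] at e
  rw [← e, ← FFun_add (UFun_add_mul hζ) τ (-m) (x - _)]
  congr 1; push_cast; ring

lemma OnSurface.FFun_add_right [NeZero N] (h : OnSurface N ζ τ c m n) (hζ : 0 < ζ.im) (x : ℂ) :
    FFun N ζ (tauStar ζ τ c) n (x + m * (τ + 1)) = (FFun N ζ (tauStar ζ τ c) (-n) x)⁻¹ := by
  rw [← FFun_sub_mul, ← FFun_add (UFun_add_mul hζ),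
    ← FFun_add (UFun_add_of_ePi_eq_one h.ePi_eq_one) _ _ (x - _)]
  congr 1; ring

end

/-! ### Exchange relations -/

lemma scal_RHat_shift {N : ℕ} {A : Type*} [Ring A] [Algebra ℂ A] {R R' : Matrix (Fin N × Fin N) (Fin N × Fin N) ℂ}
    {f : ℂ} {k : ℤ} (h : R' = f • (((gammaMat N ^ (-k)) ⊗ₖ (1 : Matrix (Fin N) (Fin N) ℂ)) * R
        * ((gammaMat N ^ k) ⊗ₖ (1 : Matrix (Fin N) (Fin N) ℂ)))) :
    scal A R' = f • (first (scal A (gammaMat N ^ (-k))) * scal A R * first (scal A (gammaMat N ^ k))) := by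
  rw [h, scal_smul, scal_mul, scal_mul, scal_kronecker_one, scal_kronecker_one]


section

variable {N : ℕ} [NeZero N] {ζ τ c : ℂ} {m n : ℤ}

lemma scal_gammaMat_cancel (A : Type*) [Ring A] [Algebra ℂ A] (k : ℤ) :
    first (scal A (gammaMat N ^ (-k))) * first (scal A (gammaMat N ^ k)) = 1 := by
  rw [first_mul_first, ← scal_mul, Matrix.zpow_neg (isUnit_det_gammaMat N),
    Matrix.nonsing_inv_mul _ ((isUnit_det_gammaMat N).det_zpow k), scal_one, first_one]

lemma inv_RHat_shift {R R' : Matrix (Fin N × Fin N) (Fin N × Fin N) ℂ} {f : ℂ} (hf : f ≠ 0)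
    (hR : IsUnit R) {k : ℤ} (h : R' = f⁻¹ • (((gammaMat N ^ (-k)) ⊗ₖ (1 : Matrix (Fin N) (Fin N) ℂ)) * R
        * ((gammaMat N ^ k) ⊗ₖ (1 : Matrix (Fin N) (Fin N) ℂ)))) :
    R'⁻¹ = f • (((gammaMat N ^ (-k)) ⊗ₖ (1 : Matrix (Fin N) (Fin N) ℂ)) * R⁻¹
        * ((gammaMat N ^ k) ⊗ₖ (1 : Matrix (Fin N) (Fin N) ℂ))) := by
  have hu := (isUnit_det_gammaMat N).det_zpow k
  have hR' := (Matrix.isUnit_iff_isUnit_det _).mp hR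
  have e1 : ((gammaMat N ^ k) ⊗ₖ (1 : Matrix (Fin N) (Fin N) ℂ))
      * ((gammaMat N ^ (-k)) ⊗ₖ (1 : Matrix (Fin N) (Fin N) ℂ)) = 1 := by
    rw [← Matrix.mul_kronecker_mul, one_mul, Matrix.zpow_neg (isUnit_det_gammaMat N),
      Matrix.mul_nonsing_inv _ hu, Matrix.one_kronecker_one]
  have e2 : ((gammaMat N ^ (-k)) ⊗ₖ (1 : Matrix (Fin N) (Fin N) ℂ))
      * ((gammaMat N ^ k) ⊗ₖ (1 : Matrix (Fin N) (Fin N) ℂ)) = 1 := by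
    rw [← Matrix.mul_kronecker_mul, one_mul, Matrix.zpow_neg (isUnit_det_gammaMat N),
      Matrix.nonsing_inv_mul _ hu, Matrix.one_kronecker_one]
  refine Matrix.inv_eq_right_inv ?_
  set G := (gammaMat N ^ k) ⊗ₖ (1 : Matrix (Fin N) (Fin N) ℂ)
  set G' := (gammaMat N ^ (-k)) ⊗ₖ (1 : Matrix (Fin N) (Fin N) ℂ)
  rw [h, Matrix.smul_mul, Matrix.mul_smul, smul_smul, inv_mul_cancel₀ hf, one_smul]
  calc _ = G' * R * (G * G') * R⁻¹ * G := by simp only [mul_assoc]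
    _ = 1 := by rw [e1, mul_one, mul_assoc G', Matrix.mul_nonsing_inv _ hR', mul_one, e2]

section

variable {A : Type*} [Ring A] [Algebra ℂ A] {P R S R' S' : Matrix (Fin N × Fin N) (Fin N × Fin N) ℂ}
  {f g : ℂ} {L₁ L₁' L L' L₂ : Matrix (Fin N) (Fin N) A}

/-- `P`, `R'` and `S'` stand for `R̂(q^{-N}z)` and the two R-matrices at the shifted point. The
powers of `Γ` act in the first factor only, hence commute with the second Lax matrix and merge into
`Γ^{-m} L₁ Γ^{-n}`. -/
lemma trace_exchange_of_shift (hf : f ≠ 0) (hR : IsUnit R) (hS : IsUnit S)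
    (hc : transpose₁ P * transpose₁ R⁻¹ = 1)
    (hR' : R' = f⁻¹ • (((gammaMat N ^ (-(-m))) ⊗ₖ (1 : Matrix (Fin N) (Fin N) ℂ)) * P
        * ((gammaMat N ^ (-m)) ⊗ₖ (1 : Matrix (Fin N) (Fin N) ℂ))))
    (hS' : S' = g⁻¹ • (((gammaMat N ^ (-n)) ⊗ₖ (1 : Matrix (Fin N) (Fin N) ℂ)) * S
        * ((gammaMat N ^ n) ⊗ₖ (1 : Matrix (Fin N) (Fin N) ℂ))))
    (hL : L * L' = 1) (hL' : L' * L = 1)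
    (h0 : scal A R * first L * second L₂ = second L₂ * first L * scal A S)
    (h1 : scal A R' * first L₁ * second L₂ = second L₂ * first L₁ * scal A S') (i j : Fin N) :
    (scal A (gammaMat N ^ (-m)) * L₁ * scal A (gammaMat N ^ (-n)) * L').trace * L₂ i j
      = (f / g) • (L₂ i j *
        (scal A (gammaMat N ^ (-m)) * L₁ * scal A (gammaMat N ^ (-n)) * L').trace) := by
  rw [scal_RHat_shift (A := A) hR', scal_RHat_shift (A := A) hS'] at h1
  refine trace_exchange hS hc ?_ (first_inv_exchange hR hS hL hL' h0) i j
  have hm := scal_gammaMat_cancel (N := N) A m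
  have hn := scal_gammaMat_cancel (N := N) A (-n)
  have hcm := fun k => first_scal_mul_second (A := A) (gammaMat N ^ (k : ℤ)) L₂
  rw [neg_neg] at h1 hn
  simp only [← first_mul_first]
  have hc1 := hcm (-m)
  have hc2 := hcm (-n)
  generalize scal A P = P at *
  generalize scal A S = S at *
  generalize first L₁ = L1 at *
  generalize second L₂ = L2 at *
  generalize first (scal A (gammaMat N ^ m)) = M at *
  generalize first (scal A (gammaMat N ^ (-m))) = M' at *
  generalize first (scal A (gammaMat N ^ n)) = G at *
  generalize first (scal A (gammaMat N ^ (-n))) = G' at *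
  have k2 := congrArg (fun Z => f • (M' * Z * G')) h1
  simp only [Matrix.smul_mul, Matrix.mul_smul, smul_smul, mul_inv_cancel₀ hf, one_smul] at k2
  calc P * (M' * L1 * G') * L2 = P * M' * L1 * (G' * L2) := by simp only [mul_assoc]
    _ = (M' * M) * P * M' * L1 * L2 * G' := by rw [hc2, hm, one_mul]; simp only [mul_assoc]
    _ = M' * (M * P * M' * L1 * L2) * G' := by simp only [mul_assoc]
    _ = _ := by
      have k3 : M' * (L2 * L1 * (G' * S * G)) * G' = L2 * (M' * L1 * G') * S := by
        calc _ = (M' * L2) * L1 * G' * S * (G * G') := by simp only [mul_assoc]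
          _ = _ := by rw [hc1, hn, mul_one]; simp only [mul_assoc]
      rw [k2, k3, div_eq_mul_inv]

/-- Here the shifted Lax matrix is the inverted one, so the conjugated R-matrices enter through
their inverses and the scalar is `g/f` instead of `f/g`. -/
lemma trace_exchange_star_of_shift (hf : f ≠ 0) (hg : g ≠ 0) (hR : IsUnit R) (hS : IsUnit P)
    (hR1 : IsUnit R') (hS1 : IsUnit S') (hc : transpose₁ S * transpose₁ P⁻¹ = 1)
    (hR' : R' = f⁻¹ • (((gammaMat N ^ (-(-m))) ⊗ₖ (1 : Matrix (Fin N) (Fin N) ℂ)) * R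
        * ((gammaMat N ^ (-m)) ⊗ₖ (1 : Matrix (Fin N) (Fin N) ℂ))))
    (hS' : S' = g⁻¹ • (((gammaMat N ^ (-n)) ⊗ₖ (1 : Matrix (Fin N) (Fin N) ℂ)) * P
        * ((gammaMat N ^ n) ⊗ₖ (1 : Matrix (Fin N) (Fin N) ℂ))))
    (hL : L₁ * L₁' = 1) (hL' : L₁' * L₁ = 1)
    (h0 : scal A R * first L * second L₂ = second L₂ * first L * scal A S)
    (h1 : scal A R' * first L₁ * second L₂ = second L₂ * first L₁ * scal A S') (i j : Fin N) :
    (scal A (gammaMat N ^ (-(-n))) * L₁' * scal A (gammaMat N ^ (-(-m))) * L).trace * L₂ i j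
      = (g / f) • (L₂ i j *
        (scal A (gammaMat N ^ (-(-n))) * L₁' * scal A (gammaMat N ^ (-(-m))) * L).trace) := by
  have hinv := first_inv_exchange hR1 hS1 hL hL' h1
  rw [scal_RHat_shift (A := A) (inv_RHat_shift hf hR hR'),
    scal_RHat_shift (A := A) (inv_RHat_shift hg hS hS')] at hinv
  refine trace_exchange_star hR (mul_eq_one_comm.mp hc) ?_ h0 i j
  have hm := scal_gammaMat_cancel (N := N) A m
  have hn := scal_gammaMat_cancel (N := N) A (-n)
  have hcm := fun k => first_scal_mul_second (A := A) (gammaMat N ^ (k : ℤ)) L₂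
  rw [neg_neg] at hinv hn
  simp only [← first_mul_first, neg_neg]
  have hc1 := hcm m
  have hc2 := hcm n
  generalize scal A P⁻¹ = P at *
  generalize scal A R⁻¹ = S at *
  generalize first L₁' = L1 at *
  generalize second L₂ = L2 at *
  generalize first (scal A (gammaMat N ^ m)) = M at *
  generalize first (scal A (gammaMat N ^ (-m))) = M' at *
  generalize first (scal A (gammaMat N ^ n)) = G at *
  generalize first (scal A (gammaMat N ^ (-n))) = G' at *
  have k2 := congrArg (fun Z => f⁻¹ • (G * Z * M)) hinv
  simp only [Matrix.smul_mul, Matrix.mul_smul, smul_smul, inv_mul_cancel₀ hf, one_smul] at k2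
  calc G * L1 * M * S * L2 = G * L1 * M * S * ((M' * M) * L2) := by rw [hm, one_mul]
    _ = G * L1 * M * S * M' * (M * L2) := by simp only [mul_assoc]
    _ = G * (L1 * (M * S * M') * L2) * M := by rw [hc1]; simp only [mul_assoc]
    _ = _ := by
      have k3 : G * (L2 * (G' * P * G) * L1) * M = L2 * P * (G * L1 * M) := by
        calc _ = (G * L2) * G' * P * (G * L1 * M) := by simp only [mul_assoc]
          _ = L2 * (G * G') * P * (G * L1 * M) := by rw [hc2]; simp only [mul_assoc]
          _ = _ := by rw [hn, mul_one]
      rw [k2, k3, div_eq_inv_mul]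

end

theorem t_mul_LMat (hζ : 0 < ζ.im) (hτ : 0 < τ.im) (hτs : 0 < (tauStar ζ τ c).im)
    (hS : OnSurface N ζ τ c m n) :
    ∀ᶠ x in Filter.codiscrete ℂ, ∀ (v : ℂ) (i j : Fin N),
      t N ζ τ c m n (v + x) * LMat N ζ τ c v i j
        = (FFun N ζ τ (-m) x / FFun N ζ (tauStar ζ τ c) n x) •
          (LMat N ζ τ c v i j * t N ζ τ c m n (v + x)) := by
  have r1 := eventually_isRegular (N := N) hζ hτ
  have r2 := eventually_isRegular (N := N) hζ hτs
  have hF := eventually_FFun_ne_zero (N := N) hζ τ (-m)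
  have s1 := eventually_codiscrete_sub (RHat_add_zsmul (N := N) hζ hτ (-m)) (N * ζ)
  filter_upwards [r1, r2, eventually_codiscrete_add r1 (n * (tauStar ζ τ c + 1)),
    eventually_codiscrete_add r2 (n * (tauStar ζ τ c + 1)), hF, s1,
    RHat_add_zsmul (N := N) hζ hτs n, RHat_crossing (N := N) hζ hτ]
    with x x1 x2 x3 x4 hf e1 e2 hc v i j
  have k0 := RLL_of_sub_eq N ζ τ c (add_sub_cancel_left v x) x1 x2
  have e3 : v + x + n * (tauStar ζ τ c + 1) - v = x + n * (tauStar ζ τ c + 1) := by ring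
  have k1 := RLL_of_sub_eq N ζ τ c e3 x3 x4
  -- The surface is used here: the shift in `t_{mn}` is seen by `R̂` as a crossing shift followed by
  -- `-m` quasi-periods.
  have e4 : RHat N ζ τ (x - N * ζ + ((-m : ℤ) : ℂ) * (τ + 1))
      = RHat N ζ τ (x + n * (tauStar ζ τ c + 1)) := by
    rw [← hS.RHat_add hτ (x - N * ζ + ((-m : ℤ) : ℂ) * (τ + 1))]
    congr 1; push_cast; ring
  rw [FFun_sub_mul_self hζ, e4] at e1
  exact trace_exchange_of_shift hf x1.2.1 x2.2.1 hc.2 e1 e2 (LMat_mul_LInv N ζ τ c _)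
    (LInv_mul_LMat N ζ τ c _) k0 k1 i j

theorem tStar_mul_LMat (hζ : 0 < ζ.im) (hτ : 0 < τ.im) (hτs : 0 < (tauStar ζ τ c).im)
    (hS : OnSurface N ζ τ c m n) :
    ∀ᶠ x in Filter.codiscrete ℂ, ∀ (v : ℂ) (i j : Fin N),
      tStar N ζ τ c (-n) (-m) (v + x) * LMat N ζ τ c v i j
        = (FFun N ζ (tauStar ζ τ c) n x / FFun N ζ τ (-m) x) •
          (LMat N ζ τ c v i j * tStar N ζ τ c (-n) (-m) (v + x)) := by
  have r1 := eventually_isRegular (N := N) hζ hτ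
  have r2 := eventually_isRegular (N := N) hζ hτs
  have hF := eventually_FFun_ne_zero (N := N) hζ τ (-m)
  have hFs := eventually_FFun_ne_zero (N := N) hζ (tauStar ζ τ c) n
  have s2 := eventually_codiscrete_add (RHat_add_zsmul (N := N) hζ hτs n) (N * ζ)
  filter_upwards [r1, r2, eventually_codiscrete_add r1 (((-m : ℤ) : ℂ) * (τ + 1)),
    eventually_codiscrete_add r2 (((-m : ℤ) : ℂ) * (τ + 1)), hF, hFs,
    RHat_add_zsmul (N := N) hζ hτ (-m), s2,
    eventually_codiscrete_add (RHat_crossing (N := N) hζ hτs) (N * ζ)]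
    with x x1 x2 x3 x4 hf hfs e1 e2 hc v i j
  have k0 := RLL_of_sub_eq N ζ τ c (add_sub_cancel_left v x) x1 x2
  have e3 : v + x + ((-m : ℤ) : ℂ) * (τ + 1) - v = x + ((-m : ℤ) : ℂ) * (τ + 1) := by ring
  have k1 := RLL_of_sub_eq N ζ τ c e3 x3 x4
  -- The roles are exchanged: `R̂*` sees the shift by `-m(τ+1)` as `Nζ` plus `n` of its own
  -- quasi-periods.
  have e4 : RHat N ζ (tauStar ζ τ c) (x + ((-m : ℤ) : ℂ) * (τ + 1))
      = RHat N ζ (tauStar ζ τ c) (x + N * ζ + n * (tauStar ζ τ c + 1)) := by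
    rw [← hS.RHat_add hτs (x + ((-m : ℤ) : ℂ) * (τ + 1))]
    congr 1; push_cast; ring
  rw [FFun_add (UFun_add_mul hζ), ← e4] at e2
  rw [add_sub_cancel_right] at hc
  exact trace_exchange_star_of_shift hf hfs x1.2.1 hc.1 x3.2.1 x4.2.1 hc.2 e1 e2
    (LMat_mul_LInv N ζ τ c _) (LInv_mul_LMat N ζ τ c _) k0 k1 i j

end

/-! ### From linear to quadratic exchange relations, and product forms of `𝓕_a`. -/

section

variable {N : ℕ} {ζ τ c : ℂ} {m n : ℤ}

/-- Exchange with `L` implies exchange with `t_{mn}`. -/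
lemma exchange_t {T : ℂ → EllAlg N ζ τ c} {f : ℂ → ℂ}
    (hf : ∀ᶠ x in Filter.codiscrete ℂ, f x ≠ 0)
    (h : ∀ᶠ x in Filter.codiscrete ℂ, ∀ (v : ℂ) (i j : Fin N),
      T (v + x) * LMat N ζ τ c v i j = f x • (LMat N ζ τ c v i j * T (v + x))) :
    ∀ᶠ x in Filter.codiscrete ℂ, ∀ v : ℂ, T (v + x) * t N ζ τ c m n v
      = (f (x - n * (tauStar ζ τ c + 1)) * (f x)⁻¹) • (t N ζ τ c m n v * T (v + x)) := by
  filter_upwards [hf, h, eventually_codiscrete_sub h (n * (tauStar ζ τ c + 1))] with x hfx h1 h2 v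
  refine trace_mul_exchange _ _ ?_
    (inv_exchange hfx (LMat_mul_LInv N ζ τ c v) (LInv_mul_LMat N ζ τ c v) (h1 v))
  have h3 := h2 (v + n * (tauStar ζ τ c + 1))
  rwa [show v + n * (tauStar ζ τ c + 1) + (x - n * (tauStar ζ τ c + 1)) = v + x by ring] at h3

/-- Exchange with `L` implies exchange with `t^*_{-n,-m}`. -/
lemma exchange_tStar {T : ℂ → EllAlg N ζ τ c} {f : ℂ → ℂ}
    (hf : ∀ᶠ x in Filter.codiscrete ℂ, f x ≠ 0)
    (h : ∀ᶠ x in Filter.codiscrete ℂ, ∀ (v : ℂ) (i j : Fin N),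
      T (v + x) * LMat N ζ τ c v i j = f x • (LMat N ζ τ c v i j * T (v + x))) :
    ∀ᶠ x in Filter.codiscrete ℂ, ∀ v : ℂ, T (v + x) * tStar N ζ τ c (-n) (-m) v
      = ((f (x + m * (τ + 1)))⁻¹ * f x) • (tStar N ζ τ c (-n) (-m) v * T (v + x)) := by
  filter_upwards [h, eventually_codiscrete_add hf (m * (τ + 1)),
    eventually_codiscrete_add h (m * (τ + 1))] with x h1 hfx h2 v
  refine trace_mul_exchange _ _ ?_ (h1 v)
  have h3 := h2 (v + ((-m : ℤ) : ℂ) * (τ + 1))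
  rw [show v + ((-m : ℤ) : ℂ) * (τ + 1) + (x + m * (τ + 1)) = v + x by push_cast; ring] at h3
  exact inv_exchange hfx (LMat_mul_LInv N ζ τ c _) (LInv_mul_LMat N ζ τ c _) h3

lemma YFun_neg (x : ℂ) : YFun N ζ τ c m n x = YFun N ζ τ c (-m) (-n) x := by
  rw [YFun, YFun, neg_neg, neg_neg, mul_comm (FFun N ζ (tauStar ζ τ c) n x), mul_comm (FFun N ζ τ m x)]

lemma ePi_two_mul_add_natCast (σ x : ℂ) (k : ℕ) :
    ePi (2 * (x + k * (σ + 1))) = ePi (2 * σ) ^ k * ePi (2 * x) := by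
  rw [show 2 * (x + k * (σ + 1)) = k * (2 * σ) + 2 * x + 2 * k by ring, ePi_add, ePi_two_mul_nat,
    ePi_add, ePi_nat_mul, mul_one]

lemma ePi_two_mul_sub_natCast (σ x : ℂ) (k : ℕ) :
    ePi (2 * (x - k * (σ + 1))) = (ePi (2 * σ))⁻¹ ^ k * ePi (2 * x) := by
  have h := ePi_two_mul_add_natCast σ (x - k * (σ + 1)) k
  rw [sub_add_cancel] at h
  rw [h, ← mul_assoc, ← mul_pow, inv_mul_cancel₀ (ePi_ne_zero _), one_pow, one_mul]

lemma FFun_eq_prod_Theta (σ : ℂ) (a : ℕ) (x : ℂ) :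
    let Θ := Theta (ePi ζ ^ (2 * N))
    let q := ePi ζ
    let p := ePi (2 * σ)
    let y := ePi (2 * x)
    FFun N ζ σ a x
        = ePi (ζ * (a * (2 / N - 2))) * ∏ k ∈ Finset.range a,
            (Θ (q ^ 2 * p ^ k * y) * Θ (q ^ 2 * p⁻¹ ^ k * y⁻¹))
              / (Θ (p ^ k * y) * Θ (p⁻¹ ^ k * y⁻¹)) ∧
      FFun N ζ σ (-a) x
        = ePi (-(ζ * (a * (2 / N - 2)))) * ∏ k ∈ Finset.Icc 1 a,
            (Θ (p⁻¹ ^ k * y) * Θ (p ^ k * y⁻¹))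
              / (Θ (q ^ 2 * p⁻¹ ^ k * y) * Θ (q ^ 2 * p ^ k * y⁻¹)) := by
  intro Θ q p y
  have hp : p ≠ 0 := ePi_ne_zero _
  have e : ePi (ζ * (a * (2 / N - 2))) = ePi (ζ * (2 / N - 2)) ^ a := by
    rw [← ePi_nat_mul]; congr 1; ring
  constructor
  · rw [FFun_natCast, e]
    have h1 := Finset.prod_const (s := Finset.range a) (ePi (ζ * (2 / N - 2)))
    rw [Finset.card_range] at h1
    rw [← h1, ← Finset.prod_mul_distrib]
    refine Finset.prod_congr rfl fun k _ => ?_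
    rw [UFun_eq, ePi_two_mul_add_natCast, mul_inv, ← inv_pow, mul_assoc, mul_assoc]
  · rw [FFun_neg_natCast, ePi_neg, e, ← inv_pow]
    have h1 := Finset.prod_const (s := Finset.Icc 1 a) (ePi (ζ * (2 / N - 2)))⁻¹
    rw [Nat.card_Icc, Nat.add_sub_cancel] at h1
    rw [← h1, ← Finset.prod_mul_distrib]
    refine Finset.prod_congr rfl fun k _ => ?_
    rw [UFun_eq, ePi_two_mul_sub_natCast, mul_inv, mul_inv, inv_div, ← inv_pow, inv_inv, mul_assoc,
      mul_assoc]

end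

/-! ### The functions `g^{(k)}` -/

/-- `(1 - z) (q² z/r; q⁴) (q⁴ r z; q⁴) / ((z/r; q⁴) (q² r z; q⁴))`, the function `g^{(k)}` for
`r = p^k`. -/
noncomputable def gMero (q r z : ℂ) : ℂ :=
  (1 - z) * (qPoch (q ^ 2 * r⁻¹ * z) (q ^ 4) * qPoch (q ^ 4 * r * z) (q ^ 4))
    / (qPoch (r⁻¹ * z) (q ^ 4) * qPoch (q ^ 2 * r * z) (q ^ 4))

section

variable {q w : ℂ}

lemma norm_one_add_pow_ge (hq : ‖q‖ < 1) (l : ℕ) : 1 - ‖q‖ ^ 2 ≤ ‖1 + q ^ (2 * (l + 1))‖ := by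
  have h1 : ‖q ^ (2 * (l + 1))‖ ≤ ‖q‖ ^ 2 := by
    rw [norm_pow]
    exact pow_le_pow_of_le_one (norm_nonneg q) hq.le (by omega)
  have h2 := norm_sub_norm_le (1 : ℂ) (-q ^ (2 * (l + 1)))
  rw [norm_neg, norm_one, sub_neg_eq_add] at h2
  linarith

lemma one_add_pow_ne_zero (hq : ‖q‖ < 1) (l : ℕ) : 1 + q ^ (2 * (l + 1)) ≠ 0 := by
  have h1 := norm_one_add_pow_ge hq l
  have h2 : ‖q‖ ^ 2 < 1 := pow_lt_one₀ (norm_nonneg q) hq two_ne_zero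
  exact norm_pos_iff.mp (by linarith)

lemma norm_div_one_add_pow_le (hq : ‖q‖ < 1) (w : ℂ) (l : ℕ) :
    ‖w ^ (l + 1) / ((1 + q ^ (2 * (l + 1))) * ((l : ℂ) + 1))‖
      ≤ (1 - ‖q‖ ^ 2)⁻¹ * ‖w‖ ^ (l + 1) := by
  have h2 : 0 < 1 - ‖q‖ ^ 2 := by
    have := pow_lt_one₀ (norm_nonneg q) hq two_ne_zero
    linarith
  have h3 : (1 : ℝ) ≤ ‖(l : ℂ) + 1‖ := by
    have : ((l : ℂ) + 1) = ((l + 1 : ℕ) : ℂ) := by push_cast; rfl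
    rw [this, Complex.norm_natCast]
    exact_mod_cast Nat.succ_le_succ (Nat.zero_le l)
  rw [norm_div, norm_mul, norm_pow, div_eq_inv_mul]
  refine mul_le_mul_of_nonneg_right (inv_anti₀ h2 ?_) (by positivity)
  nlinarith [norm_one_add_pow_ge hq l]

lemma summable_div_one_add_pow (hq : ‖q‖ < 1) (hw : ‖w‖ < 1) :
    Summable fun l : ℕ => w ^ (l + 1) / ((1 + q ^ (2 * (l + 1))) * ((l : ℂ) + 1)) := by
  refine Summable.of_norm_bounded (g := fun l => (1 - ‖q‖ ^ 2)⁻¹ * ‖w‖ ^ (l + 1)) ?_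
    (norm_div_one_add_pow_le hq w)
  exact (((summable_geometric_of_lt_one (norm_nonneg w) hw).comp_injective
    (add_left_injective 1)).mul_left _)

lemma one_sub_ne_zero_of_norm (hw : ‖w‖ < 1) : 1 - w ≠ 0 := by
  intro h
  rw [← sub_eq_zero.mp h, norm_one] at hw
  exact lt_irrefl _ hw

/-- Adding the series at `v` and at `q²v` cancels `1 + q^{2ℓ}` and leaves `-log(1 - v)`. The ratio
`ρ` of the two sides therefore satisfies `ρ(v)ρ(q²v) = 1`, so it is invariant under `v ↦ q⁴v`, and
letting the argument tend to `0` gives `ρ = 1`. -/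
lemma exists_hasSum_exp_eq_qPoch (hq : ‖q‖ < 1) (hw : ‖w‖ < 1) :
    ∃ s, HasSum (fun l : ℕ => w ^ (l + 1) / ((1 + q ^ (2 * (l + 1))) * ((l : ℂ) + 1))) s ∧
      Complex.exp s = qPoch (q ^ 2 * w) (q ^ 4) / qPoch w (q ^ 4) := by
  have ha : ‖q ^ 4‖ < 1 := norm_pow_lt_one hq (by norm_num)
  have hq2 : ‖q ^ 2‖ < 1 := norm_pow_lt_one hq (by norm_num)
  have hmul : ∀ {v : ℂ}, ‖v‖ < 1 → ‖q ^ 2 * v‖ < 1 := fun {v} hv => by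
    rw [norm_mul]
    exact mul_lt_one_of_nonneg_of_lt_one_left (norm_nonneg _) hq2 hv.le
  set e : ℂ → ℂ := fun v => ∑' l : ℕ, v ^ (l + 1) / ((1 + q ^ (2 * (l + 1))) * ((l : ℂ) + 1)) with he
  set ρ : ℂ → ℂ := fun v => Complex.exp (e v) * (qPoch v (q ^ 4) / qPoch (q ^ 2 * v) (q ^ 4)) with hρ
  have hne : ∀ {v : ℂ}, ‖v‖ < 1 → qPoch v (q ^ 4) ≠ 0 := fun hv => qPoch_ne_zero_of_norm_lt ha hv
  have hfe : ∀ {v : ℂ}, ‖v‖ < 1 → ρ v * ρ (q ^ 2 * v) = 1 := fun {v} hv => by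
    have h1 : HasSum (fun l : ℕ => v ^ (l + 1) / ((l : ℂ) + 1)) (e v + e (q ^ 2 * v)) := by
      refine ((summable_div_one_add_pow hq hv).hasSum.add
        (summable_div_one_add_pow hq (hmul hv)).hasSum).congr_fun fun l => ?_
      have h2 := one_add_pow_ne_zero hq l
      have h3 : (l : ℂ) + 1 ≠ 0 := Nat.cast_add_one_ne_zero l
      rw [mul_pow, ← pow_mul]
      field_simp
    have h2 : e v + e (q ^ 2 * v) = -Complex.log (1 - v) :=
      h1.unique (Complex.hasSum_taylorSeries_neg_log' hv)
    have h3 : Complex.exp (e v) * Complex.exp (e (q ^ 2 * v)) = (1 - v)⁻¹ := by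
      rw [← Complex.exp_add, h2, Complex.exp_neg, Complex.exp_log (one_sub_ne_zero_of_norm hv)]
    have h4 := qPoch_eq_mul ha v
    rw [show q ^ 4 * v = q ^ 2 * (q ^ 2 * v) by ring] at h4
    have n1 := hne (hmul hv)
    have n2 := hne (hmul (hmul hv))
    have n3 := one_sub_ne_zero_of_norm hv
    calc ρ v * ρ (q ^ 2 * v) = (Complex.exp (e v) * Complex.exp (e (q ^ 2 * v)))
          * (qPoch v (q ^ 4) / qPoch (q ^ 2 * v) (q ^ 4)
            * (qPoch (q ^ 2 * v) (q ^ 4) / qPoch (q ^ 2 * (q ^ 2 * v)) (q ^ 4))) := by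
          simp only [hρ]; ring
      _ = 1 := by
          rw [h3, h4]
          generalize qPoch (q ^ 2 * v) (q ^ 4) = A at *
          generalize qPoch (q ^ 2 * (q ^ 2 * v)) (q ^ 4) = B at *
          field_simp
  have hstep : ∀ {v : ℂ}, ‖v‖ < 1 → ρ (q ^ 4 * v) = ρ v := fun {v} hv => by
    have h1 := hfe hv
    have h2 := hfe (hmul hv)
    rw [show q ^ 4 * v = q ^ 2 * (q ^ 2 * v) by ring]
    calc _ = (ρ v * ρ (q ^ 2 * v)) * ρ (q ^ 2 * (q ^ 2 * v)) := by rw [h1, one_mul]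
      _ = _ := by rw [mul_assoc, h2, mul_one]
  have hpow : ∀ k : ℕ, ‖(q ^ 4) ^ k * w‖ ≤ ‖w‖ := fun k => by
    rw [norm_mul, norm_pow]
    exact mul_le_of_le_one_left (norm_nonneg w) (pow_le_one₀ (norm_nonneg _) ha.le)
  have hconst : ∀ k : ℕ, ρ ((q ^ 4) ^ k * w) = ρ w := fun k => by
    induction k with
    | zero => simp
    | succ k ih => rw [pow_succ', mul_assoc, hstep ((hpow k).trans_lt hw), ih]
  have hlim : Filter.Tendsto (fun k : ℕ => (q ^ 4) ^ k * w) Filter.atTop (𝓝 0) := by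
    simpa using (tendsto_pow_atTop_nhds_zero_of_norm_lt_one ha).mul_const w
  have helim : Filter.Tendsto (fun k : ℕ => e ((q ^ 4) ^ k * w)) Filter.atTop (𝓝 0) := by
    have h := tendsto_tsum_of_dominated_convergence (𝓕 := Filter.atTop)
      (f := fun (k l : ℕ) => ((q ^ 4) ^ k * w) ^ (l + 1) / ((1 + q ^ (2 * (l + 1))) * ((l : ℂ) + 1)))
      (g := fun _ => 0) (bound := fun l => (1 - ‖q‖ ^ 2)⁻¹ * ‖w‖ ^ (l + 1))
      (((summable_geometric_of_lt_one (norm_nonneg w) hw).comp_injective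
        (add_left_injective 1)).mul_left _)
      (fun l => by
        have := (hlim.pow (l + 1)).div_const ((1 + q ^ (2 * (l + 1))) * ((l : ℂ) + 1))
        simpa using this)
      (.of_forall fun k l => (norm_div_one_add_pow_le hq _ l).trans <| by
        have h2 : 0 < 1 - ‖q‖ ^ 2 := by
          have := pow_lt_one₀ (norm_nonneg q) hq two_ne_zero
          linarith
        have := pow_le_pow_left₀ (norm_nonneg _) (hpow k) (l + 1)
        exact mul_le_mul_of_nonneg_left this (inv_nonneg.mpr h2.le))
    simpa using h
  have hρlim : Filter.Tendsto (fun k : ℕ => ρ ((q ^ 4) ^ k * w)) Filter.atTop (𝓝 1) := by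
    have hd := (differentiable_qPoch ha).continuous
    have c1 : Filter.Tendsto (fun k : ℕ => qPoch ((q ^ 4) ^ k * w) (q ^ 4)) Filter.atTop (𝓝 1) := by
      have := (hd.tendsto 0).comp hlim
      rwa [qPoch_zero] at this
    have c2 : Filter.Tendsto (fun k : ℕ => qPoch (q ^ 2 * ((q ^ 4) ^ k * w)) (q ^ 4))
        Filter.atTop (𝓝 1) := by
      have h0 := hlim.const_mul (q ^ 2)
      rw [mul_zero] at h0
      have := (hd.tendsto 0).comp h0
      rwa [qPoch_zero] at this
    have := helim.cexp.mul (c1.div c2 one_ne_zero)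
    simpa using this
  have hρ1 : ρ w = 1 := by
    simp only [hconst] at hρlim
    exact tendsto_nhds_unique tendsto_const_nhds hρlim
  refine ⟨e w, (summable_div_one_add_pow hq hw).hasSum, ?_⟩
  have n1 := hne hw
  have n2 := hne (hmul hw)
  rw [hρ] at hρ1
  field_simp at hρ1 ⊢
  exact hρ1

/-- With `r = p^k` the coefficient equals `1 - (r^{-ℓ} + (q²r)^ℓ)/(1 + q^{2ℓ})`, so the series is a
logarithm minus two series of the previous kind, at `z/r` and `q²rz`. The condition `|z| < |r|`
makes all three converge. -/
lemma isGFun_gMero {p : ℂ} (hq : ‖q‖ < 1) (hp : ‖p‖ < 1) (hp0 : p ≠ 0) (k : ℕ) :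
    IsGFun p q k (gMero q (p ^ k)) := by
  have ha : ‖q ^ 4‖ < 1 := norm_pow_lt_one hq (by norm_num)
  have hr : p ^ k ≠ 0 := pow_ne_zero k hp0
  have hr1 : ‖p ^ k‖ ≤ 1 := by rw [norm_pow]; exact pow_le_one₀ (norm_nonneg p) hp.le
  refine ⟨fun z _ => ?_, fun z hz => ?_⟩
  · have hm : ∀ b : ℂ, MeromorphicAt (fun z => qPoch (b * z) (q ^ 4)) z := fun b =>
      (((differentiable_qPoch ha).comp (differentiable_id.const_mul b)).analyticAt z).meromorphicAt
    have h1 : MeromorphicAt (fun z : ℂ => 1 - z) z := by fun_prop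
    exact (h1.fun_mul ((hm _).fun_mul (hm _))).fun_div ((hm _).fun_mul (hm _))
  · rw [← norm_pow] at hz
    set r := p ^ k with hrdef
    have hz1 : ‖z‖ < 1 := hz.trans_le hr1
    have hz2 : ‖r⁻¹ * z‖ < 1 := by
      rw [norm_mul, norm_inv, inv_mul_lt_iff₀ (norm_pos_iff.mpr hr), mul_one]; exact hz
    have hz3 : ‖q ^ 2 * r * z‖ < 1 := by
      have h2 : ‖q ^ 2‖ ≤ 1 := (norm_pow_lt_one hq two_ne_zero).le
      rw [norm_mul, norm_mul]
      exact mul_lt_one_of_nonneg_of_lt_one_right (mul_le_one₀ h2 (norm_nonneg _) hr1)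
        (norm_nonneg z) hz1
    obtain ⟨s₁, hs₁, e₁⟩ := exists_hasSum_exp_eq_qPoch hq hz2
    obtain ⟨s₂, hs₂, e₂⟩ := exists_hasSum_exp_eq_qPoch hq hz3
    refine ⟨-Complex.log (1 - z) - s₁ - s₂, ?_, ?_⟩
    · refine (((Complex.hasSum_taylorSeries_neg_log' hz1).sub hs₁).sub hs₂).congr_fun fun l => ?_
      have h2 := one_add_pow_ne_zero hq l
      have h3 : (l : ℂ) + 1 ≠ 0 := Nat.cast_add_one_ne_zero l
      rw [show p⁻¹ ^ (k * (l + 1)) = r⁻¹ ^ (l + 1) by rw [hrdef, ← inv_pow, ← pow_mul]]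
      simp only [mul_pow, pow_mul, inv_pow] at h2 ⊢
      have h4 : r ^ (l + 1) ≠ 0 := pow_ne_zero _ hr
      generalize r ^ (l + 1) = R at *
      generalize (q ^ 2) ^ (l + 1) = Q at *
      field_simp
      ring
    · rw [show -(-Complex.log (1 - z) - s₁ - s₂) = Complex.log (1 - z) + (s₁ + s₂) by ring,
        Complex.exp_add, Complex.exp_add, Complex.exp_log (one_sub_ne_zero_of_norm hz1), e₁, e₂, gMero,
        show q ^ 2 * (q ^ 2 * r * z) = q ^ 4 * r * z by ring, ← mul_assoc (q ^ 2) r⁻¹ z]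
      rw [div_mul_div_comm, mul_div_assoc]

end

/-- `Θ(q² y) / Θ(y)` for the nome `q⁴`. -/
noncomputable def thetaQuot (q y : ℂ) : ℂ := Theta (q ^ 4) (q ^ 2 * y) / Theta (q ^ 4) y

/-! ### Theta quotients of nome `q⁴` and the ratios `g^{(k)}(y)/g^{(k)}(1/y)`. -/

section

variable {q y r : ℂ}

lemma thetaQuot_mul (hq : ‖q‖ < 1) (hq0 : q ≠ 0) (hy : y ≠ 0) :
    thetaQuot q (q ^ 4 * y) = (q ^ 2)⁻¹ * thetaQuot q y := by
  have ha : ‖q ^ 4‖ < 1 := norm_pow_lt_one hq (by norm_num)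
  have h1 := Theta_mul ha (pow_ne_zero 4 hq0) hy
  have h2 := Theta_mul ha (pow_ne_zero 4 hq0) (mul_ne_zero (pow_ne_zero 2 hq0) hy)
  rw [thetaQuot, thetaQuot, h1, show q ^ 2 * (q ^ 4 * y) = q ^ 4 * (q ^ 2 * y) by ring, h2]
  generalize Theta (q ^ 4) (q ^ 2 * y) = A
  generalize Theta (q ^ 4) y = B
  field_simp

/-- The two factors acquire the inverse multipliers `q⁻²` and `q²`; the product depends on `r` only
modulo the nome. -/
lemma thetaQuot_mul_inv (hq : ‖q‖ < 1) (hq0 : q ≠ 0) (hy : y ≠ 0) (hr : r ≠ 0) :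
    thetaQuot q (q ^ 4 * r * y) * thetaQuot q ((q ^ 4 * r)⁻¹ * y)
      = thetaQuot q (r * y) * thetaQuot q (r⁻¹ * y) := by
  have h1 := thetaQuot_mul hq hq0 (mul_ne_zero hr hy)
  have h2 := thetaQuot_mul hq hq0
    (mul_ne_zero (inv_ne_zero (mul_ne_zero (pow_ne_zero 4 hq0) hr)) hy)
  rw [show q ^ 4 * ((q ^ 4 * r)⁻¹ * y) = r⁻¹ * y by field_simp] at h2
  rw [mul_assoc (q ^ 4), h1, h2]
  ring

/-- For `N = 2` the nome is `q⁴ = q²·q²`, so the inversion formula also turns `Θ(q²/y)` into a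
multiple of `Θ(q²y)` and the quotient becomes a square. -/
lemma UFun_two (ζ x : ℂ) (hq : ‖ePi ζ‖ < 1) :
    UFun 2 ζ x = -(ePi ζ)⁻¹ * ePi (2 * x) * thetaQuot (ePi ζ) (ePi (2 * x)) ^ 2 := by
  have ha : ‖ePi ζ ^ 4‖ < 1 := norm_pow_lt_one hq (by norm_num)
  have hq0 := ePi_ne_zero ζ
  have hy := ePi_ne_zero (2 * x)
  have e : ePi (ζ * (2 / (2 : ℕ) - 2)) = (ePi ζ)⁻¹ := by
    rw [← ePi_neg]; congr 1; push_cast; ring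
  rw [UFun_eq, e, thetaQuot, show 2 * 2 = 4 from rfl]
  generalize ePi ζ = q at *
  generalize ePi (2 * x) = y at *
  have h1 := Theta_inv ha hy
  have h2 := Theta_inv ha (mul_ne_zero (pow_ne_zero 2 hq0) hy)
  have h3 := Theta_mul ha (pow_ne_zero 4 hq0) (inv_ne_zero (mul_ne_zero (pow_ne_zero 2 hq0) hy))
  rw [show q ^ 4 * (q ^ 2 * y)⁻¹ = q ^ 2 * y⁻¹ by field_simp, h2] at h3
  rw [h1, h3]
  generalize Theta (q ^ 4) (q ^ 2 * y) = A
  generalize Theta (q ^ 4) y = B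
  field_simp

/-- Each Pochhammer symbol in `y` meets its partner in `1/y` and forms a theta function; the
elementary factors combine into `r⁻¹`. -/
lemma gMero_div_gMero_inv (hq : ‖q‖ < 1) (hq0 : q ≠ 0) (hy : y ≠ 0) (hr : r ≠ 0) (hy1 : y ≠ 1)
    (h1 : qPoch (r⁻¹ * y) (q ^ 4) ≠ 0) (h2 : qPoch (q ^ 2 * r * y) (q ^ 4) ≠ 0)
    (h3 : qPoch (q ^ 2 * r⁻¹ * y⁻¹) (q ^ 4) ≠ 0) (h4 : qPoch (q ^ 4 * r * y⁻¹) (q ^ 4) ≠ 0)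
    (h5 : qPoch (r⁻¹ * y⁻¹) (q ^ 4) ≠ 0) (h6 : qPoch (q ^ 2 * r * y⁻¹) (q ^ 4) ≠ 0)
    (h7 : qPoch (r * y) (q ^ 4) ≠ 0) :
    gMero q r y / gMero q r y⁻¹ = r⁻¹ * (thetaQuot q (r⁻¹ * y) / thetaQuot q (r * y)) := by
  have ha : ‖q ^ 4‖ < 1 := norm_pow_lt_one hq (by norm_num)
  have haa : qPoch (q ^ 4) (q ^ 4) ≠ 0 := qPoch_ne_zero_of_norm_lt ha ha
  have e1 := qPoch_eq_mul ha (r * y)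
  have e2 := qPoch_eq_mul ha (r⁻¹ * y⁻¹)
  rw [← mul_assoc] at e1
  have i1 : q ^ 4 * (q ^ 2 * (r⁻¹ * y))⁻¹ = q ^ 2 * r * y⁻¹ := by field_simp
  have i2 : q ^ 4 * (r⁻¹ * y)⁻¹ = q ^ 4 * r * y⁻¹ := by field_simp
  have i3 : q ^ 4 * (q ^ 2 * (r * y))⁻¹ = q ^ 2 * r⁻¹ * y⁻¹ := by field_simp
  have i4 : q ^ 4 * (r * y)⁻¹ = q ^ 4 * (r⁻¹ * y⁻¹) := by rw [mul_inv]
  have hy2 : 1 - y⁻¹ ≠ 0 := by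
    rw [sub_ne_zero]; intro h; exact hy1 (by rw [← inv_inv y, ← h, inv_one])
  have hy3 : 1 - y = -(y * (1 - y⁻¹)) := by field_simp; ring
  rw [e1] at h7
  rw [e2] at h5
  have hry : 1 - r * y = -(r * y * (1 - r⁻¹ * y⁻¹)) := by field_simp; ring
  rw [hry] at h7 e1
  rw [gMero, gMero, thetaQuot, thetaQuot, Theta, Theta, Theta, Theta, i1, i2, i3, i4, e1, e2, hy3,
    ← mul_assoc (q ^ 2) r⁻¹ y, ← mul_assoc (q ^ 2) r y]
  simp only [ne_eq, mul_eq_zero, neg_eq_zero, not_or] at h5 h7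
  obtain ⟨h51, h52⟩ := h5
  obtain ⟨-, h72⟩ := h7
  generalize qPoch (r⁻¹ * y) (q ^ 4) = x1 at *
  generalize qPoch (q ^ 2 * r * y) (q ^ 4) = x2 at *
  generalize qPoch (q ^ 2 * r⁻¹ * y⁻¹) (q ^ 4) = x3 at *
  generalize qPoch (q ^ 4 * r * y⁻¹) (q ^ 4) = x4 at *
  generalize qPoch (q ^ 4 * (r⁻¹ * y⁻¹)) (q ^ 4) = x5 at *
  generalize qPoch (q ^ 2 * r * y⁻¹) (q ^ 4) = x6 at *
  generalize qPoch (q ^ 4 * r * y) (q ^ 4) = x7 at *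
  generalize qPoch (q ^ 2 * r⁻¹ * y) (q ^ 4) = x8 at *
  generalize qPoch (q ^ 4) (q ^ 4) = x9 at *
  generalize 1 - r⁻¹ * y⁻¹ = u at *
  generalize 1 - y⁻¹ = v at *
  field_simp

lemma eventually_gMero_div (hq : ‖q‖ < 1) (hq0 : q ≠ 0) (hr : r ≠ 0) :
    ∀ᶠ x in Filter.codiscrete ℂ, gMero q r (ePi (2 * x)) / gMero q r (ePi (2 * x))⁻¹
      = r⁻¹ * (thetaQuot q (r⁻¹ * ePi (2 * x)) / thetaQuot q (r * ePi (2 * x))) := by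
  have ha : ‖q ^ 4‖ < 1 := norm_pow_lt_one hq (by norm_num)
  have h := eventually_qPoch_ne_zero ha
  filter_upwards [(h r⁻¹).1, (h (q ^ 2 * r)).1, (h (q ^ 2 * r⁻¹)).2, (h (q ^ 4 * r)).2, (h r⁻¹).2,
    (h (q ^ 2 * r)).2, (h r).1, (h 1).1] with x h1 h2 h3 h4 h5 h6 h7 h8
  refine gMero_div_gMero_inv hq hq0 (ePi_ne_zero _) hr (fun hy => h8 ?_) h1 h2 h3 h4 h5 h6 h7
  rw [hy, one_mul, qPoch_eq_mul ha, sub_self, zero_mul]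

lemma eventually_thetaQuot_ne_zero (hq : ‖q‖ < 1) (r : ℂ) :
    ∀ᶠ x in Filter.codiscrete ℂ, thetaQuot q (r * ePi (2 * x)) ≠ 0 := by
  have ha : ‖q ^ 4‖ < 1 := norm_pow_lt_one hq (by norm_num)
  filter_upwards [(eventually_Theta_ne_zero ha (q ^ 2 * r)).1, (eventually_Theta_ne_zero ha r).1]
    with x h1 h2
  rw [mul_assoc] at h1
  exact div_ne_zero h1 h2

end

/-- The ratio `g^{(k)}(y) / g^{(k)}(1/y)` for `r = p^k`. -/
noncomputable def gRatio (q r y : ℂ) : ℂ := r⁻¹ * (thetaQuot q (r⁻¹ * y) / thetaQuot q (r * y))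

/-- One more step multiplies by `𝒰(p^{-(M+1)/2}x)/𝒰(p^{M/2}x)` up to signs of the half powers, a
ratio of squared theta quotients. It replaces the boundary term at `p^{-M}` by that at `p^{-(M+1)}`
and contributes one squared `gRatio`. -/
lemma inv_FFun_mul_FFun_neg_natCast {ζ : ℂ} (hq : ‖ePi ζ‖ < 1) (τ x : ℂ) (M : ℕ)
    (h : ∀ k ∈ Finset.range (M + 1), thetaQuot (ePi ζ) ((ePi (2 * τ) ^ k)⁻¹ * ePi (2 * x)) ≠ 0) :
    (FFun 2 ζ τ (M : ℤ) x * FFun 2 ζ τ (-(M : ℤ)) x)⁻¹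
      = (ePi (2 * τ) ^ M)⁻¹ * (thetaQuot (ePi ζ) ((ePi (2 * τ) ^ M)⁻¹ * ePi (2 * x)) ^ 2
          / thetaQuot (ePi ζ) (ePi (2 * x)) ^ 2)
        * (∏ k ∈ Finset.range M, gRatio (ePi ζ) (ePi (2 * τ) ^ k) (ePi (2 * x))) ^ 2 := by
  have hq0 := ePi_ne_zero ζ
  have hp0 := ePi_ne_zero (2 * τ)
  have hy := ePi_ne_zero (2 * x)
  have h0 := h 0 (by simp)
  rw [pow_zero, inv_one, one_mul] at h0
  induction M with
  | zero =>
    have e : FFun 2 ζ τ ((0 : ℕ) : ℤ) x = 1 := FFun_zero ζ τ x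
    have e' : FFun 2 ζ τ (-((0 : ℕ) : ℤ)) x = 1 := by simpa using FFun_zero (N := 2) ζ τ x
    rw [e, e']
    simp [h0]
  | succ M ih =>
    have ih' := ih fun k hk => h k (by simp at hk ⊢; omega)
    have hM := h M (by simp)
    have e1 := FFun_natCast_succ (N := 2) ζ τ M x
    have e2 := FFun_neg_natCast_sub_one (N := 2) ζ τ M x
    have e3 := ePi_two_mul_sub_natCast τ x (M + 1)
    push_cast at e3 ⊢
    rw [neg_add, ← sub_eq_add_neg, e1, e2, Finset.prod_range_succ, mul_pow,
      show ∀ A B C D : ℂ, (A * B * (C * D⁻¹))⁻¹ = (A * C)⁻¹ * (B⁻¹ * D) by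
        intros; simp only [mul_inv, inv_inv]; ring, ih', gRatio,
      UFun_two ζ _ hq, UFun_two ζ _ hq, ePi_two_mul_add_natCast, e3, inv_pow]
    generalize ePi (2 * x) = y at *
    generalize ePi (2 * τ) = p at *
    generalize ePi ζ = q at *
    have hpM : p ^ M ≠ 0 := pow_ne_zero M hp0
    generalize thetaQuot q (p ^ M * y) = A at *
    generalize thetaQuot q ((p ^ M)⁻¹ * y) = B at *
    generalize thetaQuot q ((p ^ (M + 1))⁻¹ * y) = C at *
    generalize thetaQuot q y = D at *
    rw [pow_succ]
    generalize p ^ M = r at *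
    generalize ∏ k ∈ Finset.range M, gRatio q (p ^ k) y = E at *
    -- If this theta quotient vanishes, both sides are `0` by the convention for division by zero,
    -- so no hypothesis at positive powers is needed.
    by_cases hA : A = 0
    · simp [hA]
    · field_simp

lemma inv_FFun_mul_FFun_neg {ζ : ℂ} (hq : ‖ePi ζ‖ < 1) (τ x : ℂ) (m : ℤ)
    (h : ∀ k ∈ Finset.range (m.natAbs + 1),
      thetaQuot (ePi ζ) ((ePi (2 * τ) ^ k)⁻¹ * ePi (2 * x)) ≠ 0) :
    (FFun 2 ζ τ m x * FFun 2 ζ τ (-m) x)⁻¹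
      = (ePi (2 * τ) ^ m.natAbs)⁻¹ * (thetaQuot (ePi ζ) ((ePi (2 * τ) ^ m.natAbs)⁻¹ * ePi (2 * x)) ^ 2
          / thetaQuot (ePi ζ) (ePi (2 * x)) ^ 2)
        * (∏ k ∈ Finset.Ico 1 m.natAbs, gRatio (ePi ζ) (ePi (2 * τ) ^ k) (ePi (2 * x))) ^ 2 := by
  have h0 := h 0 (by simp)
  rw [pow_zero, inv_one, one_mul] at h0
  -- The factor `k = 0` is `1`, since `gRatio` at `r = 1` is a nonzero theta quotient divided by
  -- itself.
  have e : ∏ k ∈ Finset.range m.natAbs, gRatio (ePi ζ) (ePi (2 * τ) ^ k) (ePi (2 * x))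
      = ∏ k ∈ Finset.Ico 1 m.natAbs, gRatio (ePi ζ) (ePi (2 * τ) ^ k) (ePi (2 * x)) := by
    rcases Nat.eq_zero_or_pos m.natAbs with hm | hm
    · simp [hm]
    · rw [Finset.range_eq_Ico, Finset.prod_eq_prod_Ico_succ_bot hm]
      simp [gRatio, h0]
  rw [← e, ← inv_FFun_mul_FFun_neg_natCast hq τ x _ h]
  obtain ⟨n, rfl | rfl⟩ := m.eq_nat_or_neg
  · simp
  · simp [mul_comm]

section

variable {N : ℕ} {ζ τ c : ℂ} {m n : ℤ}

/-- On the surface, `Θ`-quotients at `p^{±|m|}` and `p^{*±|n|}` are related. -/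
lemma OnSurface.thetaQuot_eq (hS : OnSurface 2 ζ τ c m n) (hζ : 0 < ζ.im) {y : ℂ} (hy : y ≠ 0) :
    thetaQuot (ePi ζ) (ePi (2 * τ) ^ m.natAbs * y)
        * thetaQuot (ePi ζ) ((ePi (2 * τ) ^ m.natAbs)⁻¹ * y)
      = thetaQuot (ePi ζ) (ePi (2 * tauStar ζ τ c) ^ n.natAbs * y)
        * thetaQuot (ePi ζ) ((ePi (2 * tauStar ζ τ c) ^ n.natAbs)⁻¹ * y) := by
  have hq := norm_ePi_lt_one hζ
  have hq0 := ePi_ne_zero ζ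
  have habs : ∀ (p : ℂ) (k : ℤ), thetaQuot (ePi ζ) (p ^ k.natAbs * y)
      * thetaQuot (ePi ζ) ((p ^ k.natAbs)⁻¹ * y)
      = thetaQuot (ePi ζ) (p ^ k * y) * thetaQuot (ePi ζ) ((p ^ k)⁻¹ * y) := fun p k => by
    obtain ⟨j, rfl | rfl⟩ := k.eq_nat_or_neg
    · simp
    · simp [mul_comm]
  -- Squaring the surface relation removes the signs: `q⁴ p^m = p*^{-n}`, a shift by exactly the
  -- nome.
  have hsurf : ePi ζ ^ 4 * ePi (2 * τ) ^ m = (ePi (2 * tauStar ζ τ c) ^ n)⁻¹ := by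
    have e (u : ℂ) (k : ℤ) : ((-ePi u) ^ k) ^ 2 = ePi (2 * u) ^ k := by
      rw [ePi_two_mul, ← neg_sq (ePi u), pow_two, pow_two, mul_zpow]
    have h1 := congrArg (fun w => w ^ 2) hS.1
    simp only [mul_pow, e] at h1
    have h2 := zpow_ne_zero n (ePi_ne_zero (2 * tauStar ζ τ c))
    rw [← mul_eq_one_iff_eq_inv₀ h2, mul_assoc, h1, zpow_neg, zpow_natCast]
    field_simp
  rw [habs, habs, ← thetaQuot_mul_inv hq hq0 hy (zpow_ne_zero m (ePi_ne_zero _)), hsurf, inv_inv,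
    mul_comm]

theorem YFun_eq_gFun (hζ : 0 < ζ.im) (hτ : 0 < τ.im) (hτs : 0 < (tauStar ζ τ c).im)
    (hS : OnSurface 2 ζ τ c m n) :
    ∃ g gs : ℕ → ℂ → ℂ,
      (∀ k, IsGFun (ePi (2 * τ)) (ePi ζ) k (g k)) ∧
      (∀ k, IsGFun (ePi (2 * tauStar ζ τ c)) (ePi ζ) k (gs k)) ∧
      ∀ᶠ x in Filter.codiscrete ℂ,
        YFun 2 ζ τ c m n x = gFun g gs m n (ePi (2 * x)) / gFun g gs m n (ePi (-(2 * x))) := by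
  have hq := norm_ePi_lt_one hζ
  have hq0 := ePi_ne_zero ζ
  refine ⟨fun k => gMero (ePi ζ) (ePi (2 * τ) ^ k), fun k => gMero (ePi ζ) (ePi (2 * tauStar ζ τ c) ^ k),
    isGFun_gMero hq (norm_p_lt_one hτ) (ePi_ne_zero _),
    isGFun_gMero hq (norm_p_lt_one hτs) (ePi_ne_zero _), ?_⟩
  have hev : ∀ (σ : ℂ) (M : ℕ), ∀ᶠ x in Filter.codiscrete ℂ, ∀ k ∈ Finset.range (M + 1),
      (gMero (ePi ζ) (ePi (2 * σ) ^ k) (ePi (2 * x)) / gMero (ePi ζ) (ePi (2 * σ) ^ k) (ePi (2 * x))⁻¹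
        = gRatio (ePi ζ) (ePi (2 * σ) ^ k) (ePi (2 * x))) ∧
      thetaQuot (ePi ζ) (ePi (2 * σ) ^ k * ePi (2 * x)) ≠ 0 ∧
      thetaQuot (ePi ζ) ((ePi (2 * σ) ^ k)⁻¹ * ePi (2 * x)) ≠ 0 := fun σ M =>
    (Finset.range (M + 1)).eventually_all.mpr fun k _ =>
      (eventually_gMero_div hq hq0 (pow_ne_zero k (ePi_ne_zero _))).and
        ((eventually_thetaQuot_ne_zero hq _).and (eventually_thetaQuot_ne_zero hq _))
  filter_upwards [hev τ m.natAbs, hev (tauStar ζ τ c) n.natAbs] with x h1 h2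
  have hy := ePi_ne_zero (2 * x)
  have k1 := inv_FFun_mul_FFun_neg hq τ x m fun k hk => (h1 k hk).2.2
  have k2 := inv_FFun_mul_FFun_neg hq (tauStar ζ τ c) x n fun k hk => (h2 k hk).2.2
  have k3 := hS.thetaQuot_eq hζ hy
  have hprod : ∀ (σ : ℂ) (M : ℕ), (∀ k ∈ Finset.range (M + 1),
      gMero (ePi ζ) (ePi (2 * σ) ^ k) (ePi (2 * x)) / gMero (ePi ζ) (ePi (2 * σ) ^ k) (ePi (2 * x))⁻¹
        = gRatio (ePi ζ) (ePi (2 * σ) ^ k) (ePi (2 * x))) →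
      ∏ k ∈ Finset.Ico 1 M, gRatio (ePi ζ) (ePi (2 * σ) ^ k) (ePi (2 * x))
        = (∏ k ∈ Finset.Ico 1 M, gMero (ePi ζ) (ePi (2 * σ) ^ k) (ePi (2 * x)))
          / ∏ k ∈ Finset.Ico 1 M, gMero (ePi ζ) (ePi (2 * σ) ^ k) (ePi (2 * x))⁻¹ := by
    intro σ M h
    rw [← Finset.prod_div_distrib]
    refine Finset.prod_congr rfl fun k hk => (h k ?_).symm
    simp at hk ⊢; omega
  have p1 := hprod τ m.natAbs fun k hk => (h1 k hk).1
  have p2 := hprod (tauStar ζ τ c) n.natAbs fun k hk => (h2 k hk).1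
  obtain ⟨a1, a2, a3⟩ := h1 m.natAbs (by simp)
  obtain ⟨b1, b2, b3⟩ := h2 n.natAbs (by simp)
  have c0 := (h1 0 (by simp)).2.1
  rw [pow_zero, one_mul] at c0
  have hr := pow_ne_zero m.natAbs (ePi_ne_zero (2 * τ))
  have hr' := pow_ne_zero n.natAbs (ePi_ne_zero (2 * tauStar ζ τ c))
  have hY : YFun 2 ζ τ c m n x
      = (FFun 2 ζ τ m x * FFun 2 ζ τ (-m) x)⁻¹
        * ((FFun 2 ζ (tauStar ζ τ c) n x * FFun 2 ζ (tauStar ζ τ c) (-n) x)⁻¹)⁻¹ := by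
    rw [YFun, inv_inv, div_eq_inv_mul]
  have hG : ∀ A A' B B' C C' D D' : ℂ, A * B⁻¹ * C ^ 2 * (D ^ 2)⁻¹ / (A' * B'⁻¹ * C' ^ 2 * (D' ^ 2)⁻¹)
      = (A / A') * (B / B')⁻¹ * (C / C') ^ 2 * ((D / D') ^ 2)⁻¹ := fun A A' B B' C C' D D' => by
    simp only [div_eq_mul_inv, mul_inv, mul_pow, inv_pow, inv_inv]; ring
  rw [hY, k1, k2, gFun, gFun, ePi_neg, hG, a1, b1, ← p1, ← p2, gRatio, gRatio]
  generalize ∏ k ∈ Finset.Ico 1 m.natAbs, gRatio (ePi ζ) (ePi (2 * τ) ^ k) (ePi (2 * x)) = E₁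
  generalize ∏ k ∈ Finset.Ico 1 n.natAbs,
    gRatio (ePi ζ) (ePi (2 * tauStar ζ τ c) ^ k) (ePi (2 * x)) = E₂
  generalize thetaQuot (ePi ζ) (ePi (2 * τ) ^ m.natAbs * ePi (2 * x)) = A₁ at *
  generalize thetaQuot (ePi ζ) ((ePi (2 * τ) ^ m.natAbs)⁻¹ * ePi (2 * x)) = A₂ at *
  generalize thetaQuot (ePi ζ) (ePi (2 * tauStar ζ τ c) ^ n.natAbs * ePi (2 * x)) = B₁ at *
  generalize thetaQuot (ePi ζ) ((ePi (2 * tauStar ζ τ c) ^ n.natAbs)⁻¹ * ePi (2 * x)) = B₂ at *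
  generalize thetaQuot (ePi ζ) (ePi (2 * x)) = D at *
  generalize ePi (2 * τ) ^ m.natAbs = r at *
  generalize ePi (2 * tauStar ζ τ c) ^ n.natAbs = r' at *
  -- The surface relation `A₁A₂ = B₁B₂` turns the squared boundary terms into the quotients
  -- occurring in `g^{(|m|)}` and `g^{*(|n|)}`. This is why these two enter to the first power and
  -- the inner factors squared.
  have e1 : A₂ ^ 2 / D ^ 2 * (D ^ 2 / B₂ ^ 2) = (A₂ / A₁) * (B₁ / B₂) := by
    field_simp
    linear_combination k3
  calc _ = r⁻¹ * r' * (A₂ ^ 2 / D ^ 2 * (D ^ 2 / B₂ ^ 2)) * E₁ ^ 2 * (E₂ ^ 2)⁻¹ := by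
        simp only [mul_inv, inv_inv, inv_div]; ring
    _ = _ := by
        rw [e1]; simp only [mul_inv, inv_inv, inv_div]; ring

/-! ### The quadratic exchange relations -/

lemma FFun_neg_add (ζ τ : ℂ) (m : ℤ) (x : ℂ) :
    FFun N ζ τ (-m) (x + m * (τ + 1)) = (FFun N ζ τ m x)⁻¹ := by
  have h := FFun_sub_mul (N := N) ζ τ (-m) x
  rw [neg_neg] at h
  rw [← h]; congr 1; push_cast; ring

variable [NeZero N]

lemma eventually_factor_ne_zero (hζ : 0 < ζ.im) (m n : ℤ) :
    ∀ᶠ x in Filter.codiscrete ℂ, FFun N ζ τ (-m) x / FFun N ζ (tauStar ζ τ c) n x ≠ 0 := by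
  filter_upwards [eventually_FFun_ne_zero (N := N) hζ τ (-m),
    eventually_FFun_ne_zero (N := N) hζ (tauStar ζ τ c) n] with x h1 h2
  exact div_ne_zero h1 h2

/-- With `f = 𝓕_{-m}/𝓕*_n` the scalar is `f(x - n(τ*+1))/f(x)`. The starred part of the shifted `f`
gives `𝓕*_{-n}` by telescoping, the other part `𝓕_m⁻¹` by the surface relation. -/
theorem t_mul_t (hζ : 0 < ζ.im) (hτ : 0 < τ.im) (hτs : 0 < (tauStar ζ τ c).im)
    (hS : OnSurface N ζ τ c m n) :
    ∀ᶠ x in Filter.codiscrete ℂ, ∀ v : ℂ, t N ζ τ c m n (v + x) * t N ζ τ c m n v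
      = YFun N ζ τ c m n x • (t N ζ τ c m n v * t N ζ τ c m n (v + x)) := by
  filter_upwards [exchange_t (m := m) (n := n) (eventually_factor_ne_zero hζ m n)
    (t_mul_LMat hζ hτ hτs hS)] with x hx v
  rw [hx, hS.FFun_add_left hζ, FFun_sub_mul, YFun]
  congr 1
  simp only [div_eq_mul_inv, mul_inv, inv_inv]; ring

theorem tStar_mul_tStar (hζ : 0 < ζ.im) (hτ : 0 < τ.im) (hτs : 0 < (tauStar ζ τ c).im)
    (hS : OnSurface N ζ τ c m n) :
    ∀ᶠ x in Filter.codiscrete ℂ, ∀ v : ℂ, tStar N ζ τ c (-n) (-m) (v + x) * tStar N ζ τ c (-n) (-m) v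
      = YFun N ζ τ c m n x • (tStar N ζ τ c (-n) (-m) v * tStar N ζ τ c (-n) (-m) (v + x)) := by
  have h0 : ∀ᶠ x in Filter.codiscrete ℂ, FFun N ζ (tauStar ζ τ c) n x / FFun N ζ τ (-m) x ≠ 0 :=
    (eventually_factor_ne_zero hζ m n).mono fun x hx => by
      rw [← inv_div]; exact inv_ne_zero hx
  filter_upwards [exchange_tStar (m := m) (n := n) h0 (tStar_mul_LMat hζ hτ hτs hS)] with x hx v
  rw [hx, hS.FFun_add_right hζ, FFun_neg_add, YFun]
  congr 1
  simp only [div_eq_mul_inv, mul_inv, inv_inv]; ring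

/-- The scalar is `f(x)/f(x + m(τ+1))` with the same `f`. For `tStar_mul_tStar` the linear factor is
`1/f`, hence the inverse structure function here. -/
theorem t_mul_tStar (hζ : 0 < ζ.im) (hτ : 0 < τ.im) (hτs : 0 < (tauStar ζ τ c).im)
    (hS : OnSurface N ζ τ c m n) :
    ∀ᶠ x in Filter.codiscrete ℂ, ∀ v : ℂ, t N ζ τ c m n (v + x) * tStar N ζ τ c (-n) (-m) v
      = (YFun N ζ τ c m n x)⁻¹ • (tStar N ζ τ c (-n) (-m) v * t N ζ τ c m n (v + x)) := by
  filter_upwards [exchange_tStar (m := m) (n := n) (eventually_factor_ne_zero hζ m n)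
    (t_mul_LMat hζ hτ hτs hS)] with x hx v
  rw [hx, hS.FFun_add_right hζ, FFun_neg_add, YFun]
  congr 1
  simp only [div_eq_mul_inv, mul_inv, inv_inv]; ring

end

end EllipticGL

theorem mainTheorem1 (N : ℕ) (hN : 2 ≤ N) (ζ τ c : ℂ)
    (hζ : 0 < ζ.im) (hτ : 0 < τ.im) (hτs : 0 < (EllipticGL.tauStar ζ τ c).im)
    (m n : ℤ) (hn : n ≠ 0) (hS : EllipticGL.OnSurface N ζ τ c m n) :
    -- exchange of `t_{mn}(z)` and of `t^*_{-n,-m}(z)` with `L(w)`; here `z = e^{iπ(v+x)}`,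
    -- `w = e^{iπv}`, so that `z/w = e^{iπx}`
    (∀ᶠ x in Filter.codiscrete ℂ, ∀ (v : ℂ) (i j : Fin N),
      EllipticGL.t N ζ τ c m n (v + x) * EllipticGL.LMat N ζ τ c v i j
        = (EllipticGL.FFun N ζ τ (-m) x / EllipticGL.FFun N ζ (EllipticGL.tauStar ζ τ c) n x) •
          (EllipticGL.LMat N ζ τ c v i j * EllipticGL.t N ζ τ c m n (v + x))) ∧
    (∀ᶠ x in Filter.codiscrete ℂ, ∀ (v : ℂ) (i j : Fin N),
      EllipticGL.tStar N ζ τ c (-n) (-m) (v + x) * EllipticGL.LMat N ζ τ c v i j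
        = (EllipticGL.FFun N ζ (EllipticGL.tauStar ζ τ c) n x / EllipticGL.FFun N ζ τ (-m) x) •
          (EllipticGL.LMat N ζ τ c v i j * EllipticGL.tStar N ζ τ c (-n) (-m) (v + x))) ∧
    -- the quadratic exchange relations
    (∀ᶠ x in Filter.codiscrete ℂ, ∀ v : ℂ,
      EllipticGL.t N ζ τ c m n (v + x) * EllipticGL.t N ζ τ c m n v
        = EllipticGL.YFun N ζ τ c m n x •
          (EllipticGL.t N ζ τ c m n v * EllipticGL.t N ζ τ c m n (v + x))) ∧
    (∀ᶠ x in Filter.codiscrete ℂ, ∀ v : ℂ,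
      EllipticGL.tStar N ζ τ c (-n) (-m) (v + x) * EllipticGL.tStar N ζ τ c (-n) (-m) v
        = EllipticGL.YFun N ζ τ c m n x •
          (EllipticGL.tStar N ζ τ c (-n) (-m) v * EllipticGL.tStar N ζ τ c (-n) (-m) (v + x))) ∧
    (∀ᶠ x in Filter.codiscrete ℂ, ∀ v : ℂ,
      EllipticGL.t N ζ τ c m n (v + x) * EllipticGL.tStar N ζ τ c (-n) (-m) v
        = (EllipticGL.YFun N ζ τ c m n x)⁻¹ •
          (EllipticGL.tStar N ζ τ c (-n) (-m) v * EllipticGL.t N ζ τ c m n (v + x))) ∧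
    -- theta function form of the structure functions `𝓕_a`, `𝓕_{-a}` (and of `𝓕^*`, at `σ = τ^*`)
    (∀ σ ∈ ({τ, EllipticGL.tauStar ζ τ c} : Set ℂ), ∀ a : ℕ, 0 < a → ∀ x : ℂ,
      let Θ := EllipticGL.Theta (EllipticGL.ePi ζ ^ (2 * N))
      let q := EllipticGL.ePi ζ
      let p := EllipticGL.ePi (2 * σ)
      let y := EllipticGL.ePi (2 * x)
      EllipticGL.FFun N ζ σ a x
          = EllipticGL.ePi (ζ * (a * (2 / N - 2))) * ∏ k ∈ Finset.range a,
              (Θ (q ^ 2 * p ^ k * y) * Θ (q ^ 2 * p⁻¹ ^ k * y⁻¹))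
                / (Θ (p ^ k * y) * Θ (p⁻¹ ^ k * y⁻¹)) ∧
        EllipticGL.FFun N ζ σ (-a) x
          = EllipticGL.ePi (-(ζ * (a * (2 / N - 2)))) * ∏ k ∈ Finset.Icc 1 a,
              (Θ (p⁻¹ ^ k * y) * Θ (p ^ k * y⁻¹))
                / (Θ (q ^ 2 * p⁻¹ ^ k * y) * Θ (q ^ 2 * p ^ k * y⁻¹))) ∧
    (∀ x : ℂ, EllipticGL.YFun N ζ τ c m n x = EllipticGL.YFun N ζ τ c (-m) (-n) x) ∧
    -- the factorised form for `N = 2`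
    (N = 2 → ∃ g gs : ℕ → ℂ → ℂ,
      (∀ k, EllipticGL.IsGFun (EllipticGL.ePi (2 * τ)) (EllipticGL.ePi ζ) k (g k)) ∧
      (∀ k, EllipticGL.IsGFun (EllipticGL.ePi (2 * EllipticGL.tauStar ζ τ c))
        (EllipticGL.ePi ζ) k (gs k)) ∧
      ∀ᶠ x in Filter.codiscrete ℂ,
        EllipticGL.YFun N ζ τ c m n x
          = EllipticGL.gFun g gs m n (EllipticGL.ePi (2 * x))
            / EllipticGL.gFun g gs m n (EllipticGL.ePi (-(2 * x)))) := by
  have : NeZero N := ⟨by omega⟩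
  refine ⟨EllipticGL.t_mul_LMat hζ hτ hτs hS, EllipticGL.tStar_mul_LMat hζ hτ hτs hS,
    EllipticGL.t_mul_t hζ hτ hτs hS, EllipticGL.tStar_mul_tStar hζ hτ hτs hS,
    EllipticGL.t_mul_tStar hζ hτ hτs hS, fun σ _ a _ x => EllipticGL.FFun_eq_prod_Theta σ a x,
    EllipticGL.YFun_neg, fun hN2 => ?_⟩
  subst hN2
  exact EllipticGL.YFun_eq_gFun hζ hτ hτs hS
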